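/- Let $N\ge 1$. For $\gamma=\begin{pmatrix}a&b\\c&d\end{pmatrix}\in\Gamma_0(N)$ put $\mu_\gamma(z_1,z_2)=cz_1z_2+dz_2+az_1+b$. Let $\Gamma_\infty=\{\begin{pmatrix}1&b\\0&1\end{pmatrix}: b\in\mathbb Z\}$. For $z,z_1,z_2$ in the upper half-plane, $r'\in\mathbb Z\setminus\{0\}$ and $\Re(s)>1$ put $$\Xi_N(z_1,z_2,s)=\frac12\sum_{\gamma\in\Gamma_0(N)}\frac{\overline{\mu_\gamma(z_1,-z_2)}\;\overline{\mu_\gamma(z_1,-\bar z_2)}}{|\mu_\gamma(z_1,-z_2)|^{2s}\,|\mu_\gamma(z_1,-\bar z_2)|^{2s}},$$ $$E_N^\infty(z,s)=\frac12\sum_{\gamma\in\Gamma_\infty\backslash\Gamma_0(N)}\frac{(c\bar z+d)^2}{|cz+d|^{2s+2}},\qquad P^\infty_{N,r'}(z,s)=\frac12\sum_{\gamma\in\Gamma_\infty\backslash\Gamma_0(N)}\frac{e^{-2\pi i r'\gamma z}}{(cz+d)^2|cz+d|^{2s-2}},$$ and $\Xi_N(z_1,z_2)=\lim_{s\to1}\Xi_N(z_1,z_2,s)$.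 All limits are taken as $s\to 1$ in the half-plane $\Re(s)>1$. Put $\varphi(N)=N\prod_{\ell\mid N}(1+1/\ell)$ (product over primes $\ell$), $K(a,b;n)=\sum_{m \bmod n,\ (m,n)=1} e^{2\pi i(am+bm^*)/n}$ with $mm^*\equiv1\pmod n$, and let $J_1$, $I_1$ be the Bessel function and the modified Bessel function. Define $e_{0,N}=1-\dfrac{3}{\pi\varphi(N)\,\Im(z_1)}$ and, for $r>0$, $r'\neq0$, $$e_{r,N}=-4\pi^2 r\sum_{\substack{c>0\\ N\mid c}}\frac1{c^2}\sum_{l\mid (c,r)}\mu\!\left(\frac cl\right)l,\qquad p_{r',N}(r)=-2\pi\sqrt{\frac r{|r'|}}\sum_{\substack{c>0\\ N\mid c}}\frac{K(-r,r';c)}{c}\,B_{r'}\!\left(\frac{4\pi\sqrt{r|r'|}}{c}\right),$$ where $\mu$ is the Möbius function, $B_{r'}=I_1$ if $r'>0$ and $B_{r'}=J_1$ if $r'<0$. **Theorem.** Let $z_1,z_2$ be in the upper half-plane with $\Im(z_2)>\Im(\gamma z_1)$ for all $\gamma\in\Gamma_0(N)$, and let $p=e^{2\pi i z_1}$, $q=e^{2\pi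 i z_2}$, $\tilde q=e^{2\pi i\bar z_2}$. The series defining $\Xi_N(z_1,z_2,s)$, $E_N^\infty(z_1,s)$ and $P^\infty_{N,r'}(z_1,s)$ converge absolutely for $\Re(s)>1$, the series defining $p_{r',N}(r)$ converge absolutely, the limit $\Xi_N(z_1,z_2)$ exists, and $$\lim_{s\to1}E_N^\infty(z_1,s)=\sum_{r\ge0}e_{r,N}\,p^r,\qquad \lim_{s\to1}P^\infty_{N,r'}(z_1,s)=p^{-r'}+\sum_{r>0}p_{r',N}(r)\,p^r\quad(r'\ne0).$$ Moreover $$\frac{1}{2\pi i}\,\Xi_N(z_1,z_2)(z_2-\bar z_2)=\sum_{r\ge0}e_{r,N}\,p^r+\sum_{r'>0}\Bigl(p^{-r'}+\sum_{r>0}p_{r',N}(r)\,p^r\Bigr)q^{r'}+\sum_{r'<0}\Bigl(p^{-r'}+\sum_{r>0}p_{r',N}(r)\,p^r\Bigr)\tilde q^{\,r'}.$$ Here the terms $p^{-r'}q^{r'}$ ($r'>0$), the terms $p^{-r'}\tilde q^{\,r'}$ ($r'<0$), the terms $\bigl(\sum_{r>0}p_{r',N}(r)p^r\bigr)q^{r'}$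 ($r'>0$) and the double family $p_{r',N}(r)p^r\tilde q^{\,r'}$ ($r>0$, $r'<0$) are absolutely summable. The double family $p_{r',N}(r)p^rq^{r'}$ ($r,r'>0$) is absolutely summable if $N^2\,\Im(z_1)\Im(z_2)>1$. Also $$\frac{1}{2\pi i}\,\Xi_N(z_1,z_2)(z_2-\bar z_2)=\lim_{s\to1}\Bigl(E_N^\infty(z_1,s)+\sum_{r'>0}P^\infty_{N,r'}(z_1,s)\,q^{r'}+\sum_{r'<0}P^\infty_{N,r'}(z_1,s)\,\tilde q^{\,r'}\Bigr),$$ where both sums over $r'$ converge absolutely for $\Re(s)>1$. -/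

import Mathlib

open Complex UpperHalfPlane Filter Topology
open scoped MatrixGroups

noncomputable section

namespace CauchyKernel

open CongruenceSubgroup

/-- `μ_γ(z, w) = c z w + d w + a z + b` for `γ = (a b; c d)`. -/
def mu (γ : SL(2, ℤ)) (z w : ℂ) : ℂ :=
  (γ 1 0 : ℂ) * z * w + (γ 1 1 : ℂ) * w + (γ 0 0 : ℂ) * z + (γ 0 1 : ℂ)

/-- The filter `s → 1` inside the half-plane `Re s > 1` of absolute convergence. -/
def toOne : Filter ℂ := 𝓝[{s : ℂ | 1 < s.re}] 1

/-- The summand of the series `Ξ_N(z₁, z₂, s)`. -/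
def xiTerm (z₁ z₂ : ℍ) (s : ℂ) (γ : SL(2, ℤ)) : ℂ :=
  starRingEnd ℂ (mu γ z₁ (-(z₂ : ℂ))) * starRingEnd ℂ (mu γ z₁ (-(starRingEnd ℂ (z₂ : ℂ)))) /
    (((‖mu γ z₁ (-(z₂ : ℂ))‖ : ℝ) : ℂ) ^ (2 * s) *
      ((‖mu γ z₁ (-(starRingEnd ℂ (z₂ : ℂ)))‖ : ℝ) : ℂ) ^ (2 * s))

/-- `Ξ_N(z₁, z₂, s)`. -/
def xiSeries (N : ℕ) (z₁ z₂ : ℍ) (s : ℂ) : ℂ :=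
  (1 / 2) * ∑' γ : Gamma0 N, xiTerm z₁ z₂ s γ

/-- The modular Cauchy kernel `Ξ_N(z₁, z₂) = lim_{s → 1} Ξ_N(z₁, z₂, s)`. -/
def Xi (N : ℕ) (z₁ z₂ : ℍ) : ℂ :=
  limUnder toOne (xiSeries N z₁ z₂)

/-- `Γ_∞ = {(1 b; 0 1)}`, as a subgroup of `Γ₀(N)`. -/
def GammaInf (N : ℕ) : Subgroup (Gamma0 N) :=
  (Subgroup.zpowers ModularGroup.T).subgroupOf (Gamma0 N)

/-- The set `Γ_∞ \ Γ₀(N)` of cosets `Γ_∞ γ`. -/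
abbrev Cosets (N : ℕ) : Type := Quotient (QuotientGroup.rightRel (GammaInf N))

/-- The automorphy factor `c z + d`. -/
def autom (γ : SL(2, ℤ)) (z : ℍ) : ℂ := (γ 1 0 : ℂ) * z + (γ 1 1 : ℂ)

/-- The summand of the Eisenstein series at the cusp `i∞`. -/
def eisTerm (z : ℍ) (s : ℂ) (γ : SL(2, ℤ)) : ℂ :=
  (starRingEnd ℂ (autom γ z)) ^ 2 / ((‖autom γ z‖ : ℝ) : ℂ) ^ (2 * s + 2)

/-- The summand of the Poincaré series at the cusp `i∞` with parameter `r'`. -/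
def poincareTerm (r' : ℤ) (z : ℍ) (s : ℂ) (γ : SL(2, ℤ)) : ℂ :=
  exp (-2 * Real.pi * Complex.I * r' * ((γ • z : ℍ) : ℂ)) /
    ((autom γ z) ^ 2 * ((‖autom γ z‖ : ℝ) : ℂ) ^ (2 * s - 2))

lemma exists_zpow_of_rel {N : ℕ} {x y : Gamma0 N}
    (h : (QuotientGroup.rightRel (GammaInf N)) x y) :
    ∃ n : ℤ, (y : SL(2, ℤ)) = ModularGroup.T ^ n * (x : SL(2, ℤ)) := by
  rw [QuotientGroup.rightRel_apply, GammaInf, Subgroup.mem_subgroupOf,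
    Subgroup.mem_zpowers_iff] at h
  obtain ⟨n, hn⟩ := h
  exact ⟨n, by rw [hn]; simp⟩

lemma autom_T_zpow_mul (n : ℤ) (γ : SL(2, ℤ)) (z : ℍ) :
    autom (ModularGroup.T ^ n * γ) z = autom γ z := by
  simp [autom]

lemma eisTerm_wd {N : ℕ} (z : ℍ) (s : ℂ) (x y : Gamma0 N)
    (h : (QuotientGroup.rightRel (GammaInf N)) x y) :
    eisTerm z s x = eisTerm z s y := by
  obtain ⟨n, hn⟩ := exists_zpow_of_rel h
  rw [hn, eisTerm, eisTerm, autom_T_zpow_mul]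

lemma poincareTerm_wd {N : ℕ} (r' : ℤ) (z : ℍ) (s : ℂ) (x y : Gamma0 N)
    (h : (QuotientGroup.rightRel (GammaInf N)) x y) :
    poincareTerm r' z s x = poincareTerm r' z s y := by
  obtain ⟨n, hn⟩ := exists_zpow_of_rel h
  rw [hn, poincareTerm, poincareTerm, autom_T_zpow_mul, mul_smul,
    ModularGroup.coe_T_zpow_smul_eq]
  congr 1
  rw [Complex.exp_eq_exp_iff_exists_int]
  exact ⟨r' * n, by push_cast; ring⟩

/-- The Eisenstein summand on a coset `Γ_∞ γ`. -/
def eisCosetTerm (N : ℕ) (z : ℍ) (s : ℂ) (x : Cosets N) : ℂ :=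
  Quotient.lift (fun γ : Gamma0 N => eisTerm z s γ) (eisTerm_wd z s) x

/-- The Poincaré summand on a coset `Γ_∞ γ`. -/
def poincareCosetTerm (N : ℕ) (r' : ℤ) (z : ℍ) (s : ℂ) (x : Cosets N) : ℂ :=
  Quotient.lift (fun γ : Gamma0 N => poincareTerm r' z s γ) (poincareTerm_wd r' z s) x

/-- The Eisenstein series `E_N^∞(z, s)`. -/
def eisSeries (N : ℕ) (z : ℍ) (s : ℂ) : ℂ :=
  (1 / 2) * ∑' x : Cosets N, eisCosetTerm N z s x

/-- The Poincaré series `P^∞_{N, r'}(z, s)`. -/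
def poincareSeries (N : ℕ) (r' : ℤ) (z : ℍ) (s : ℂ) : ℂ :=
  (1 / 2) * ∑' x : Cosets N, poincareCosetTerm N r' z s x

/-- `φ(N) = N ∏_{p ∣ N} (1 + 1/p)`, the index of `Γ₀(N)` in `SL₂(ℤ)`. -/
def phi (N : ℕ) : ℝ := N * ∏ p ∈ N.primeFactors, (1 + 1 / (p : ℝ))

/-- The Eisenstein coefficients `e_{r, N}`; the constant one depends on `Im z`. -/
def eisCoeff (N : ℕ) (z : ℍ) (r : ℕ) : ℂ :=
  if r = 0 then ((1 - 3 / (Real.pi * phi N * z.im) : ℝ) : ℂ)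
  else -4 * (Real.pi : ℂ) ^ 2 * r *
    ∑' k : ℕ+, (1 / ((N * k : ℕ) : ℂ) ^ 2) *
      ∑ l ∈ (Nat.gcd (N * k) r).divisors,
        ((ArithmeticFunction.moebius (N * k / l) : ℤ) : ℂ) * (l : ℂ)

/-- The Kloosterman sum `K(a, b; n)`: the sum of `exp (2πi (a m + b m*) / n)` over the residues
`m` modulo `n` prime to `n`, where `m m* ≡ 1` modulo `n`. -/
def kloosterman (a b : ℤ) (n : ℕ) : ℂ :=
  ∑ m ∈ (Finset.range n).filter (fun m => m.Coprime n),
    exp (2 * Real.pi * Complex.I * ((a * m + b * (((m : ZMod n)⁻¹).val : ℤ) : ℤ) : ℂ) / n)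

/-- The Bessel function `J₁`. -/
def besselJ1 (x : ℝ) : ℝ :=
  ∑' k : ℕ, (-1) ^ k * (x / 2) ^ (2 * k + 1) / (k.factorial * (k + 1).factorial)

/-- The modified Bessel function `I₁`. -/
def besselI1 (x : ℝ) : ℝ :=
  ∑' k : ℕ, (x / 2) ^ (2 * k + 1) / (k.factorial * (k + 1).factorial)

/-- The summand of `p_{r', N}(r)` at the modulus `c = N k`. -/
def poincareCoeffTerm (N : ℕ) (r' : ℤ) (r : ℕ) (k : ℕ+) : ℂ :=
  kloosterman (-r) r' (N * k) / ((N * k : ℕ) : ℂ) *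
    (((if 0 < r' then besselI1 else besselJ1)
      (4 * Real.pi * √(r * |(r' : ℝ)|) / ((N * k : ℕ) : ℝ)) : ℝ) : ℂ)

/-- The Poincaré coefficients `p_{r', N}(r)`, for `r > 0` and `r' ≠ 0`. -/
def poincareCoeff (N : ℕ) (r' : ℤ) (r : ℕ) : ℂ :=
  -2 * Real.pi * ((√(r / |(r' : ℝ)|) : ℝ) : ℂ) * ∑' k : ℕ+, poincareCoeffTerm N r' r k

end CauchyKernel

end

noncomputable section

namespace CauchyKernel

/-! ### Kloosterman sums -/

/-! Write `j = c z₁ + d`. The two factors `μ_γ` multiply to `j² (γz₁ - z₂)(γz₁ - conj z₂)`, so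
summing over the translates `T^n γ` turns `Ξ_N(z₁, z₂, s)` into an Eisenstein series of exponent `2s
- 1` whose terms are weighted by a `1`-periodic function `kerSum` of `γz₁` (`xiSeries_eq`). At `s =
1` partial fractions and the cotangent expansion make `kerSum` a sum of exponentials `e(±mγz₁)` with
coefficients `q^m` and `conj q^m` (`kerSum_one`). Weighted by the Eisenstein terms, each exponential
sums to a Poincaré series, and the constant to the Eisenstein series. Formally this is the theorem.

The obstacle is that at `s = 1` the weights have size `|j|⁻²` and the sum over cosets is not
absolutely convergent. For `c > 0` one has `γz₁ = a/c - 1/(cj)`. If `f` is Lipschitz, the weighted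
sum of `f(γz₁) - f(a/c)` is controlled by `∑ |j|⁻³`. What remains is the weighted sum of `f(a/c)`,
hence by Fourier expansion of `e(m a/c)`. Poisson summation in `d` rewrites it as `∑_c c^{-2s} ∑_r
F(r) e(rx) K(r, m; c)` (`tsum_units_lineKernel`). It stays absolutely convergent at `s = 1` as soon
as `K` saves a power of `c`; Kloosterman's fourth-moment method gives the exponent `11/12` up to a
divisor function (`norm_klo_div_sq_le`). Only `m = r = 0` escapes: there `K = φ(c)` and the
Dirichlet series has a pole at `s = 1`, but `F(0)` has a zero. Their product leaves the constant
`-3/(π φ(N) Im z₁)` (`tendsto_poleSum`).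

This splitting is used twice: with `f = e(m ·)` it gives the limits of the Eisenstein and Poincaré
series (`tendsto_twistSum`), and with `f` the difference of `kerSum` at `s` and at `1` it shows that
replacing one by the other changes nothing in the limit (`tendsto_xiSeries_sub`).

The Fourier coefficients come from evaluating, at `s = 1` and for each fixed `c`, the sum over `d`
by a Lipschitz formula twisted by `exp(-2πit/(w + n))`; expanding the exponential produces the
Bessel series (`tsum_lipschitz_exp`, `twistLim_eq`).

The sums over `r'` converge because all `Im γz₁` lie below some `Y < Im z₂` (`exists_im_smul_le`),
while the limit of the `m`-th twist grows at most like `(1 + |m|) e^{2π|m|Y}`. For `r' < 0` the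
rescaled `J₁` is bounded by `1`, so the double family converges absolutely; for `r' > 0` the growth
of `I₁` accounts for the condition on `N² Im z₁ Im z₂`. -/

/-- The Kloosterman sum as a sum over the units of `ZMod c`. -/
def klo (c : ℕ) [NeZero c] (a b : ZMod c) : ℂ :=
  ∑ u : (ZMod c)ˣ, ZMod.stdAddChar (a * (u : ZMod c) + b * ((u⁻¹ : (ZMod c)ˣ) : ZMod c))

lemma klo_symm (c : ℕ) [NeZero c] (a b : ZMod c) : klo c a b = klo c b a := by
  unfold klo
  rw [← Equiv.sum_comp (Equiv.inv (ZMod c)ˣ)]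
  refine Finset.sum_congr rfl fun u _ => ?_
  simp [add_comm]

lemma klo_neg (c : ℕ) [NeZero c] (a b : ZMod c) : klo c (-a) b = klo c a (-b) := by
  unfold klo
  rw [← Equiv.sum_comp (Equiv.neg (ZMod c)ˣ)]
  refine Finset.sum_congr rfl fun u _ => ?_
  simp

/-- Substitution `u ↦ vu`. It spreads one Kloosterman sum over a whole orbit of parameters, so that
a moment over all parameters bounds a single sum. -/
lemma klo_smul (c : ℕ) [NeZero c] (a b : ZMod c) (v : (ZMod c)ˣ) :
    klo c (a * v) (((v⁻¹ : (ZMod c)ˣ) : ZMod c) * b) = klo c a b := by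
  unfold klo
  rw [← Equiv.sum_comp (Equiv.mulLeft v) fun u : (ZMod c)ˣ =>
    ZMod.stdAddChar (a * (u : ZMod c) + b * ((u⁻¹ : (ZMod c)ˣ) : ZMod c))]
  refine Finset.sum_congr rfl fun u _ => ?_
  congr 1
  simp only [Equiv.coe_mulLeft, mul_inv, Units.val_mul]
  ring

/-- In a fixed class modulo `e` a representative below `c` is determined by its quotient by `e`,
which is less than `c / e`. -/
lemma card_fiber_cast_le {c e : ℕ} [NeZero c] (hec : e ∣ c) (t : ZMod e) :
    (Finset.univ.filter fun x : ZMod c => (x.val : ZMod e) = t).card ≤ c / e := by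
  have he : 0 < e := Nat.pos_of_dvd_of_pos hec (NeZero.pos c)
  have : NeZero e := ⟨he.ne'⟩
  rw [← Finset.card_range (c / e)]
  refine Finset.card_le_card_of_injOn (fun x => x.val / e) ?_ ?_
  · intro x _
    simp only [Finset.coe_range, Set.mem_Iio]
    exact Nat.div_lt_div_of_lt_of_dvd hec (ZMod.val_lt x)
  · intro x hx y hy hxy
    simp only [Finset.coe_filter, Finset.mem_univ, true_and, Set.mem_ofPred_eq] at hx hy hxy
    have h := (ZMod.natCast_eq_natCast_iff' _ _ _).1 (hx.trans hy.symm)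
    apply ZMod.val_injective c
    rw [← Nat.div_add_mod x.val e, ← Nat.div_add_mod y.val e, hxy, h]

/-- Factor `c = xyz` with `x ∣ A`, `y ∣ B`, `z ∣ C`; the largest of the three has cube at least `c`.
-/
lemma exists_large_dvd_factor {c : ℕ} (hc : c ≠ 0) {A B C : ℤ} (h : (c : ℤ) ∣ A * B * C) :
    ∃ e ∈ c.divisors, c ≤ e ^ 3 ∧ ((e : ℤ) ∣ A ∨ (e : ℤ) ∣ B ∨ (e : ℤ) ∣ C) := by
  obtain ⟨d, f, hd, hf, hdf⟩ := exists_dvd_and_dvd_of_dvd_mul h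
  obtain ⟨d₁, d₂, h1, h2, h12⟩ := exists_dvd_and_dvd_of_dvd_mul hd
  have hcn : c = d₁.natAbs * d₂.natAbs * f.natAbs := by
    rw [← Int.natAbs_mul, ← Int.natAbs_mul, ← h12, ← hdf]; simp
  have key : ∀ e : ℕ, e ∣ c → c ≤ e ^ 3 → ((e : ℤ) ∣ A ∨ (e : ℤ) ∣ B ∨ (e : ℤ) ∣ C) →
      ∃ e ∈ c.divisors, c ≤ e ^ 3 ∧ ((e : ℤ) ∣ A ∨ (e : ℤ) ∣ B ∨ (e : ℤ) ∣ C) :=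
    fun e h1 h2 h3 => ⟨e, Nat.mem_divisors.2 ⟨h1, hc⟩, h2, h3⟩
  set x := d₁.natAbs
  set y := d₂.natAbs
  set z := f.natAbs
  have hx : (x : ℤ) ∣ A := Int.natAbs_dvd.2 h1
  have hy : (y : ℤ) ∣ B := Int.natAbs_dvd.2 h2
  have hz : (z : ℤ) ∣ C := Int.natAbs_dvd.2 hf
  have hm : ∀ m : ℕ, x ≤ m → y ≤ m → z ≤ m → c ≤ m ^ 3 := by
    intro m h1 h2 h3
    rw [hcn, pow_succ, pow_two]
    gcongr
  rcases le_total x y with hxy | hxy <;> rcases le_total y z with hyz | hyz <;>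
    rcases le_total x z with hxz | hxz
  · exact key z (hcn ▸ Dvd.intro_left _ rfl) (hm z hxz hyz le_rfl) (Or.inr (Or.inr hz))
  · exact key z (hcn ▸ Dvd.intro_left _ rfl) (hm z (hxy.trans hyz) hyz le_rfl) (Or.inr (Or.inr hz))
  · exact key y ⟨x * z, by rw [hcn]; ring⟩ (hm y hxy le_rfl hyz) (Or.inr (Or.inl hy))
  · exact key y ⟨x * z, by rw [hcn]; ring⟩ (hm y hxy le_rfl hyz) (Or.inr (Or.inl hy))
  · exact key z (hcn ▸ Dvd.intro_left _ rfl) (hm z hxz hyz le_rfl) (Or.inr (Or.inr hz))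
  · exact key x ⟨y * z, by rw [hcn]; ring⟩ (hm x le_rfl hxy hxz) (Or.inl hx)
  · exact key x ⟨y * z, by rw [hcn]; ring⟩ (hm x le_rfl hxy (hyz.trans hxy)) (Or.inl hx)
  · exact key x ⟨y * z, by rw [hcn]; ring⟩ (hm x le_rfl hxy hxz) (Or.inl hx)

lemma div_le_rpow_of_le_pow_three {c e : ℕ} (he : 0 < e) (hce : c ≤ e ^ 3) :
    ((c / e : ℕ) : ℝ) ≤ (c : ℝ) ^ (2 / 3 : ℝ) := by
  have h1 : ((c / e : ℕ) : ℝ) ≤ (c : ℝ) / e := Nat.cast_div_le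
  refine h1.trans ?_
  rw [div_le_iff₀ (by exact_mod_cast he)]
  have h2 : (c : ℝ) ^ (1 / 3 : ℝ) ≤ e := by
    have : (c : ℝ) ≤ (e : ℝ) ^ (3 : ℝ) := by
      rw [Real.rpow_ofNat]; exact_mod_cast hce
    calc (c : ℝ) ^ (1 / 3 : ℝ) ≤ ((e : ℝ) ^ (3 : ℝ)) ^ (1 / 3 : ℝ) := by gcongr
      _ = e := by rw [← Real.rpow_mul (by positivity)]; norm_num
  rcases Nat.eq_zero_or_pos c with rfl | hc
  · simp
  · calc (c : ℝ) = (c : ℝ) ^ (2 / 3 : ℝ) * (c : ℝ) ^ (1 / 3 : ℝ) := by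
          rw [← Real.rpow_add (by exact_mod_cast hc)]; norm_num
      _ ≤ _ := by gcongr

lemma card_fiber_filter_le {c e : ℕ} [NeZero c] (hec : e ∣ c) (f : ZMod c → ZMod e) :
    (Finset.univ.filter fun p : ZMod c × ZMod c => (p.2.val : ZMod e) = f p.1).card
      ≤ c * (c / e) := by
  have h := Finset.card_le_mul_card_image_of_maps_to
    (s := Finset.univ.filter fun p : ZMod c × ZMod c => (p.2.val : ZMod e) = f p.1)
    (t := (Finset.univ : Finset (ZMod c))) (f := Prod.fst) (fun _ _ => Finset.mem_univ _) (c / e) ?_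
  · rwa [Finset.card_univ, ZMod.card, mul_comm] at h
  · intro x _
    refine le_trans ?_ (card_fiber_cast_le hec (f x))
    refine Finset.card_le_card_of_injOn Prod.snd ?_ ?_
    · intro p hp
      simp only [Finset.coe_filter, Finset.mem_filter, Finset.mem_univ, true_and,
        Set.mem_ofPred_eq] at hp ⊢
      rw [hp.1, hp.2]
    · intro p hp p' hp' h
      simp only [Finset.coe_filter, Finset.mem_filter, Finset.mem_univ, true_and,
        Set.mem_ofPred_eq] at hp hp'
      exact Prod.ext (hp.2.trans hp'.2.symm) h

/-- Lifted to integers, the equation says that `c` divides a product of three linear forms, so some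
divisor `e` of `c` with `e³ ≥ c` divides one of them. Each such divisibility leaves at most `c · (c
/ e) ≤ c^(5/3)` pairs, and there are three forms and at most `d(c)` divisors. -/
lemma card_cubic_solutions_le (c : ℕ) [NeZero c] :
    ((Finset.univ.filter fun p : ZMod c × ZMod c =>
      (p.1 + p.2) * (1 - p.1) * (1 - p.2) = 0).card : ℝ) ≤
      3 * c.divisors.card * (c : ℝ) ^ (5 / 3 : ℝ) := by
  classical
  let E := c.divisors.filter fun e => c ≤ e ^ 3
  let S : ℕ → Finset (ZMod c × ZMod c) := fun e =>
    (Finset.univ.filter fun p : ZMod c × ZMod c => (p.2.val : ZMod e) = -(p.1.val : ZMod e)) ∪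
    (Finset.univ.filter fun p : ZMod c × ZMod c => (p.1.val : ZMod e) = 1) ∪
    (Finset.univ.filter fun p : ZMod c × ZMod c => (p.2.val : ZMod e) = 1)
  have hsub : (Finset.univ.filter fun p : ZMod c × ZMod c =>
      (p.1 + p.2) * (1 - p.1) * (1 - p.2) = 0) ⊆ E.biUnion S := by
    intro p hp
    simp only [Finset.mem_filter, Finset.mem_univ, true_and] at hp
    have h0 : (c : ℤ) ∣ ((p.1.val : ℤ) + p.2.val) * (1 - p.1.val) * (1 - p.2.val) := by
      rw [← ZMod.intCast_zmod_eq_zero_iff_dvd]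
      push_cast
      simpa using hp
    obtain ⟨e, he, hce, h⟩ := exists_large_dvd_factor (NeZero.ne c) h0
    refine Finset.mem_biUnion.2 ⟨e, Finset.mem_filter.2 ⟨he, hce⟩, ?_⟩
    simp only [S, Finset.mem_union, Finset.mem_filter, Finset.mem_univ, true_and]
    simp only [← ZMod.intCast_zmod_eq_zero_iff_dvd] at h
    push_cast at h
    rcases h with h | h | h
    · exact Or.inl (Or.inl (by linear_combination h))
    · exact Or.inl (Or.inr (by linear_combination -h))
    · exact Or.inr (by linear_combination -h)
  have hS : ∀ e ∈ E, ((S e).card : ℝ) ≤ 3 * (c : ℝ) ^ (5 / 3 : ℝ) := by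
    intro e he
    obtain ⟨hed, hce⟩ := Finset.mem_filter.1 he
    have hec := Nat.dvd_of_mem_divisors hed
    have h1 := card_fiber_filter_le hec fun x : ZMod c => -(x.val : ZMod e)
    have h2 := card_fiber_filter_le hec fun _ : ZMod c => (1 : ZMod e)
    have h3 : (Finset.univ.filter fun p : ZMod c × ZMod c => (p.1.val : ZMod e) = 1).card
        ≤ c * (c / e) := by
      refine le_trans (le_of_eq ?_) h2
      refine Finset.card_bij (fun p _ => p.swap) ?_ ?_ ?_
      · intro p hp; simpa using hp
      · intro p _ p' _ h; exact Prod.swap_injective h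
      · intro p hp; exact ⟨p.swap, by simpa using hp, by simp⟩
    have h4 : (S e).card ≤ 3 * (c * (c / e)) := by
      refine (Finset.card_union_le _ _).trans ?_
      have := Finset.card_union_le
        (Finset.univ.filter fun p : ZMod c × ZMod c => (p.2.val : ZMod e) = -(p.1.val : ZMod e))
        (Finset.univ.filter fun p : ZMod c × ZMod c => (p.1.val : ZMod e) = 1)
      omega
    have h5 := div_le_rpow_of_le_pow_three (Nat.pos_of_mem_divisors hed) hce
    calc ((S e).card : ℝ) ≤ 3 * (c * ((c / e : ℕ) : ℝ)) := by exact_mod_cast h4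
      _ ≤ 3 * (c * (c : ℝ) ^ (2 / 3 : ℝ)) := by gcongr
      _ = 3 * (c : ℝ) ^ (5 / 3 : ℝ) := by
        have : (0 : ℝ) < c := by exact_mod_cast NeZero.pos c
        rw [show (5 / 3 : ℝ) = 1 + 2 / 3 by norm_num, Real.rpow_add this, Real.rpow_one]
  calc _ ≤ ((E.biUnion S).card : ℝ) := by exact_mod_cast Finset.card_le_card hsub
    _ ≤ ∑ e ∈ E, ((S e).card : ℝ) := by exact_mod_cast Finset.card_biUnion_le
    _ ≤ ∑ e ∈ E, 3 * (c : ℝ) ^ (5 / 3 : ℝ) := Finset.sum_le_sum hS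
    _ = E.card * (3 * (c : ℝ) ^ (5 / 3 : ℝ)) := by simp
    _ ≤ c.divisors.card * (3 * (c : ℝ) ^ (5 / 3 : ℝ)) := by
      gcongr
      exact Finset.filter_subset _ _
    _ = _ := by ring

/-- Quadruples of units with equal sums and equal sums of inverses. -/
def unitQuadruples (c : ℕ) [NeZero c] :
    Finset (((ZMod c)ˣ × (ZMod c)ˣ) × ((ZMod c)ˣ × (ZMod c)ˣ)) :=
  Finset.univ.filter fun x =>
    ((x.1.1 : ZMod c) + x.1.2 = x.2.1 + x.2.2) ∧
    (((x.1.1⁻¹ : (ZMod c)ˣ) : ZMod c) + ((x.1.2⁻¹ : (ZMod c)ˣ) : ZMod c) =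
      ((x.2.1⁻¹ : (ZMod c)ˣ) : ZMod c) + ((x.2.2⁻¹ : (ZMod c)ˣ) : ZMod c))

/-- By homogeneity one divides by `w`: the pair `(u/w, v/w)` solves the cubic, and it determines the
quadruple together with `w`, because `t = u + v - w`. -/
lemma card_unitQuadruples_le (c : ℕ) [NeZero c] :
    ((unitQuadruples c).card : ℝ) ≤
      Fintype.card (ZMod c)ˣ * (3 * c.divisors.card * (c : ℝ) ^ (5 / 3 : ℝ)) := by
  classical
  refine le_trans ?_ (mul_le_mul_of_nonneg_left (card_cubic_solutions_le c) (by positivity))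
  rw [← Finset.card_univ, ← Nat.cast_mul, ← Finset.card_product]
  refine Nat.cast_le.2 (Finset.card_le_card_of_injOn
    (fun x => (x.2.1, ((x.1.1 : ZMod c) * ((x.2.1⁻¹ : (ZMod c)ˣ) : ZMod c),
      (x.1.2 : ZMod c) * ((x.2.1⁻¹ : (ZMod c)ˣ) : ZMod c)))) ?_ ?_)
  · rintro ⟨⟨u, v⟩, ⟨w, t⟩⟩ hx
    simp only [unitQuadruples, Finset.coe_filter, Finset.mem_univ, true_and,
      Set.mem_ofPred_eq] at hx
    obtain ⟨h1, h2⟩ := hx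
    simp only [Finset.coe_product, Set.mem_prod, Finset.coe_univ, Set.mem_univ, true_and,
      Finset.coe_filter, Finset.mem_univ, Set.mem_ofPred_eq]
    have hu := u.mul_inv
    have hv := v.mul_inv
    have hw := w.mul_inv
    have ht := t.mul_inv
    generalize ((u⁻¹ : (ZMod c)ˣ) : ZMod c) = u' at *
    generalize ((v⁻¹ : (ZMod c)ˣ) : ZMod c) = v' at *
    generalize ((w⁻¹ : (ZMod c)ˣ) : ZMod c) = w' at *
    generalize ((t⁻¹ : (ZMod c)ˣ) : ZMod c) = t' at *
    generalize (u : ZMod c) = u at *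
    generalize (v : ZMod c) = v at *
    generalize (w : ZMod c) = w at *
    generalize (t : ZMod c) = t at *
    have h3 : (u + v) * (w * t) = (w + t) * (u * v) := by
      have e1 : (u' + v') * (u * v) = u + v := by linear_combination v * hu + u * hv
      have e2 : (w' + t') * (w * t) = w + t := by linear_combination t * hw + w * ht
      calc (u + v) * (w * t) = (u' + v') * (u * v) * (w * t) := by rw [e1]
        _ = (w' + t') * (w * t) * (u * v) := by rw [h2]; ring
        _ = _ := by rw [e2]
    -- Since `w + t = u + v`, the previous identity reads `(u + v)(wt - uv) = 0`, and `t = u + v -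
    -- w` gives `wt - uv = -(w - u)(w - v)`.
    have h4 : (u + v) * (w - u) * (w - v) = 0 := by
      linear_combination (-1 : ZMod c) * h3 + (u * v - w * (u + v)) * h1
    have h5 : (u * w' + v * w') * (1 - u * w') * (1 - v * w') =
        w' ^ 3 * ((u + v) * (w - u) * (w - v)) := by
      rw [show (1 : ZMod c) = w * w' from hw.symm]; ring
    rw [h5, h4, mul_zero]
  · rintro ⟨⟨u, v⟩, ⟨w, t⟩⟩ hx ⟨⟨u₁, v₁⟩, ⟨w₁, t₁⟩⟩ hx₁ h
    simp only [unitQuadruples, Finset.coe_filter, Finset.mem_univ, true_and,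
      Set.mem_ofPred_eq] at hx hx₁
    simp only [Prod.mk.injEq] at h
    obtain ⟨rfl, h2, h3⟩ := h
    have hu : u = u₁ := Units.ext ((Units.mul_left_inj _).1 h2)
    have hv : v = v₁ := Units.ext ((Units.mul_left_inj _).1 h3)
    subst hu hv
    have ht : t = t₁ := Units.ext (add_left_cancel (hx.1.symm.trans hx₁.1))
    rw [ht]

/-- Expanding the fourth power gives a sum over quadruples of units; orthogonality in each parameter
keeps those with equal sums and equal sums of inverses. -/
lemma sum_norm_klo_pow_four (c : ℕ) [NeZero c] :
    ∑ p : ZMod c × ZMod c, ‖klo c p.1 p.2‖ ^ 4 = (c : ℝ) ^ 2 * (unitQuadruples c).card := by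
  classical
  have hsq : ∀ a b : ZMod c, klo c a b ^ 2 = ∑ p : (ZMod c)ˣ × (ZMod c)ˣ,
      ZMod.stdAddChar (a * ((p.1 : ZMod c) + (p.2 : ZMod c)) +
        b * (((p.1⁻¹ : (ZMod c)ˣ) : ZMod c) + ((p.2⁻¹ : (ZMod c)ˣ) : ZMod c))) := by
    intro a b
    rw [pow_two, klo, Finset.sum_mul_sum, ← Finset.univ_product_univ, Finset.sum_product]
    refine Finset.sum_congr rfl fun u _ => Finset.sum_congr rfl fun v _ => ?_
    rw [← AddChar.map_add_eq_mul]
    congr 1; ring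
  have hconj : ∀ x : ZMod c, starRingEnd ℂ (ZMod.stdAddChar x) = ZMod.stdAddChar (-x) := by
    intro x
    exact (AddChar.map_neg_eq_conj _ x).symm
  have h4 : ∀ a b : ZMod c, ((‖klo c a b‖ ^ 4 : ℝ) : ℂ) =
      ∑ x : ((ZMod c)ˣ × (ZMod c)ˣ) × ((ZMod c)ˣ × (ZMod c)ˣ),
        ZMod.stdAddChar (a * (((x.1.1 : ZMod c) + (x.1.2 : ZMod c)) - ((x.2.1 : ZMod c) + (x.2.2 : ZMod c)))) *
        ZMod.stdAddChar (b * ((((x.1.1⁻¹ : (ZMod c)ˣ) : ZMod c) + ((x.1.2⁻¹ : (ZMod c)ˣ) : ZMod c)) -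
          (((x.2.1⁻¹ : (ZMod c)ˣ) : ZMod c) + ((x.2.2⁻¹ : (ZMod c)ˣ) : ZMod c)))) := by
    intro a b
    have : ((‖klo c a b‖ ^ 4 : ℝ) : ℂ) = klo c a b ^ 2 * starRingEnd ℂ (klo c a b ^ 2) := by
      rw [Complex.mul_conj, Complex.normSq_eq_norm_sq, norm_pow]
      push_cast; ring
    rw [this, hsq, map_sum, Finset.sum_mul_sum, Fintype.sum_prod_type (γ := ℂ)
      (α₁ := (ZMod c)ˣ × (ZMod c)ˣ)]
    refine Finset.sum_congr rfl fun u _ => Finset.sum_congr rfl fun v _ => ?_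
    rw [hconj, ← AddChar.map_add_eq_mul, ← AddChar.map_add_eq_mul]
    congr 1; ring
  apply Complex.ofReal_injective
  rw [Complex.ofReal_sum]
  simp_rw [h4]
  rw [Finset.sum_comm]
  have h5 : ∀ S T : ZMod c, ∑ p : ZMod c × ZMod c,
      (ZMod.stdAddChar (p.1 * S) * ZMod.stdAddChar (p.2 * T) : ℂ) =
      if S = 0 ∧ T = 0 then (c : ℂ) ^ 2 else 0 := by
    intro S T
    rw [Fintype.sum_prod_type, ← Finset.sum_mul_sum (f := fun x => ZMod.stdAddChar (x * S))
      (g := fun y => ZMod.stdAddChar (y * T)), AddChar.sum_mulShift S (ZMod.isPrimitive_stdAddChar c),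
      AddChar.sum_mulShift T (ZMod.isPrimitive_stdAddChar c), ZMod.card]
    by_cases hS : S = 0 <;> by_cases hT : T = 0 <;> simp [hS, hT, pow_two]
  simp_rw [h5, sub_eq_zero]
  rw [← Finset.sum_filter]
  simp [unitQuadruples, mul_comm]

/-- The integer `v.val * |b|` is below `c|b|` and its residue modulo `c` is prescribed, so its
quotient by `c` determines it; that quotient takes at most `|b|` values. -/
lemma card_mul_eq_le {c : ℕ} [NeZero c] {b : ℤ} (hb : b ≠ 0) (t : ZMod c) :
    (Finset.univ.filter fun v : ZMod c => v * (b : ZMod c) = t).card ≤ b.natAbs := by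
  have hb' : 0 < b.natAbs := Int.natAbs_pos.2 hb
  have key : ∀ (t : ZMod c), (Finset.univ.filter fun v : ZMod c => v * (b.natAbs : ZMod c) = t).card
      ≤ b.natAbs := by
    intro t
    conv_rhs => rw [← Finset.card_range b.natAbs]
    refine Finset.card_le_card_of_injOn (fun v => v.val * b.natAbs / c) ?_ ?_
    · intro v _
      simp only [Finset.coe_range, Set.mem_Iio]
      rw [Nat.div_lt_iff_lt_mul (NeZero.pos c), mul_comm]
      exact Nat.mul_lt_mul_of_pos_left (ZMod.val_lt v) hb'
    · intro v hv w hw h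
      simp only [Finset.coe_filter, Finset.mem_univ, true_and, Set.mem_ofPred_eq] at hv hw h
      have h1 : ((v.val * b.natAbs : ℕ) : ZMod c) = ((w.val * b.natAbs : ℕ) : ZMod c) := by
        push_cast
        simpa using hv.trans hw.symm
      have h2 := (ZMod.natCast_eq_natCast_iff' _ _ _).1 h1
      have h3 : v.val * b.natAbs = w.val * b.natAbs := by
        rw [← Nat.div_add_mod (v.val * b.natAbs) c, ← Nat.div_add_mod (w.val * b.natAbs) c, h, h2]
      exact ZMod.val_injective c (Nat.eq_of_mul_eq_mul_right hb' h3)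
  rcases Int.natAbs_eq b with h | h
  · have hb2 : (b : ZMod c) = (b.natAbs : ZMod c) := by
      conv_lhs => rw [h]
      rw [Int.cast_natCast]
    rw [hb2]
    exact key t
  · have hb2 : (b : ZMod c) = -(b.natAbs : ZMod c) := by
      conv_lhs => rw [h]
      rw [Int.cast_neg, Int.cast_natCast]
    simp_rw [hb2, mul_neg, neg_eq_iff_eq_neg]
    exact key (-t)

/-- The sum is constant along the orbit `(av, v⁻¹b)` of the `φ(c)` units, and no pair of parameters
occurs in it more than `|b|` times. Hence `φ(c)|K|⁴` is at most `|b|` times the full fourth moment,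
and the factor `φ(c)` in the count of quadruples cancels. -/
lemma norm_klo_pow_four_le (c : ℕ) [NeZero c] (a : ZMod c) {b : ℤ} (hb : b ≠ 0) :
    ‖klo c a b‖ ^ 4 ≤ 3 * |(b : ℝ)| * c.divisors.card * (c : ℝ) ^ (11 / 3 : ℝ) := by
  classical
  have hφ : (0 : ℝ) < Fintype.card (ZMod c)ˣ := by exact_mod_cast Fintype.card_pos
  have hc : (0 : ℝ) < c := by exact_mod_cast NeZero.pos c
  let F : (ZMod c)ˣ → ZMod c × ZMod c := fun v => (a * v, ((v⁻¹ : (ZMod c)ˣ) : ZMod c) * b)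
  have h1 : (Fintype.card (ZMod c)ˣ : ℝ) * ‖klo c a b‖ ^ 4 =
      ∑ v : (ZMod c)ˣ, ‖klo c (F v).1 (F v).2‖ ^ 4 := by
    simp only [F, klo_smul]
    simp
  have h2 : ∑ v : (ZMod c)ˣ, ‖klo c (F v).1 (F v).2‖ ^ 4 ≤
      |(b : ℝ)| * ∑ p : ZMod c × ZMod c, ‖klo c p.1 p.2‖ ^ 4 := by
    rw [← Finset.sum_fiberwise_of_maps_to (s := Finset.univ) (t := Finset.univ) (g := F)
      (fun _ _ => Finset.mem_univ _), Finset.mul_sum]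
    refine Finset.sum_le_sum fun p _ => ?_
    have h3 : ∑ v ∈ Finset.univ.filter (fun v => F v = p), ‖klo c (F v).1 (F v).2‖ ^ 4 =
        (Finset.univ.filter (fun v => F v = p)).card * ‖klo c p.1 p.2‖ ^ 4 := by
      rw [Finset.sum_congr rfl (g := fun _ => ‖klo c p.1 p.2‖ ^ 4)]
      · simp
      · intro v hv
        rw [(Finset.mem_filter.1 hv).2]
    rw [h3]
    gcongr
    have h4 : (Finset.univ.filter (fun v => F v = p)).card ≤ b.natAbs := by
      refine le_trans ?_ (card_mul_eq_le hb p.2)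
      refine Finset.card_le_card_of_injOn (fun v => ((v⁻¹ : (ZMod c)ˣ) : ZMod c)) ?_ ?_
      · intro v hv
        simp only [Finset.coe_filter, Finset.mem_univ, true_and, Set.mem_ofPred_eq] at hv ⊢
        rw [← hv]
      · intro v _ w _ h
        exact inv_injective (Units.ext h)
    calc ((Finset.univ.filter (fun v => F v = p)).card : ℝ) ≤ (b.natAbs : ℝ) := by exact_mod_cast h4
      _ = |(b : ℝ)| := by simp
  rw [sum_norm_klo_pow_four] at h2
  have h5 := card_unitQuadruples_le c
  have h6 : (Fintype.card (ZMod c)ˣ : ℝ) * ‖klo c a b‖ ^ 4 ≤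
      Fintype.card (ZMod c)ˣ * (3 * |(b : ℝ)| * c.divisors.card * (c : ℝ) ^ (11 / 3 : ℝ)) := by
    rw [h1]
    refine h2.trans ?_
    calc |(b : ℝ)| * ((c : ℝ) ^ 2 * (unitQuadruples c).card) ≤ |(b : ℝ)| * ((c : ℝ) ^ 2 *
          (Fintype.card (ZMod c)ˣ * (3 * c.divisors.card * (c : ℝ) ^ (5 / 3 : ℝ)))) := by gcongr
      _ = _ := by
        rw [show (11 / 3 : ℝ) = 2 + 5 / 3 by norm_num, Real.rpow_add hc, Real.rpow_two]
        ring
  exact le_of_mul_le_mul_left h6 hφ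

/-- A summable weight dominating Kloosterman sums divided by the square of the modulus. -/
def kloWeight (c : ℕ) : ℝ := c.divisors.card * (c : ℝ) ^ (-(13 / 12) : ℝ)

lemma kloWeight_nonneg (c : ℕ) : 0 ≤ kloWeight c := by unfold kloWeight; positivity

/-- A fourth root of the previous bound: `11/12 - 2 = -13/12`, which is below `-1`. The linear
growth in `|b|` is harmless later on. -/
lemma norm_klo_div_sq_le (c : ℕ) [NeZero c] (a : ZMod c) {b : ℤ} (hb : b ≠ 0) :
    ‖klo c a b‖ / (c : ℝ) ^ 2 ≤ 3 * |(b : ℝ)| * kloWeight c := by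
  have hc : (0 : ℝ) < c := by exact_mod_cast NeZero.pos c
  have hb1 : (1 : ℝ) ≤ |(b : ℝ)| := by exact_mod_cast Int.one_le_abs hb
  have hd1 : (1 : ℝ) ≤ c.divisors.card := by
    exact_mod_cast Finset.card_pos.2 ⟨1, Nat.one_mem_divisors.2 (NeZero.ne c)⟩
  rw [div_le_iff₀ (by positivity)]
  refine le_of_pow_le_pow_left₀ (n := 4) (by norm_num) (by unfold kloWeight; positivity) ?_
  refine (norm_klo_pow_four_le c a hb).trans ?_
  have h : (3 * |(b : ℝ)| * kloWeight c * (c : ℝ) ^ 2) ^ 4 =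
      (3 * |(b : ℝ)| * c.divisors.card) ^ 4 * (c : ℝ) ^ (11 / 3 : ℝ) := by
    have : (c : ℝ) ^ (11 / 3 : ℝ) = ((c : ℝ) ^ (-(13 / 12) : ℝ) * (c : ℝ) ^ 2) ^ 4 := by
      rw [← Real.rpow_two, ← Real.rpow_add hc, ← Real.rpow_natCast, ← Real.rpow_mul hc.le]
      norm_num
    rw [this, kloWeight]; ring
  rw [h]
  gcongr
  -- `3|b|d(c) ≥ 1`, so this factor may be replaced by its fourth power.
  refine le_self_pow₀ ?_ (by norm_num)
  nlinarith [mul_le_mul hb1 hd1 zero_le_one (by positivity)]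

/-- The sum is the Dirichlet series of `ζ²` at `13/12`. -/
lemma summable_kloWeight : Summable kloWeight := by
  have h : LSeriesSummable (fun n => (ArithmeticFunction.zeta * ArithmeticFunction.zeta :
      ArithmeticFunction ℂ) n) (13 / 12 : ℂ) := by
    have h1 : LSeriesSummable (fun n => (ArithmeticFunction.zeta : ArithmeticFunction ℂ) n)
        (13 / 12 : ℂ) := by
      have := ArithmeticFunction.LSeriesSummable_zeta_iff (s := (13 / 12 : ℂ))
      simp only [ArithmeticFunction.natCoe_apply]
      rw [this]
      norm_num
    exact ArithmeticFunction.LSeriesSummable_mul h1 h1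
  refine h.norm.congr fun n => ?_
  rw [LSeries.norm_term_eq]
  rcases eq_or_ne n 0 with rfl | hn
  · simp [kloWeight]
  · rw [if_neg hn, kloWeight, Real.rpow_neg (by positivity), div_eq_mul_inv]
    congr 1
    · rw [← ArithmeticFunction.natCoe_mul, ArithmeticFunction.natCoe_apply, Complex.norm_natCast,
        ArithmeticFunction.zeta_mul_apply]
      congr 1
      rw [Finset.card_eq_sum_ones]
      refine Finset.sum_congr rfl fun i hi => ?_
      rw [ArithmeticFunction.zeta_apply, if_neg (Nat.pos_of_mem_divisors hi).ne']
    · norm_num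

lemma kloosterman_eq_klo (c : ℕ) [NeZero c] (a b : ℤ) : kloosterman a b c = klo c a b := by
  classical
  unfold kloosterman klo
  symm
  refine Finset.sum_bij (fun u _ => (u : ZMod c).val) ?_ ?_ ?_ ?_
  · intro u _
    exact Finset.mem_filter.2 ⟨Finset.mem_range.2 (ZMod.val_lt _), ZMod.val_coe_unit_coprime u⟩
  · intro u _ v _ h
    exact Units.ext (ZMod.val_injective c h)
  · intro m hm
    obtain ⟨hm1, hm2⟩ := Finset.mem_filter.1 hm
    refine ⟨ZMod.unitOfCoprime m hm2, Finset.mem_univ _, ?_⟩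
    rw [ZMod.coe_unitOfCoprime, ZMod.val_natCast, Nat.mod_eq_of_lt (Finset.mem_range.1 hm1)]
  · intro u _
    rw [← ZMod.stdAddChar_coe]
    congr 1
    push_cast
    simp

/-! ### Ramanujan sums. -/

lemma sum_divisors_moebius (n : ℕ) :
    ∑ l ∈ n.divisors, ArithmeticFunction.moebius l = if n = 1 then 1 else 0 := by
  rw [← ArithmeticFunction.coe_mul_zeta_apply, ArithmeticFunction.moebius_mul_coe_zeta,
    ArithmeticFunction.one_apply]

lemma sum_range_exp (n : ℕ) [NeZero n] (r : ℕ) :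
    ∑ y ∈ Finset.range n, exp (2 * Real.pi * Complex.I * (r * y : ℕ) / n) =
      if n ∣ r then (n : ℂ) else 0 := by
  classical
  have h := AddChar.sum_mulShift (r : ZMod n) (ZMod.isPrimitive_stdAddChar n)
  rw [ZMod.card] at h
  simp only [ZMod.natCast_eq_zero_iff] at h
  have h2 : ∑ y ∈ Finset.range n, exp (2 * Real.pi * Complex.I * (r * y : ℕ) / n) =
      ∑ x : ZMod n, ZMod.stdAddChar (x * (r : ZMod n)) := by
    symm
    refine Finset.sum_bij (fun x _ => x.val) ?_ ?_ ?_ ?_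
    · intro x _; exact Finset.mem_range.2 (ZMod.val_lt x)
    · intro x _ y _ h; exact ZMod.val_injective n h
    · intro m hm
      exact ⟨(m : ZMod n), Finset.mem_univ _, ZMod.val_cast_of_lt (Finset.mem_range.1 hm)⟩
    · intro x _
      have := ZMod.stdAddChar_coe (N := n) ((r * x.val : ℕ) : ℤ)
      rw [Int.cast_natCast, Int.cast_natCast] at this
      rw [← this]
      congr 1
      push_cast
      simp [mul_comm]
  rw [h2, h]
  split_ifs <;> simp

/-- The evaluation of Ramanujan sums. -/
lemma kloosterman_zero_right (c : ℕ) (hc : c ≠ 0) (r : ℕ) :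
    kloosterman r 0 c = ∑ l ∈ (Nat.gcd c r).divisors,
      ((ArithmeticFunction.moebius (c / l) : ℤ) : ℂ) * (l : ℂ) := by
  classical
  let F : ℕ → ℂ := fun m => exp (2 * Real.pi * Complex.I * (r * m : ℕ) / c)
  have h0 : kloosterman r 0 c = ∑ m ∈ (Finset.range c).filter (fun m => m.Coprime c), F m := by
    unfold kloosterman
    refine Finset.sum_congr rfl fun m _ => ?_
    simp only [F]
    congr 2
    push_cast
    simp
  -- Coprimality to `c` is detected by summing `μ` over the divisors of `gcd(m, c)`.
  have h1 : ∑ m ∈ (Finset.range c).filter (fun m => m.Coprime c), F m =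
      ∑ m ∈ Finset.range c, ∑ l ∈ c.divisors,
        if l ∣ m then ((ArithmeticFunction.moebius l : ℤ) : ℂ) * F m else 0 := by
    rw [Finset.sum_filter]
    refine Finset.sum_congr rfl fun m _ => ?_
    have hd : c.divisors.filter (fun l => l ∣ m) = (Nat.gcd m c).divisors := by
      ext l
      have hg : m.gcd c ≠ 0 := fun h => hc (Nat.eq_zero_of_gcd_eq_zero_right h)
      simp only [Finset.mem_filter, Nat.mem_divisors, Nat.dvd_gcd_iff]
      tauto
    rw [← Finset.sum_filter, hd, ← Finset.sum_mul, ← Int.cast_sum, sum_divisors_moebius]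
    by_cases h : m.gcd c = 1 <;> simp [Nat.coprime_iff_gcd_eq_one, h]
  -- The multiples of `l` below `c` are `ly` with `y < c/l`; what remains is a complete exponential
  -- sum modulo `c/l`.
  have h2 : ∀ l ∈ c.divisors, ∑ m ∈ Finset.range c,
      (if l ∣ m then ((ArithmeticFunction.moebius l : ℤ) : ℂ) * F m else 0) =
      ((ArithmeticFunction.moebius l : ℤ) : ℂ) * if c / l ∣ r then ((c / l : ℕ) : ℂ) else 0 := by
    intro l hl
    have hlc := Nat.dvd_of_mem_divisors hl
    have hl0 := Nat.pos_of_mem_divisors hl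
    obtain ⟨n, rfl⟩ := hlc
    have hn : n ≠ 0 := right_ne_zero_of_mul hc
    have : NeZero n := ⟨hn⟩
    rw [Nat.mul_div_cancel_left _ hl0, ← Finset.sum_filter, ← Finset.mul_sum]
    congr 1
    rw [← sum_range_exp]
    symm
    refine Finset.sum_bij (fun y _ => l * y) ?_ ?_ ?_ ?_
    · intro y hy
      exact Finset.mem_filter.2 ⟨Finset.mem_range.2
        (Nat.mul_lt_mul_of_pos_left (Finset.mem_range.1 hy) hl0), dvd_mul_right _ _⟩
    · intro y _ y' _ h
      exact Nat.eq_of_mul_eq_mul_left hl0 h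
    · intro m hm
      obtain ⟨hm1, y, rfl⟩ := Finset.mem_filter.1 hm
      exact ⟨y, Finset.mem_range.2 (Nat.lt_of_mul_lt_mul_left (Finset.mem_range.1 hm1)), rfl⟩
    · intro y _
      simp only [F]
      congr 1
      have : (l : ℂ) ≠ 0 := by exact_mod_cast hl0.ne'
      have : (n : ℂ) ≠ 0 := by exact_mod_cast hn
      push_cast
      field_simp
  rw [h0, h1, Finset.sum_comm, Finset.sum_congr rfl h2,
    ← Nat.sum_div_divisors c fun l => ((ArithmeticFunction.moebius l : ℤ) : ℂ) *
      if c / l ∣ r then ((c / l : ℕ) : ℂ) else 0]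
  have hd : (Nat.gcd c r).divisors = c.divisors.filter (fun l => l ∣ r) := by
    ext l
    have : c.gcd r ≠ 0 := fun h => hc (Nat.eq_zero_of_gcd_eq_zero_left h)
    simp only [Finset.mem_filter, Nat.mem_divisors, Nat.dvd_gcd_iff]
    tauto
  rw [hd, Finset.sum_filter]
  refine Finset.sum_congr rfl fun l hl => ?_
  rw [Nat.div_div_self (Nat.dvd_of_mem_divisors hl) hc]
  split_ifs <;> simp

lemma klo_zero_zero (c : ℕ) [NeZero c] : klo c 0 0 = c.totient := by
  simp [klo, ZMod.card_units_eq_totient]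

/-! ### The Dirichlet series of the totient over multiples of the level -/

lemma sum_moebius_mul_eq_totient (n : ℕ) (hn : 0 < n) :
    ∑ x ∈ n.divisorsAntidiagonal, ((ArithmeticFunction.moebius x.1 : ℤ) : ℂ) * (x.2 : ℂ) =
      n.totient := by
  have := (ArithmeticFunction.sum_eq_iff_sum_mul_moebius_eq (R := ℂ)
    (f := fun n => (n.totient : ℂ)) (g := fun n => (n : ℂ))).1 ?_ n hn
  · exact this
  · intro n _
    rw [← Nat.cast_sum, Nat.sum_totient]

lemma norm_moebius_le_one (n : ℕ) : ‖((ArithmeticFunction.moebius n : ℤ) : ℂ)‖ ≤ 1 := by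
  rw [Complex.norm_intCast]
  exact_mod_cast ArithmeticFunction.abs_moebius_le_one

lemma summable_pnat_cpow {s : ℂ} (hs : 1 < s.re) :
    Summable fun m : ℕ+ => ‖((m : ℕ) : ℂ) ^ (-s)‖ := by
  have h : Summable fun n : ℕ => (n : ℝ) ^ (-s.re) := by
    rw [Real.summable_nat_rpow]; linarith
  refine (h.comp_injective PNat.coe_injective).congr fun m => ?_
  rw [Complex.norm_natCast_cpow_of_pos m.pos]
  simp

lemma tsum_pnat_cpow {s : ℂ} (hs : 1 < s.re) :
    ∑' m : ℕ+, ((m : ℕ) : ℂ) ^ (-s) = riemannZeta s := by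
  rw [zeta_eq_tsum_one_div_nat_cpow hs, ← PNat.coe_injective.tsum_eq]
  · exact tsum_congr fun m => by rw [Complex.cpow_neg, one_div]
  · intro n hn
    rcases Nat.eq_zero_or_pos n with rfl | h
    · exfalso
      refine hn ?_
      have : s ≠ 0 := by rintro rfl; simp at hs; linarith
      simp [Complex.zero_cpow this]
    · exact ⟨⟨n, h⟩, rfl⟩

lemma tsum_pnat_multiples (M : ℕ) (hM : 0 < M) (f : ℕ → ℂ) :
    ∑' m : ℕ+, (if M ∣ m then f m else 0) = ∑' k : ℕ+, f (M * k) := by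
  let g : ℕ+ → ℕ+ := fun k => ⟨M * k, Nat.mul_pos hM k.pos⟩
  have hinj : Function.Injective g := by
    intro a b h
    have := congrArg PNat.val h
    exact PNat.eq (Nat.eq_of_mul_eq_mul_left hM this)
  rw [← hinj.tsum_eq]
  · exact tsum_congr fun k => by simp [g]
  · intro m hm
    have hd : M ∣ (m : ℕ) := by
      by_contra h
      exact hm (by simp [h])
    obtain ⟨k, hk⟩ := hd
    have : 0 < k := by
      rcases Nat.eq_zero_or_pos k with rfl | h
      · simp at hk
      · exact h
    exact ⟨⟨k, this⟩, PNat.eq hk.symm⟩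

lemma norm_moebius_cpow_le {N : ℕ} (hN : 0 < N) {s : ℂ} (hs : 1 ≤ s.re) (l : ℕ+) :
    ‖((ArithmeticFunction.moebius l : ℤ) : ℂ) * ((l : ℕ) : ℂ) ^ (-2 * s) *
      ((N / Nat.gcd N l : ℕ) : ℂ) ^ (1 - 2 * s)‖ ≤ ((l : ℕ) : ℝ) ^ (-2 : ℝ) := by
  have hg : 0 < N / Nat.gcd N l :=
    Nat.div_pos (Nat.gcd_le_left _ hN) (Nat.gcd_pos_of_pos_left _ hN)
  rw [norm_mul, norm_mul, Complex.norm_natCast_cpow_of_pos l.pos,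
    Complex.norm_natCast_cpow_of_pos hg]
  have hl1 : (1 : ℝ) ≤ (l : ℕ) := by exact_mod_cast l.pos
  have hg1 : (1 : ℝ) ≤ (N / Nat.gcd N l : ℕ) := by exact_mod_cast hg
  have h1 : (-2 * s).re = -2 * s.re := by simp
  have h2 : (1 - 2 * s).re = 1 - 2 * s.re := by simp
  rw [h1, h2]
  calc _ ≤ 1 * ((l : ℕ) : ℝ) ^ (-2 : ℝ) * 1 := by
        gcongr
        · exact norm_moebius_le_one _
        · linarith
        · exact Real.rpow_le_one_of_one_le_of_nonpos hg1 (by linarith)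
    _ = _ := by ring

lemma summable_pnat_rpow_neg_two : Summable fun l : ℕ+ => ((l : ℕ) : ℝ) ^ (-2 : ℝ) :=
  (Real.summable_nat_rpow.2 (by norm_num)).comp_injective PNat.coe_injective

/-- Since `φ = μ * id`, the left side is a sum over `n = lm` with `N ∣ lm`, that is with `N / gcd(N,
l)` dividing `m`. The sum over `m` is then a multiple of `ζ(2s - 1)`, and the remaining series in
`l` converges up to `s = 1`. -/
lemma tsum_totient_cpow {N : ℕ} (hN : 0 < N) {s : ℂ} (hs : 1 < s.re) :
    ∑' k : ℕ+, ((N * k : ℕ).totient : ℂ) * ((N * k : ℕ) : ℂ) ^ (-2 * s) =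
      riemannZeta (2 * s - 1) *
        ∑' l : ℕ+, ((ArithmeticFunction.moebius l : ℤ) : ℂ) * ((l : ℕ) : ℂ) ^ (-2 * s) *
          ((N / Nat.gcd N l : ℕ) : ℂ) ^ (1 - 2 * s) := by
  classical
  have hs2 : 1 < (2 * s - 1).re := by simp; linarith
  let f : ℕ → ℂ := fun n => (n.totient : ℂ) * (n : ℂ) ^ (-2 * s)
  let G : ℕ+ × ℕ+ → ℂ := fun x => if N ∣ (x.1 * x.2 : ℕ) then
    ((ArithmeticFunction.moebius x.1 : ℤ) : ℂ) * ((x.1 : ℕ) : ℂ) ^ (-2 * s) *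
      ((x.2 : ℕ) : ℂ) ^ (-(2 * s - 1)) else 0
  have hG : Summable G := by
    have h1 : Summable fun l : ℕ+ => ‖((l : ℕ) : ℂ) ^ (-(2 * s))‖ :=
      summable_pnat_cpow (by simp; linarith)
    have h2 := summable_pnat_cpow hs2
    refine Summable.of_norm_bounded (h1.mul_of_nonneg h2 (fun _ => norm_nonneg _)
      (fun _ => norm_nonneg _)) fun x => ?_
    simp only [G]
    split_ifs
    · rw [norm_mul, norm_mul]
      gcongr
      rw [neg_mul]
      exact mul_le_of_le_one_left (norm_nonneg _) (norm_moebius_le_one _)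
    · rw [norm_zero]; positivity
  have hL : ∑' k : ℕ+, ((N * k : ℕ).totient : ℂ) * ((N * k : ℕ) : ℂ) ^ (-2 * s) =
      ∑' x, G x := by
    have hG' : Summable (G ∘ sigmaAntidiagonalEquivProd) := (Equiv.summable_iff _).2 hG
    have e1 : ∑' x, G x = ∑' x, (G ∘ sigmaAntidiagonalEquivProd) x :=
      (Equiv.tsum_eq sigmaAntidiagonalEquivProd G).symm
    have e2 := hG'.tsum_sigma
    rw [e1, e2]
    refine (tsum_pnat_multiples N hN f).symm.trans ?_
    refine tsum_congr fun n => ?_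
    have h3 : ∀ x : Nat.divisorsAntidiagonal n, G (sigmaAntidiagonalEquivProd ⟨n, x⟩) =
        if N ∣ n then ((ArithmeticFunction.moebius x.1.1 : ℤ) : ℂ) * (x.1.2 : ℂ) *
          ((n : ℕ) : ℂ) ^ (-2 * s) else 0 := by
      intro x
      have hx := (Nat.mem_divisorsAntidiagonal.1 x.2).1
      have h2 : (x.1.2 : ℂ) ≠ 0 := by
        intro h
        have h0 : x.1.2 = 0 := by exact_mod_cast h
        rw [h0, mul_zero] at hx
        exact n.ne_zero hx.symm
      have h4 : G (sigmaAntidiagonalEquivProd ⟨n, x⟩) = if N ∣ x.1.1 * x.1.2 then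
        ((ArithmeticFunction.moebius x.1.1 : ℤ) : ℂ) * (x.1.1 : ℂ) ^ (-2 * s) *
          (x.1.2 : ℂ) ^ (-(2 * s - 1)) else 0 := rfl
      rw [h4]
      by_cases hd : N ∣ n
      · rw [if_pos hd, if_pos (by rwa [hx]),
          show ((n : ℕ) : ℂ) = (x.1.1 : ℂ) * (x.1.2 : ℂ) by rw [← Nat.cast_mul, hx],
          Complex.natCast_mul_natCast_cpow,
          show -(2 * s - 1) = 1 + (-2 * s) by ring, Complex.cpow_add _ _ h2, Complex.cpow_one]
        ring
      · rw [if_neg hd, if_neg (by rwa [hx])]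
    symm
    refine (tsum_congr h3).trans ?_
    rw [tsum_fintype]
    rw [Finset.sum_coe_sort (Nat.divisorsAntidiagonal n) fun x : ℕ × ℕ =>
      if N ∣ n then ((ArithmeticFunction.moebius x.1 : ℤ) : ℂ) * (x.2 : ℂ) *
          ((n : ℕ) : ℂ) ^ (-2 * s) else 0]
    split_ifs
    · simp only [f]
      rw [← Finset.sum_mul, sum_moebius_mul_eq_totient n n.pos]
    · simp
  rw [hL, Summable.tsum_prod hG, ← tsum_mul_left]
  refine tsum_congr fun l => ?_
  have hg0 : 0 < Nat.gcd N l := Nat.gcd_pos_of_pos_left _ hN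
  have hg : 0 < N / Nat.gcd N l := Nat.div_pos (Nat.gcd_le_left _ hN) hg0
  have hdvd : ∀ m : ℕ, N ∣ (l * m : ℕ) ↔ N / Nat.gcd N l ∣ m := by
    intro m
    rw [Nat.div_dvd_iff_dvd_mul (Nat.gcd_dvd_left _ _) hg0]
    constructor
    · intro h
      rw [← Nat.gcd_mul_right]
      exact Nat.dvd_gcd (dvd_mul_right _ _) h
    · intro h
      exact h.trans (Nat.mul_dvd_mul_right (Nat.gcd_dvd_right _ _) _)
  simp only [G, hdvd]
  rw [tsum_pnat_multiples _ hg fun m => ((ArithmeticFunction.moebius l : ℤ) : ℂ) *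
    ((l : ℕ) : ℂ) ^ (-2 * s) * (m : ℂ) ^ (-(2 * s - 1)), tsum_mul_left, ← tsum_pnat_cpow hs2]
  simp_rw [Nat.cast_mul, Complex.natCast_mul_natCast_cpow]
  rw [tsum_mul_left, show -(2 * s - 1) = 1 - 2 * s by ring]
  ring

/-- Compare Euler products with `ζ(2) = π²/6`. The quotient of the local factors is `1` for `p ∤ N`
and `(1 - 1/p)/(1 - 1/p²) = (1 + 1/p)⁻¹` for `p ∣ N`. -/
lemma tsum_moebius_gcd {N : ℕ} (hN : 0 < N) :
    ∑' l : ℕ, ((ArithmeticFunction.moebius l : ℤ) : ℂ) * (Nat.gcd N l : ℂ) / (l : ℂ) ^ 2 =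
      6 / Real.pi ^ 2 * ∏ p ∈ N.primeFactors, (1 + 1 / (p : ℂ))⁻¹ := by
  let F : ℕ → ℂ := fun l =>
    ((ArithmeticFunction.moebius l : ℤ) : ℂ) * (Nat.gcd N l : ℂ) / (l : ℂ) ^ 2
  have hF : Summable fun l => ‖F l‖ := by
    have h2 : Summable fun l : ℕ => (N : ℝ) * (1 / (l : ℝ) ^ 2) :=
      (Real.summable_one_div_nat_pow.2 (by norm_num)).mul_left _
    refine Summable.of_nonneg_of_le (fun _ => norm_nonneg _) (fun l => ?_) h2
    simp only [F]
    rw [norm_div, norm_mul, norm_pow, Complex.norm_natCast, Complex.norm_natCast, mul_one_div]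
    gcongr
    calc _ ≤ 1 * (N : ℝ) := by
          gcongr
          · exact norm_moebius_le_one _
          · exact Nat.gcd_le_left _ hN
      _ = N := one_mul _
  have hE := EulerProduct.eulerProduct_hasProd (f := F) (by simp [F]) ?_ hF (by simp [F])
  swap
  · intro m n hmn
    simp only [F]
    rw [ArithmeticFunction.isMultiplicative_moebius.map_mul_of_coprime hmn, Nat.Coprime.gcd_mul _ hmn]
    push_cast
    rw [mul_pow, mul_mul_mul_comm, mul_div_mul_comm]
  have hterm : ∀ p : Nat.Primes, ∑' e : ℕ, F ((p : ℕ) ^ e) = 1 - (Nat.gcd N p : ℂ) / (p : ℂ) ^ 2 := by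
    intro p
    rw [tsum_eq_sum (s := Finset.range 2)]
    · simp [Finset.sum_range_succ, F, ArithmeticFunction.moebius_apply_prime p.2]
      ring
    · intro e he
      have he2 : 2 ≤ e := by rw [Finset.mem_range] at he; omega
      simp only [F]
      rw [ArithmeticFunction.moebius_apply_prime_pow p.2 (by omega), if_neg (by omega)]
      simp
  simp_rw [hterm] at hE
  have hζ := riemannZeta_eulerProduct_hasProd (s := 2) (by simp)
  have hprod := hE.mul hζ
  have hfin : HasProd (fun p : Nat.Primes => (1 - (Nat.gcd N p : ℂ) / (p : ℂ) ^ 2) *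
      (1 - (p : ℂ) ^ (-2 : ℂ))⁻¹) (∏ p ∈ N.primeFactors, (1 + 1 / (p : ℂ))⁻¹) := by
    have h1 : ∀ p : Nat.Primes, (1 - (Nat.gcd N p : ℂ) / (p : ℂ) ^ 2) *
      (1 - (p : ℂ) ^ (-2 : ℂ))⁻¹ = if (p : ℕ) ∣ N then (1 + 1 / (p : ℂ))⁻¹ else 1 := by
      intro p
      have hp0 : (p : ℂ) ≠ 0 := by exact_mod_cast p.2.ne_zero
      have hp1 : (p : ℂ) - 1 ≠ 0 := by
        rw [sub_ne_zero]; exact_mod_cast p.2.ne_one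
      have hp2 : (p : ℂ) + 1 ≠ 0 := by exact_mod_cast Nat.succ_ne_zero (p : ℕ)
      have hp3 : 1 - 1 / (p : ℂ) ^ 2 ≠ 0 := by
        have : 1 - 1 / (p : ℂ) ^ 2 = (p - 1) * (p + 1) / p ^ 2 := by field_simp; ring
        rw [this]
        positivity
      have h4 : (p : ℂ) ^ (-2 : ℂ) = 1 / (p : ℂ) ^ 2 := by
        rw [Complex.cpow_neg, one_div]; norm_cast
      rw [h4]
      split_ifs with h
      · rw [Nat.gcd_eq_right h]
        rw [mul_inv_eq_iff_eq_mul₀ hp3]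
        field_simp
        ring
      · have : Nat.gcd N p = 1 := ((Nat.coprime_comm.1 ((Nat.Prime.coprime_iff_not_dvd p.2).2 h)))
        rw [this, Nat.cast_one, mul_inv_cancel₀ hp3]
    have h2 : ∏ p ∈ N.primeFactors, (1 + 1 / (p : ℂ))⁻¹ =
        ∏ p ∈ N.primeFactors.subtype Nat.Prime, (1 + 1 / ((p : ℕ) : ℂ))⁻¹ := by
      rw [Finset.prod_subtype_of_mem (fun p : ℕ => (1 + 1 / (p : ℂ))⁻¹)]
      intro p hp
      exact Nat.prime_of_mem_primeFactors hp
    rw [h2]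
    simp_rw [h1]
    have h3 : ∏ p ∈ N.primeFactors.subtype Nat.Prime, (1 + 1 / ((p : ℕ) : ℂ))⁻¹ =
        ∏ p ∈ N.primeFactors.subtype Nat.Prime,
          (if (p : ℕ) ∣ N then (1 + 1 / ((p : ℕ) : ℂ))⁻¹ else 1) := by
      refine Finset.prod_congr rfl fun p hp => ?_
      rw [if_pos (Nat.dvd_of_mem_primeFactors (Finset.mem_subtype.1 hp))]
    rw [h3]
    refine hasProd_prod_of_ne_finset_one fun p hp => ?_
    rw [if_neg]
    intro h
    exact hp (Finset.mem_subtype.2 (Nat.mem_primeFactors.2 ⟨p.2, h, hN.ne'⟩))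
  have hu := hprod.unique hfin
  rw [riemannZeta_two] at hu
  have hpi : (Real.pi : ℂ) ≠ 0 := by exact_mod_cast Real.pi_ne_zero
  rw [← hu]
  simp only [F]
  field_simp

/-! ### Limits along `toOne`, and the residue of the totient series. -/

lemma toOne_neBot : toOne.NeBot := by
  rw [toOne, ← mem_closure_iff_nhdsWithin_neBot, Complex.closure_setOfPred_lt_re]
  simp

lemma tendsto_toOne : Tendsto (fun s : ℂ => s) toOne (𝓝 1) := tendsto_nhdsWithin_of_tendsto_nhds tendsto_id

lemma eventually_toOne : ∀ᶠ s in toOne, 1 < s.re ∧ ‖s - 1‖ < 1 := by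
  refine (eventually_mem_nhdsWithin).and ?_
  have : ∀ᶠ s : ℂ in 𝓝 1, ‖s - 1‖ < 1 := by
    filter_upwards [Metric.ball_mem_nhds (1 : ℂ) one_pos] with s hs
    simpa [dist_eq_norm] using hs
  exact mem_nhdsWithin_of_mem_nhds this

lemma tendsto_toOne_two_mul_sub_one : Tendsto (fun s : ℂ => 2 * s - 1) toOne toOne := by
  refine tendsto_nhdsWithin_iff.2 ⟨?_, ?_⟩
  · have : Tendsto (fun s : ℂ => 2 * s - 1) (𝓝 1) (𝓝 (2 * 1 - 1)) :=
      Continuous.tendsto (by fun_prop) 1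
    norm_num at this
    exact this.mono_left nhdsWithin_le_nhds
  · filter_upwards [eventually_mem_nhdsWithin] with s hs
    have : 1 < s.re := hs
    simp
    linarith

/-- The pole of `ζ(2s - 1)` at `s = 1` has residue `1/2`, which halves the constant `6/π²` of the
preceding Euler product. -/
lemma tendsto_sub_mul_tsum_totient {N : ℕ} (hN : 0 < N) :
    Tendsto (fun s : ℂ => (s - 1) *
      ∑' k : ℕ+, ((N * k : ℕ).totient : ℂ) * ((N * k : ℕ) : ℂ) ^ (-2 * s)) toOne
      (𝓝 ((3 / (Real.pi ^ 2 * phi N) : ℝ) : ℂ)) := by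
  have h1 : Tendsto (fun s : ℂ => (2 * s - 1 - 1) * riemannZeta (2 * s - 1)) toOne (𝓝 1) := by
    have h : Tendsto (fun s : ℂ => 2 * s - 1) toOne (𝓝[≠] 1) :=
      tendsto_toOne_two_mul_sub_one.mono_right
        (nhdsWithin_mono _ fun s (hs : 1 < s.re) (h : s = 1) => by simp [h] at hs)
    exact riemannZeta_residue_one.comp h
  have h2 : Tendsto (fun s : ℂ => ∑' l : ℕ+, ((ArithmeticFunction.moebius l : ℤ) : ℂ) *
      ((l : ℕ) : ℂ) ^ (-2 * s) * ((N / Nat.gcd N l : ℕ) : ℂ) ^ (1 - 2 * s)) toOne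
      (𝓝 (∑' l : ℕ+, ((ArithmeticFunction.moebius l : ℤ) : ℂ) *
      ((l : ℕ) : ℂ) ^ (-2 * (1 : ℂ)) * ((N / Nat.gcd N l : ℕ) : ℂ) ^ (1 - 2 * (1 : ℂ)))) := by
    refine tendsto_tsum_of_dominated_convergence summable_pnat_rpow_neg_two (fun l => ?_) ?_
    · have hg : ((N / Nat.gcd N l : ℕ) : ℂ) ≠ 0 := by
        exact_mod_cast (Nat.div_pos (Nat.gcd_le_left _ hN) (Nat.gcd_pos_of_pos_left _ hN)).ne'
      have hl : ((l : ℕ) : ℂ) ≠ 0 := by exact_mod_cast l.ne_zero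
      refine Tendsto.mul (Tendsto.mul tendsto_const_nhds ?_) ?_
      · exact (tendsto_toOne.const_mul (-2)).const_cpow (Or.inl hl)
      · exact ((tendsto_toOne.const_mul 2).const_sub 1).const_cpow (Or.inl hg)
    · filter_upwards [eventually_toOne] with s hs l
      exact norm_moebius_cpow_le hN hs.1.le l
  have h3 : ∑' l : ℕ+, ((ArithmeticFunction.moebius l : ℤ) : ℂ) *
      ((l : ℕ) : ℂ) ^ (-2 * (1 : ℂ)) * ((N / Nat.gcd N l : ℕ) : ℂ) ^ (1 - 2 * (1 : ℂ)) =
      (N : ℂ)⁻¹ * (6 / Real.pi ^ 2 * ∏ p ∈ N.primeFactors, (1 + 1 / (p : ℂ))⁻¹) := by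
    rw [← tsum_moebius_gcd hN, ← PNat.coe_injective.tsum_eq, ← tsum_mul_left]
    · refine tsum_congr fun l => ?_
      have hN' : (N : ℂ) ≠ 0 := by exact_mod_cast hN.ne'
      have hg : (Nat.gcd N l : ℂ) ≠ 0 := by
        exact_mod_cast (Nat.gcd_pos_of_pos_left _ hN).ne'
      rw [Nat.cast_div (Nat.gcd_dvd_left _ _) hg, show (1 - 2 * (1 : ℂ)) = -1 by norm_num,
        Complex.cpow_neg_one, mul_one, Complex.cpow_neg,
        Complex.cpow_ofNat]
      field_simp
    · intro n hn
      rcases Nat.eq_zero_or_pos n with rfl | h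
      · simp at hn
      · exact ⟨⟨n, h⟩, rfl⟩
  have h4 := (h1.mul h2).const_mul (1 / 2)
  rw [h3] at h4
  refine (h4.congr' ?_).trans (le_of_eq ?_)
  · filter_upwards [eventually_toOne] with s hs
    rw [tsum_totient_cpow hN hs.1]
    ring
  · congr 1
    rw [phi]
    push_cast
    rw [Finset.prod_inv_distrib]
    field_simp
    norm_num

/-! ### A family of kernels on horizontal lines, and their Fourier transforms -/

/-- The kernel `u ^ i * conj u ^ j * |u| ^ (-2τ)` for `u = x + iy`. -/
def lineKernel (y : ℝ) (i j : ℤ) (τ : ℂ) (x : ℝ) : ℂ :=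
  ((x : ℂ) + y * Complex.I) ^ i * ((x : ℂ) - y * Complex.I) ^ j * ((x : ℂ) ^ 2 + (y : ℂ) ^ 2) ^ (-τ)

/-- The Fourier transform of `lineKernel`. -/
def lineFourier (y : ℝ) (i j : ℤ) (τ : ℂ) (r : ℝ) : ℂ :=
  FourierTransform.fourier (lineKernel y i j τ) r

/-- The range of exponents in which estimates are uniform. -/
def expDomain : Set ℂ := {τ | 0 ≤ τ.re ∧ ‖τ‖ ≤ 2}

section lineKernel
variable {y : ℝ}

lemma add_mul_I_ne_zero (hy : 0 < y) (x : ℝ) : (x : ℂ) + y * Complex.I ≠ 0 := by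
  intro h
  have := congrArg Complex.im h
  simp at this
  exact hy.ne' this

lemma sub_mul_I_ne_zero (hy : 0 < y) (x : ℝ) : (x : ℂ) - y * Complex.I ≠ 0 := by
  intro h
  have := congrArg Complex.im h
  simp at this
  exact hy.ne' this

lemma add_mul_sub_I (x y : ℂ) :
    (x + y * Complex.I) * (x - y * Complex.I) = x ^ 2 + y ^ 2 := by
  linear_combination (-y ^ 2) * Complex.I_sq

lemma sq_add_sq_mem_slitPlane (hy : 0 < y) (x : ℝ) :
    (x : ℂ) ^ 2 + (y : ℂ) ^ 2 ∈ Complex.slitPlane := by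
  left
  have : (x : ℂ) ^ 2 + (y : ℂ) ^ 2 = ((x ^ 2 + y ^ 2 : ℝ) : ℂ) := by push_cast; ring
  rw [this, Complex.ofReal_re]
  positivity

/-- With `u = x + iy` one has `2x/(x² + y²) = 1/u + 1/conj u`, so the family is closed under
differentiation and each derivative lowers the total degree `i + j` by one. -/
lemma hasDerivAt_lineKernel (hy : 0 < y) (i j : ℤ) (τ : ℂ) (x : ℝ) :
    HasDerivAt (lineKernel y i j τ)
      ((i - τ) * lineKernel y (i - 1) j τ x + (j - τ) * lineKernel y i (j - 1) τ x) x := by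
  have hu := add_mul_I_ne_zero hy x
  have hv := sub_mul_I_ne_zero hy x
  have hw := sq_add_sq_mem_slitPlane hy x
  have hw0 : (x : ℂ) ^ 2 + (y : ℂ) ^ 2 ≠ 0 := Complex.slitPlane_ne_zero hw
  have h1 : HasDerivAt (fun z : ℂ => (z + y * Complex.I) ^ i)
      ((i : ℂ) * ((x : ℂ) + y * Complex.I) ^ (i - 1)) (x : ℂ) := by
    have := (hasDerivAt_zpow i _ (Or.inl hu)).comp (x : ℂ)
      ((hasDerivAt_id (x : ℂ)).add_const (y * Complex.I))
    simpa using! this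
  have h2 : HasDerivAt (fun z : ℂ => (z - y * Complex.I) ^ j)
      ((j : ℂ) * ((x : ℂ) - y * Complex.I) ^ (j - 1)) (x : ℂ) := by
    have := (hasDerivAt_zpow j _ (Or.inl hv)).comp (x : ℂ)
      ((hasDerivAt_id (x : ℂ)).sub_const (y * Complex.I))
    simpa using! this
  have h3 : HasDerivAt (fun z : ℂ => (z ^ 2 + (y : ℂ) ^ 2) ^ (-τ))
      (-τ * ((x : ℂ) ^ 2 + (y : ℂ) ^ 2) ^ (-τ - 1) * (2 * x)) (x : ℂ) := by
    have := (((hasDerivAt_pow 2 (x : ℂ)).add_const ((y : ℂ) ^ 2)).cpow_const (c := -τ) hw)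
    simpa using! this
  have h := ((h1.mul h2).mul h3).comp_ofReal
  refine h.congr_deriv ?_
  unfold lineKernel
  rw [Complex.cpow_sub _ _ hw0, Complex.cpow_one, zpow_sub_one₀ hu, zpow_sub_one₀ hv]
  have h4 : (2 * (x : ℂ)) / ((x : ℂ) ^ 2 + (y : ℂ) ^ 2) =
      ((x : ℂ) + y * Complex.I)⁻¹ + ((x : ℂ) - y * Complex.I)⁻¹ := by
    rw [← add_mul_sub_I]
    field_simp
    ring
  simp only [Pi.mul_apply]
  linear_combination (-τ) * ((x : ℂ) + y * Complex.I) ^ i * ((x : ℂ) - y * Complex.I) ^ j *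
    ((x : ℂ) ^ 2 + (y : ℂ) ^ 2) ^ (-τ) * h4

lemma norm_add_mul_I (x y : ℝ) : ‖(x : ℂ) + y * Complex.I‖ = √(x ^ 2 + y ^ 2) :=
  Complex.norm_add_mul_I x y

lemma norm_sub_mul_I (x y : ℝ) : ‖(x : ℂ) - y * Complex.I‖ = √(x ^ 2 + y ^ 2) := by
  have := Complex.norm_add_mul_I x (-y)
  rw [← neg_sq y, ← this]
  congr 1; push_cast; ring

lemma norm_lineKernel (hy : 0 < y) (i j : ℤ) (τ : ℂ) (x : ℝ) :
    ‖lineKernel y i j τ x‖ = √(x ^ 2 + y ^ 2) ^ (i + j) * (x ^ 2 + y ^ 2) ^ (-τ.re) := by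
  have h0 : 0 < x ^ 2 + y ^ 2 := by positivity
  have : (x : ℂ) ^ 2 + (y : ℂ) ^ 2 = ((x ^ 2 + y ^ 2 : ℝ) : ℂ) := by push_cast; ring
  rw [lineKernel, norm_mul, norm_mul, norm_zpow, norm_zpow, norm_add_mul_I, norm_sub_mul_I, this,
    Complex.norm_cpow_eq_rpow_re_of_pos h0, Complex.neg_re, zpow_add₀ (Real.sqrt_pos.2 h0).ne']

lemma rpow_neg_le_of_le {D ε σ : ℝ} (hε : 0 < ε) (hD : ε ≤ D) (h0 : 0 ≤ σ) (h2 : σ ≤ 2) :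
    D ^ (-σ) ≤ 1 + (ε ^ 2)⁻¹ := by
  have hD0 : 0 < D := hε.trans_le hD
  rcases le_total 1 D with h | h
  · have := Real.rpow_le_one_of_one_le_of_nonpos h (neg_nonpos.2 h0)
    have : 0 ≤ (ε ^ 2)⁻¹ := by positivity
    linarith
  · have h3 : D ^ (-σ) ≤ D ^ (-2 : ℝ) :=
      Real.rpow_le_rpow_of_exponent_ge hD0 h (by linarith)
    have h4 : D ^ (-2 : ℝ) ≤ (ε ^ 2)⁻¹ := by
      rw [Real.rpow_neg hD0.le, Real.rpow_two]
      gcongr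
    linarith

lemma re_le_two_of_mem {τ : ℂ} (hτ : τ ∈ expDomain) : τ.re ≤ 2 :=
  (Complex.re_le_norm τ).trans hτ.2

lemma norm_lineKernel_le (hy : 0 < y) {i j : ℤ} (hij : i + j ≤ -2) {τ : ℂ} (hτ : τ ∈ expDomain)
    (x : ℝ) : ‖lineKernel y i j τ x‖ ≤ y ^ (i + j + 2) * (1 + ((y ^ 2) ^ 2)⁻¹) * (x ^ 2 + y ^ 2)⁻¹ := by
  have h0 : 0 < x ^ 2 + y ^ 2 := by positivity
  have hs : 0 < √(x ^ 2 + y ^ 2) := Real.sqrt_pos.2 h0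
  rw [norm_lineKernel hy]
  have h1 : √(x ^ 2 + y ^ 2) ^ (i + j) = √(x ^ 2 + y ^ 2) ^ (i + j + 2) * (x ^ 2 + y ^ 2)⁻¹ := by
    rw [show i + j = (i + j + 2) + (-2) by ring, zpow_add₀ hs.ne']
    congr 1
    · congr 1; ring
    · rw [zpow_neg]; congr 1
      exact Real.sq_sqrt h0.le
  have h2 : √(x ^ 2 + y ^ 2) ^ (i + j + 2) ≤ y ^ (i + j + 2) := by
    have h3 : y ≤ √(x ^ 2 + y ^ 2) := Real.le_sqrt_of_sq_le (by nlinarith [sq_nonneg x])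
    obtain ⟨n, hn⟩ : ∃ n : ℕ, i + j + 2 = -(n : ℤ) := ⟨(-(i + j + 2)).toNat, by omega⟩
    rw [hn, zpow_neg, zpow_neg, zpow_natCast, zpow_natCast]
    gcongr
  have h3 := rpow_neg_le_of_le (D := x ^ 2 + y ^ 2) (ε := y ^ 2) (by positivity)
    (by nlinarith [sq_nonneg x]) hτ.1 (re_le_two_of_mem hτ)
  rw [h1]
  calc _ ≤ y ^ (i + j + 2) * (x ^ 2 + y ^ 2)⁻¹ * (1 + ((y ^ 2) ^ 2)⁻¹) := by gcongr
    _ = _ := by ring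

lemma integrable_inv_sq_add_sq (hy : 0 < y) :
    MeasureTheory.Integrable fun x : ℝ => (x ^ 2 + y ^ 2)⁻¹ := by
  have h := (integrable_inv_one_add_sq.comp_div hy.ne').const_mul (y ^ 2)⁻¹
  refine h.congr (Filter.Eventually.of_forall fun x => ?_)
  simp only
  rw [← mul_inv]
  congr 1
  field_simp
  ring

lemma integral_inv_sq_add_sq (hy : 0 < y) : ∫ x : ℝ, (x ^ 2 + y ^ 2)⁻¹ = Real.pi / y := by
  have h : ∀ x : ℝ, (x ^ 2 + y ^ 2)⁻¹ = (y ^ 2)⁻¹ * (1 + (x / y) ^ 2)⁻¹ := by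
    intro x
    rw [← mul_inv]
    congr 1
    field_simp
    ring
  simp_rw [h]
  rw [MeasureTheory.integral_const_mul,
    MeasureTheory.Measure.integral_comp_div (fun x => (1 + x ^ 2)⁻¹) y,
    integral_univ_inv_one_add_sq, abs_of_pos hy, smul_eq_mul]
  field_simp

lemma continuous_lineKernel (hy : 0 < y) (i j : ℤ) (τ : ℂ) : Continuous (lineKernel y i j τ) :=
  continuous_iff_continuousAt.2 fun x => (hasDerivAt_lineKernel hy i j τ x).continuousAt

lemma integrable_lineKernel (hy : 0 < y) {i j : ℤ} (hij : i + j ≤ -2) {τ : ℂ}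
    (hτ : τ ∈ expDomain) : MeasureTheory.Integrable (lineKernel y i j τ) :=
  ((integrable_inv_sq_add_sq hy).const_mul _).mono'
    (continuous_lineKernel hy i j τ).aestronglyMeasurable
    (Filter.Eventually.of_forall fun x => norm_lineKernel_le hy hij hτ x)

lemma lineFourier_eq (i j : ℤ) (τ : ℂ) (r : ℝ) : lineFourier y i j τ r =
    ∫ x : ℝ, Complex.exp (↑(-2 * Real.pi * x * r) * Complex.I) • lineKernel y i j τ x :=
  Real.fourier_real_eq_integral_exp_smul _ _

lemma integrable_exp_smul_lineKernel (hy : 0 < y) {i j : ℤ} (hij : i + j ≤ -2) {τ : ℂ}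
    (hτ : τ ∈ expDomain) (r : ℝ) : MeasureTheory.Integrable fun x : ℝ =>
      Complex.exp (↑(-2 * Real.pi * x * r) * Complex.I) • lineKernel y i j τ x := by
  refine (integrable_lineKernel hy hij hτ).mono (Continuous.aestronglyMeasurable ?_)
    (Filter.Eventually.of_forall fun x => ?_)
  · exact (by fun_prop : Continuous fun v : ℝ =>
      Complex.exp (↑(-2 * Real.pi * v * r) * Complex.I)).smul (continuous_lineKernel hy i j τ)
  · rw [norm_smul, Complex.norm_exp_ofReal_mul_I, one_mul]

lemma norm_fourier_lineKernel_le (hy : 0 < y) {i j : ℤ} (hij : i + j ≤ -2) {τ : ℂ}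
    (hτ : τ ∈ expDomain) (r : ℝ) : ‖lineFourier y i j τ r‖ ≤
      y ^ (i + j + 2) * (1 + ((y ^ 2) ^ 2)⁻¹) * (Real.pi / y) := by
  rw [lineFourier_eq, ← integral_inv_sq_add_sq hy,
    ← MeasureTheory.integral_const_mul]
  refine MeasureTheory.norm_integral_le_of_norm_le ((integrable_inv_sq_add_sq hy).const_mul _)
    (Filter.Eventually.of_forall fun x => ?_)
  rw [norm_smul, Complex.norm_exp_ofReal_mul_I, one_mul]
  exact norm_lineKernel_le hy hij hτ x

/-- The Fourier transform of the derivative: a factor `r` is traded for a kernel of lower degree,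
again integrable. -/
lemma fourier_lineKernel_rec (hy : 0 < y) {i j : ℤ} (hij : i + j ≤ -2) {τ : ℂ}
    (hτ : τ ∈ expDomain) (r : ℝ) :
    (2 * Real.pi * Complex.I * r) * lineFourier y i j τ r =
      (i - τ) * lineFourier y (i - 1) j τ r + (j - τ) * lineFourier y i (j - 1) τ r := by
  have hi := integrable_lineKernel hy hij hτ
  have h1 := integrable_lineKernel hy (i := i - 1) (j := j) (by omega) hτ
  have h2 := integrable_lineKernel hy (i := i) (j := j - 1) (by omega) hτ
  have hd : deriv (lineKernel y i j τ) = (((i : ℂ) - τ) • lineKernel y (i - 1) j τ) +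
      (((j : ℂ) - τ) • lineKernel y i (j - 1) τ) := by
    ext x
    rw [(hasDerivAt_lineKernel hy i j τ x).deriv]
    simp
  have h := Real.fourier_deriv hi (fun x => (hasDerivAt_lineKernel hy i j τ x).differentiableAt)
    (by rw [hd]; exact (h1.smul _).add (h2.smul _))
  have h3 := congrFun h r
  rw [smul_eq_mul] at h3
  have h4 : (2 * Real.pi * Complex.I * r) * lineFourier y i j τ r =
      FourierTransform.fourier (deriv (lineKernel y i j τ)) r := h3.symm
  rw [h4, hd, Real.fourier_real_eq_integral_exp_smul, lineFourier_eq, lineFourier_eq,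
    ← MeasureTheory.integral_const_mul, ← MeasureTheory.integral_const_mul,
    ← MeasureTheory.integral_add
      ((integrable_exp_smul_lineKernel hy (by omega) hτ r).const_mul _)
      ((integrable_exp_smul_lineKernel hy (by omega) hτ r).const_mul _)]
  congr 1
  ext x
  simp only [Pi.add_apply, Pi.smul_apply, smul_eq_mul]
  ring

/-- Induction by the recursion. The constants are uniform because `|i - τ| ≤ |i| + 2` and `|j - τ| ≤
|j| + 2` on `expDomain`. -/
lemma pow_mul_norm_fourier_lineKernel_le (hy : 0 < y) (k : ℕ) :
    ∀ i j : ℤ, i + j ≤ -2 → ∃ C : ℝ, 0 ≤ C ∧ ∀ τ ∈ expDomain, ∀ r : ℝ,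
      |r| ^ k * ‖lineFourier y i j τ r‖ ≤ C := by
  induction k with
  | zero =>
    intro i j hij
    refine ⟨_, le_trans (norm_nonneg _)
      (norm_fourier_lineKernel_le hy hij (τ := 0) ⟨by simp, by simp⟩ 0), fun τ hτ r => ?_⟩
    rw [pow_zero, one_mul]
    exact norm_fourier_lineKernel_le hy hij hτ r
  | succ k ih =>
    intro i j hij
    obtain ⟨C₁, hC₁, h1⟩ := ih (i - 1) j (by omega)
    obtain ⟨C₂, hC₂, h2⟩ := ih i (j - 1) (by omega)
    refine ⟨(‖(i : ℂ)‖ + 2) * C₁ + (‖(j : ℂ)‖ + 2) * C₂, by positivity, fun τ hτ r => ?_⟩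
    have h := congrArg norm (fourier_lineKernel_rec hy hij hτ r)
    have hpi : (1 : ℝ) ≤ 2 * Real.pi := by linarith [Real.two_le_pi]
    have h3 : ‖(2 * Real.pi * Complex.I * r : ℂ)‖ = 2 * Real.pi * |r| := by
      simp [abs_of_pos Real.pi_pos]
    rw [norm_mul, h3] at h
    have h4 : |r| * ‖lineFourier y i j τ r‖ ≤
        (‖(i : ℂ)‖ + 2) * ‖lineFourier y (i - 1) j τ r‖ +
        (‖(j : ℂ)‖ + 2) * ‖lineFourier y i (j - 1) τ r‖ := by
      calc |r| * ‖lineFourier y i j τ r‖ ≤ 2 * Real.pi * |r| * ‖lineFourier y i j τ r‖ := by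
            rw [mul_assoc]
            exact le_mul_of_one_le_left (by positivity) hpi
        _ ≤ _ := by
            rw [h]
            refine (norm_add_le _ _).trans ?_
            rw [norm_mul, norm_mul]
            gcongr
            · exact (norm_sub_le _ _).trans (by linarith [hτ.2])
            · exact (norm_sub_le _ _).trans (by linarith [hτ.2])
    calc |r| ^ (k + 1) * ‖lineFourier y i j τ r‖
        = |r| ^ k * (|r| * ‖lineFourier y i j τ r‖) := by ring
      _ ≤ |r| ^ k * ((‖(i : ℂ)‖ + 2) * ‖lineFourier y (i - 1) j τ r‖ +
        (‖(j : ℂ)‖ + 2) * ‖lineFourier y i (j - 1) τ r‖) := by gcongr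
      _ = (‖(i : ℂ)‖ + 2) * (|r| ^ k * ‖lineFourier y (i - 1) j τ r‖) +
        (‖(j : ℂ)‖ + 2) * (|r| ^ k * ‖lineFourier y i (j - 1) τ r‖) := by ring
      _ ≤ _ := by
        gcongr
        · exact h1 τ hτ r
        · exact h2 τ hτ r

/-- The cube is deliberate: one power pays for the linear growth of the Kloosterman bound in the
frequency, the other two give summability over `ℤ`. -/
lemma exists_norm_fourier_lineKernel_le (hy : 0 < y) {i j : ℤ} (hij : i + j ≤ -2) :
    ∃ C : ℝ, 0 ≤ C ∧ ∀ τ ∈ expDomain, ∀ r : ℤ,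
      ‖lineFourier y i j τ r‖ ≤ C / (1 + |(r : ℝ)|) ^ 3 := by
  obtain ⟨C₀, hC₀, h0⟩ := pow_mul_norm_fourier_lineKernel_le hy 0 i j hij
  obtain ⟨C₃, hC₃, h3⟩ := pow_mul_norm_fourier_lineKernel_le hy 3 i j hij
  refine ⟨4 * (C₀ + C₃), by positivity, fun τ hτ r => ?_⟩
  rw [le_div_iff₀ (by positivity)]
  have e0 := h0 τ hτ r
  have e3 := h3 τ hτ r
  have hp : (1 + |(r : ℝ)|) ^ 3 ≤ 4 * (1 + |(r : ℝ)| ^ 3) := by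
    have := abs_nonneg (r : ℝ)
    nlinarith [mul_nonneg this (sq_nonneg (|(r : ℝ)| - 1)), sq_nonneg (|(r : ℝ)| - 1)]
  calc _ ≤ ‖lineFourier y i j τ r‖ * (4 * (1 + |(r : ℝ)| ^ 3)) := by gcongr
    _ = 4 * (|(r : ℝ)| ^ 0 * ‖lineFourier y i j τ r‖ +
      |(r : ℝ)| ^ 3 * ‖lineFourier y i j τ r‖) := by ring
    _ ≤ _ := by gcongr

lemma tsum_lineKernel_add_int (hy : 0 < y) {i j : ℤ} (hij : i + j ≤ -2) {τ : ℂ}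
    (hτ : τ ∈ expDomain) (x : ℝ) :
    ∑' n : ℤ, lineKernel y i j τ (x + n) =
      ∑' r : ℤ, lineFourier y i j τ r * Complex.exp (2 * Real.pi * Complex.I * (r * x)) := by
  have h := Real.tsum_eq_tsum_fourier_of_rpow_decay (continuous_lineKernel hy i j τ)
    (b := 2) one_lt_two ?_ ?_ x
  · rw [h]
    refine tsum_congr fun r => ?_
    rw [fourier_coe_apply]
    unfold lineFourier
    congr 2
    push_cast
    ring
  · refine Asymptotics.IsBigO.of_bound (y ^ (i + j + 2) * (1 + ((y ^ 2) ^ 2)⁻¹)) ?_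
    filter_upwards [(Filter.eventually_cofinite_ne (0 : ℝ)).filter_mono
      (by exact Filter.cocompact_le_cofinite)] with x hx
    refine (norm_lineKernel_le hy hij hτ x).trans ?_
    rw [Real.rpow_neg (abs_nonneg _), Real.rpow_two, sq_abs, norm_inv, Real.norm_of_nonneg (sq_nonneg x)]
    gcongr
    nlinarith [sq_nonneg y]
  · obtain ⟨C, hC, h⟩ := pow_mul_norm_fourier_lineKernel_le hy 2 i j hij
    refine Asymptotics.IsBigO.of_bound C ?_
    filter_upwards [(Filter.eventually_cofinite_ne (0 : ℝ)).filter_mono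
      (by exact Filter.cocompact_le_cofinite)] with r hr
    have := h τ hτ r
    rw [Real.rpow_neg (abs_nonneg _), Real.rpow_two, norm_inv, norm_pow, Real.norm_eq_abs, abs_abs,
      ← div_eq_mul_inv, le_div_iff₀ (by positivity), mul_comm]
    exact this

lemma tendsto_fourier_lineKernel (hy : 0 < y) {i j : ℤ} (hij : i + j ≤ -2) {α : Type*}
    {l : Filter α} [l.IsCountablyGenerated] {t : α → ℂ} (ht : Tendsto t l (𝓝 0))
    (ht' : ∀ᶠ a in l, t a ∈ expDomain) (r : ℝ) :
    Tendsto (fun a => lineFourier y i j (t a) r) l (𝓝 (lineFourier y i j 0 r)) := by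
  simp only [lineFourier_eq]
  refine MeasureTheory.tendsto_integral_filter_of_dominated_convergence
    (fun x => y ^ (i + j + 2) * (1 + ((y ^ 2) ^ 2)⁻¹) * (x ^ 2 + y ^ 2)⁻¹) ?_ ?_
    ((integrable_inv_sq_add_sq hy).const_mul _) ?_
  · refine Filter.Eventually.of_forall fun a => Continuous.aestronglyMeasurable ?_
    exact (by fun_prop : Continuous fun v : ℝ =>
      Complex.exp (↑(-2 * Real.pi * v * r) * Complex.I)).smul (continuous_lineKernel hy i j (t a))
  · filter_upwards [ht'] with a ha
    refine Filter.Eventually.of_forall fun x => ?_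
    rw [norm_smul, Complex.norm_exp_ofReal_mul_I, one_mul]
    exact norm_lineKernel_le hy hij ha x
  · refine Filter.Eventually.of_forall fun x => ?_
    refine Tendsto.const_smul ?_ _
    refine Tendsto.const_mul _ ?_
    exact ht.neg.const_cpow (Or.inl (Complex.slitPlane_ne_zero (sq_add_sq_mem_slitPlane hy x)))

lemma zero_mem_expDomain : (0 : ℂ) ∈ expDomain := ⟨by simp, by simp⟩

lemma tendsto_lineKernel_zero (hy : 0 < y) {τ : ℂ} (hτ : τ ∈ expDomain) :
    Tendsto (lineKernel y (-1) 0 τ) (Filter.cocompact ℝ) (𝓝 0) := by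
  have h : ∀ x : ℝ, x ≠ 0 → ‖lineKernel y (-1) 0 τ x‖ ≤ (1 + ((y ^ 2) ^ 2)⁻¹) * |x|⁻¹ := by
    intro x hx
    rw [norm_lineKernel hy]
    have h3 := rpow_neg_le_of_le (D := x ^ 2 + y ^ 2) (ε := y ^ 2) (by positivity)
      (by nlinarith [sq_nonneg x]) hτ.1 (re_le_two_of_mem hτ)
    rw [show (-1 + 0 : ℤ) = -1 by norm_num, zpow_neg_one]
    rw [mul_comm]
    gcongr
    exact Real.le_sqrt_of_sq_le (by rw [sq_abs]; nlinarith [sq_nonneg y])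
  refine squeeze_zero_norm' ((Filter.eventually_cofinite_ne (0 : ℝ)).filter_mono
    Filter.cocompact_le_cofinite |>.mono fun x hx => h x hx) ?_
  have h2 : Tendsto (fun x : ℝ => |x|⁻¹) (Filter.cocompact ℝ) (𝓝 0) :=
    tendsto_inv_atTop_zero.comp (tendsto_norm_cocompact_atTop (E := ℝ))
  simpa using h2.const_mul (1 + ((y ^ 2) ^ 2)⁻¹)

/-- The kernel of degree `-1` vanishes at infinity, so the integral of its derivative is zero. It is
the source of the zero at `τ = 0` of the mean of the `(-2, 0)` kernel, which cancels the pole of the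
totient series. -/
lemma fourier_lineKernel_at_zero (hy : 0 < y) {τ : ℂ} (hτ : τ ∈ expDomain) :
    (1 + τ) * lineFourier y (-2) 0 τ 0 = -τ * lineFourier y (-1) (-1) τ 0 := by
  have h1 := integrable_lineKernel hy (i := -2) (j := 0) (by norm_num) hτ
  have h2 := integrable_lineKernel hy (i := -1) (j := -1) (by norm_num) hτ
  have e1 : ∀ i j : ℤ, lineFourier y i j τ 0 = ∫ x, lineKernel y i j τ x := by
    intro i j
    rw [lineFourier_eq]
    simp
  have h := MeasureTheory.integral_of_hasDerivAt_of_tendsto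
    (f' := fun x => (((-1 : ℤ) : ℂ) - τ) * lineKernel y (-2) 0 τ x +
      (((0 : ℤ) : ℂ) - τ) * lineKernel y (-1) (-1) τ x) (fun x => hasDerivAt_lineKernel hy (-1) 0 τ x) ((h1.const_mul _).add (h2.const_mul _))
    ((tendsto_lineKernel_zero hy hτ).mono_left atBot_le_cocompact)
    ((tendsto_lineKernel_zero hy hτ).mono_left atTop_le_cocompact)
  rw [MeasureTheory.integral_add (h1.const_mul _) (h2.const_mul _),
    MeasureTheory.integral_const_mul, MeasureTheory.integral_const_mul, ← e1, ← e1] at h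
  push_cast at h
  linear_combination -h

lemma fourier_lineKernel_zero_zero (hy : 0 < y) : lineFourier y (-2) 0 0 (0 : ℝ) = 0 := by
  have := fourier_lineKernel_at_zero hy zero_mem_expDomain
  simpa using this

lemma fourier_lineKernel_neg_one_zero (hy : 0 < y) :
    lineFourier y (-1) (-1) 0 (0 : ℝ) = ((Real.pi / y : ℝ) : ℂ) := by
  rw [lineFourier_eq, ← integral_inv_sq_add_sq hy, ← integral_complex_ofReal]
  congr 1
  ext x
  rw [lineKernel, neg_zero, Complex.cpow_zero, mul_one, zpow_neg_one, zpow_neg_one, ← mul_inv,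
    add_mul_sub_I]
  simp

end lineKernel

/-! ### Representatives of the cosets -/

/-- Indices `(c, d mod c, n)` for the cosets with positive lower left entry `c = N k`. -/
abbrev CuspIdx (N : ℕ) : Type := Σ k : ℕ+, (ZMod (N * k))ˣ × ℤ

namespace CuspIdx
variable {N : ℕ} [NeZero N]

/-- The lower left entry. -/
def c (i : CuspIdx N) : ℕ := N * i.1

/-- The lower right entry. -/
def d (i : CuspIdx N) : ℤ := ((i.2.1 : ZMod (N * i.1)).val : ℤ) + (i.c : ℤ) * i.2.2

/-- The upper left entry. -/
def a (i : CuspIdx N) : ℕ := ((i.2.1⁻¹ : (ZMod (N * i.1))ˣ) : ZMod (N * i.1)).val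

lemma c_pos (i : CuspIdx N) : 0 < i.c := Nat.mul_pos (NeZero.pos N) i.1.pos

lemma c_dvd (i : CuspIdx N) : (i.c : ℤ) ∣ i.a * i.d - 1 := by
  have h : ((i.a * i.d - 1 : ℤ) : ZMod (N * i.1)) = 0 := by
    have h1 : ((i.c : ℤ) : ZMod (N * i.1)) = 0 := by
      rw [Int.cast_natCast]; exact ZMod.natCast_self _
    rw [d]
    push_cast at h1 ⊢
    rw [h1, a]
    simp
  exact (ZMod.intCast_zmod_eq_zero_iff_dvd _ _).1 h

/-- The representative with bottom row `(c, d)`. -/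
def mat (i : CuspIdx N) : SL(2, ℤ) :=
  ⟨!![(i.a : ℤ), (i.a * i.d - 1) / i.c; (i.c : ℤ), i.d], by
    rw [Matrix.det_fin_two_of, Int.ediv_mul_cancel i.c_dvd]; ring⟩

@[simp] lemma mat_zero_zero (i : CuspIdx N) : i.mat 0 0 = i.a := rfl
@[simp] lemma mat_one_zero (i : CuspIdx N) : i.mat 1 0 = i.c := rfl
@[simp] lemma mat_one_one (i : CuspIdx N) : i.mat 1 1 = i.d := rfl

lemma mat_mem (i : CuspIdx N) : i.mat ∈ CongruenceSubgroup.Gamma0 N := by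
  rw [CongruenceSubgroup.Gamma0_mem, mat_one_zero, c]
  simp

/-- The point `z + d / c`. -/
def pt (i : CuspIdx N) (z : ℂ) : ℂ :=
  z + (((i.2.1 : ZMod (N * i.1)).val : ℝ) / (i.c : ℝ) : ℝ) + i.2.2

lemma c_ne_zero (i : CuspIdx N) : (i.c : ℂ) ≠ 0 := by exact_mod_cast i.c_pos.ne'

lemma autom_mat (i : CuspIdx N) (z : ℍ) : autom i.mat z = i.c * i.pt z := by
  have := i.c_ne_zero
  simp only [autom, mat_one_zero, mat_one_one, d, pt]
  push_cast
  field_simp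
  ring

lemma autom_ne_zero (γ : SL(2, ℤ)) (z : ℍ) : autom γ z ≠ 0 := by
  have := UpperHalfPlane.denom_ne_zero γ z
  rwa [ModularGroup.denom_apply] at this

lemma smul_eq (γ : SL(2, ℤ)) (z : ℍ) : ((γ • z : ℍ) : ℂ) =
    ((γ 0 0 : ℂ) * z + (γ 0 1 : ℂ)) / autom γ z := by
  rw [UpperHalfPlane.coe_specialLinearGroup_apply, autom]
  simp

/-- The determinant relation isolates the cusp `γ∞ = a/c`; the deviation from it is at most `1/|cz +
d|`, and this drives every convergence argument at `s = 1`. -/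
lemma mat_smul (i : CuspIdx N) (z : ℍ) : ((i.mat • z : ℍ) : ℂ) =
    (i.a : ℂ) / i.c - 1 / (i.c * autom i.mat z) := by
  have h := autom_ne_zero i.mat z
  have hc := i.c_ne_zero
  have hdet := Matrix.SpecialLinearGroup.det_coe i.mat
  rw [Matrix.det_fin_two, mat_zero_zero, mat_one_zero, mat_one_one] at hdet
  have hdet' : (i.a : ℂ) * i.d - (i.mat 0 1 : ℂ) * i.c = 1 := by exact_mod_cast hdet
  rw [smul_eq, mat_zero_zero]
  field_simp
  rw [autom, mat_one_zero, mat_one_one]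
  push_cast
  linear_combination (-1 : ℂ) * hdet'

end CuspIdx

/-! ### Enumeration of `Γ₀(N)` and of its cosets by sign and bottom row. -/

lemma exists_eq_T_zpow_mul {g h : SL(2, ℤ)} (h0 : g 1 0 = h 1 0) (h1 : g 1 1 = h 1 1) :
    ∃ n : ℤ, g = ModularGroup.T ^ n * h := by
  have hg := Matrix.SpecialLinearGroup.det_coe g
  have hh := Matrix.SpecialLinearGroup.det_coe h
  rw [Matrix.det_fin_two] at hg hh
  rw [← h0, ← h1] at hh
  -- The exponent is the upper right entry of `g h⁻¹`.
  refine ⟨-g 0 0 * h 0 1 + g 0 1 * h 0 0, ?_⟩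
  ext i j
  rw [Matrix.SpecialLinearGroup.coe_mul, ModularGroup.coe_T_zpow]
  fin_cases i <;> fin_cases j <;> simp [Matrix.mul_apply, Fin.sum_univ_two]
  · rw [← h0]; linear_combination (h 0 0) * hg - g 0 0 * hh
  · rw [← h1]; linear_combination (h 0 1) * hg - g 0 1 * hh
  · exact h0
  · exact h1

lemma hasSum_option {α : Type*} {f : Option α → ℂ} {a : ℂ} (h : HasSum (fun i => f (some i)) a) :
    HasSum f (f none + a) := by
  rw [← (Equiv.optionEquivSumPUnit.{0} α).symm.hasSum_iff, add_comm]
  refine HasSum.sum ?_ ?_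
  · exact h
  · exact hasSum_unique (f ∘ (Equiv.optionEquivSumPUnit.{0} α).symm ∘ Sum.inr)

lemma hasSum_bool_prod {α : Type*} {f : Bool × α → ℂ} {a : ℂ}
    (h : ∀ b, HasSum (fun i => f (b, i)) a) : HasSum f (2 * a) := by
  rw [← (Equiv.boolProdEquivSum α).symm.hasSum_iff, two_mul]
  exact HasSum.sum (h false) (h true)

lemma neg_mem_Gamma0 (N : ℕ) {γ : SL(2, ℤ)} (h : γ ∈ CongruenceSubgroup.Gamma0 N) :
    -γ ∈ CongruenceSubgroup.Gamma0 N := by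
  rw [CongruenceSubgroup.Gamma0_mem] at h ⊢
  rw [Matrix.SpecialLinearGroup.coe_neg, Matrix.neg_apply]
  push_cast
  rw [h, neg_zero]

lemma T_zpow_mem (N : ℕ) (n : ℤ) : ModularGroup.T ^ n ∈ CongruenceSubgroup.Gamma0 N := by
  rw [CongruenceSubgroup.Gamma0_mem, ModularGroup.coe_T_zpow]
  simp

section reps
variable (N : ℕ) [NeZero N]

/-- Representatives of the cosets up to sign. -/
def repMat : Option (CuspIdx N) → SL(2, ℤ)
  | none => 1
  | some i => i.mat

lemma repMat_mem (o : Option (CuspIdx N)) : repMat N o ∈ CongruenceSubgroup.Gamma0 N := by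
  cases o with
  | none => exact one_mem _
  | some i => exact i.mat_mem

/-- Representatives of the cosets. -/
def rep (x : Bool × Option (CuspIdx N)) : SL(2, ℤ) :=
  if x.1 then repMat N x.2 else -repMat N x.2

lemma rep_mem (x : Bool × Option (CuspIdx N)) : rep N x ∈ CongruenceSubgroup.Gamma0 N := by
  unfold rep
  split_ifs
  · exact repMat_mem N _
  · exact neg_mem_Gamma0 N (repMat_mem N _)

lemma CuspIdx.ext_of_c_d {i j : CuspIdx N} (hc : i.c = j.c) (hd : i.d = j.d) : i = j := by
  obtain ⟨k, u, n⟩ := i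
  obtain ⟨l, v, m⟩ := j
  have hkl : k = l := PNat.eq (Nat.eq_of_mul_eq_mul_left (NeZero.pos N) hc)
  subst hkl
  have hcp : (0 : ℤ) < ((N * k : ℕ) : ℤ) := by
    exact_mod_cast Nat.mul_pos (NeZero.pos N) k.pos
  have hu := ZMod.val_lt (u : ZMod (N * k))
  have hv := ZMod.val_lt (v : ZMod (N * k))
  simp only [CuspIdx.d, CuspIdx.c] at hd
  have h1 : (u : ZMod (N * k)) = v := by
    have := congrArg (fun x : ℤ => (x : ZMod (N * k))) hd
    have h0 : (((N * k : ℕ) : ℤ) : ZMod (N * k)) = 0 := by rw [Int.cast_natCast, ZMod.natCast_self]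
    simp only [Int.cast_add, Int.cast_mul (((N * k : ℕ) : ℤ)), h0] at this
    simpa using this
  have h2 : u = v := Units.ext h1
  subst h2
  have h3 : n = m := mul_left_cancel₀ hcp.ne' (add_left_cancel hd)
  rw [h3]

lemma CuspIdx.exists_of_pos {γ : SL(2, ℤ)} (h : γ ∈ CongruenceSubgroup.Gamma0 N)
    (hc : 0 < γ 1 0) : ∃ i : CuspIdx N, (i.c : ℤ) = γ 1 0 ∧ i.d = γ 1 1 := by
  rw [CongruenceSubgroup.Gamma0_mem, ZMod.intCast_zmod_eq_zero_iff_dvd] at h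
  obtain ⟨k, hk⟩ := h
  have hN : (0 : ℤ) < N := by exact_mod_cast NeZero.pos N
  have hk0 : 0 < k := by
    rw [hk] at hc
    exact (mul_pos_iff_of_pos_left hN).1 hc
  lift k to ℕ using hk0.le
  have hk1 : 0 < k := by exact_mod_cast hk0
  let K : ℕ+ := ⟨k, hk1⟩
  have hcK : ((N * K : ℕ) : ℤ) = γ 1 0 := by rw [hk]; push_cast; rfl
  have hdet := Matrix.SpecialLinearGroup.det_coe γ
  rw [Matrix.det_fin_two] at hdet
  have hmul : ((γ 1 1 : ℤ) : ZMod (N * K)) * ((γ 0 0 : ℤ) : ZMod (N * K)) = 1 := by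
    have h0 : ((γ 1 0 : ℤ) : ZMod (N * K)) = 0 := by
      rw [← hcK, Int.cast_natCast, ZMod.natCast_self]
    have := congrArg (fun x : ℤ => (x : ZMod (N * K))) hdet
    simp only [Int.cast_sub, Int.cast_mul, h0, Int.cast_one] at this
    linear_combination this
  let u : (ZMod (N * K))ˣ := ⟨(γ 1 1 : ℤ), (γ 0 0 : ℤ), hmul, (mul_comm _ _).trans hmul⟩
  refine ⟨⟨K, u, γ 1 1 / (N * K : ℕ)⟩, hcK, ?_⟩
  simp only [CuspIdx.d, CuspIdx.c, u]
  rw [ZMod.val_intCast]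
  exact Int.emod_add_mul_ediv _ _

lemma eq_of_T_zpow_mul_rep_eq {x y : Bool × Option (CuspIdx N)} {n m : ℤ}
    (h : ModularGroup.T ^ n * rep N x = ModularGroup.T ^ m * rep N y) : x = y ∧ n = m := by
  have hrow : ∀ (n : ℤ) (γ : SL(2, ℤ)) (j : Fin 2), (ModularGroup.T ^ n * γ) 1 j = γ 1 j := by
    intro n γ j
    rw [Matrix.SpecialLinearGroup.coe_mul, ModularGroup.coe_T_zpow]
    simp [Matrix.mul_apply, Fin.sum_univ_two]
  have h0 : rep N x 1 0 = rep N y 1 0 := by rw [← hrow n, h, hrow]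
  have h1 : rep N x 1 1 = rep N y 1 1 := by rw [← hrow n, h, hrow]
  have hxy : x = y := by
    obtain ⟨b, o⟩ := x
    obtain ⟨b', o'⟩ := y
    rcases b <;> rcases b' <;> rcases o with _ | i <;> rcases o' with _ | j <;>
      simp [rep, repMat] at h0 h1 ⊢
    all_goals first
      | exact CuspIdx.ext_of_c_d N (by omega) (by omega)
      | (have hi := i.c_pos; have hj := j.c_pos; omega)
      | (have hi := i.c_pos; omega)
      | (have hj := j.c_pos; omega)
  refine ⟨hxy, ?_⟩
  rw [hxy] at h
  have h2 := mul_right_cancel h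
  have h3 := congrArg (fun g : SL(2, ℤ) => g 0 1) h2
  simp only [ModularGroup.coe_T_zpow] at h3
  simpa using h3

lemma exists_eq_T_zpow_mul_rep {γ : SL(2, ℤ)} (h : γ ∈ CongruenceSubgroup.Gamma0 N) :
    ∃ (x : Bool × Option (CuspIdx N)) (n : ℤ), γ = ModularGroup.T ^ n * rep N x := by
  rcases lt_trichotomy (γ 1 0) 0 with hc | hc | hc
  · obtain ⟨i, h1, h2⟩ := CuspIdx.exists_of_pos N (neg_mem_Gamma0 N h) (by simpa using hc)
    refine ⟨(false, some i), exists_eq_T_zpow_mul ?_ ?_⟩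
    · simp [rep, repMat, h1]
    · simp [rep, repMat, h2]
  · have hdet := Matrix.SpecialLinearGroup.det_coe γ
    rw [Matrix.det_fin_two, hc, mul_zero, sub_zero] at hdet
    rcases Int.eq_one_or_neg_one_of_mul_eq_one ((mul_comm _ _).trans hdet) with hd | hd
    · refine ⟨(true, none), exists_eq_T_zpow_mul ?_ ?_⟩
      · simp [rep, repMat, hc]
      · simp [rep, repMat, hd]
    · refine ⟨(false, none), exists_eq_T_zpow_mul ?_ ?_⟩
      · simp [rep, repMat, hc]
      · simp [rep, repMat, hd]
  · obtain ⟨i, h1, h2⟩ := CuspIdx.exists_of_pos N h hc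
    refine ⟨(true, some i), exists_eq_T_zpow_mul ?_ ?_⟩
    · simp [rep, repMat, h1]
    · simp [rep, repMat, h2]

/-- The elements of `Γ₀(N)` are `± T ^ n γ` with `γ` a representative. -/
def gammaEquiv : (Bool × Option (CuspIdx N)) × ℤ ≃ CongruenceSubgroup.Gamma0 N :=
  Equiv.ofBijective
    (fun x => ⟨ModularGroup.T ^ x.2 * rep N x.1, mul_mem (T_zpow_mem N _) (rep_mem N _)⟩)
    ⟨fun x y h => by
      obtain ⟨h1, h2⟩ := eq_of_T_zpow_mul_rep_eq N (congrArg Subtype.val h)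
      exact Prod.ext h1 h2,
    fun γ => by
      obtain ⟨x, n, h⟩ := exists_eq_T_zpow_mul_rep N γ.2
      exact ⟨(x, n), Subtype.ext h.symm⟩⟩

/-- The cosets `Γ_∞ γ`, with `γ` up to sign a representative. -/
def cosetEquiv : Bool × Option (CuspIdx N) ≃ Cosets N :=
  Equiv.ofBijective (fun x => Quotient.mk _ ⟨rep N x, rep_mem N x⟩)
    ⟨fun x y h => by
      obtain ⟨n, hn⟩ := exists_zpow_of_rel (Quotient.exact h)
      have : ModularGroup.T ^ (0 : ℤ) * rep N y = ModularGroup.T ^ n * rep N x := by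
        rw [zpow_zero, one_mul]; exact hn
      exact (eq_of_T_zpow_mul_rep_eq N this).1.symm,
    fun q => by
      induction q using Quotient.inductionOn with
      | h γ =>
        obtain ⟨x, n, h⟩ := exists_eq_T_zpow_mul_rep N γ.2
        refine ⟨x, Quotient.sound ?_⟩
        change (QuotientGroup.rightRel (GammaInf N)) _ _
        rw [QuotientGroup.rightRel_apply, GammaInf, Subgroup.mem_subgroupOf,
          Subgroup.mem_zpowers_iff]
        refine ⟨n, ?_⟩
        simp [h]⟩

/-- Both signs contribute equally, whence the factor `2`, which cancels the `1/2` in the definitions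
of the series. The summand `F 1` is the coset with `c = 0`. -/
lemma hasSum_cosets {F : SL(2, ℤ) → ℂ} (hF : ∀ γ, F (-γ) = F γ) {f : Cosets N → ℂ}
    (hf : ∀ γ : CongruenceSubgroup.Gamma0 N, f (Quotient.mk _ γ) = F γ) {a : ℂ}
    (h : HasSum (fun i : CuspIdx N => F i.mat) a) : HasSum f (2 * (F 1 + a)) := by
  rw [← (cosetEquiv N).hasSum_iff]
  refine hasSum_bool_prod fun b => ?_
  have h1 : (fun o => (f ∘ cosetEquiv N) (b, o)) = fun o => F (repMat N o) := by
    ext o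
    change f (Quotient.mk _ ⟨rep N (b, o), _⟩) = _
    rw [hf]
    cases b <;> simp [rep, hF]
  rw [h1]
  exact hasSum_option (f := fun o => F (repMat N o)) h

end reps

/-! ### Uniform estimates for the summands -/

/-- The sum is periodic in `X`, so it is enough to bound it for `0 ≤ X < 1`, by a series independent
of `X`. -/
lemma exists_tsum_inv_sq_add_sq_le {y : ℝ} (hy : 0 < y) : ∃ C : ℝ, 0 ≤ C ∧ ∀ X : ℝ,
    (Summable fun n : ℤ => ((X + n) ^ 2 + y ^ 2)⁻¹) ∧ ∑' n : ℤ, ((X + n) ^ 2 + y ^ 2)⁻¹ ≤ C := by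
  have hs : Summable fun n : ℤ => (2 + 3 / y ^ 2) * ((n : ℝ) ^ 2 + 1)⁻¹ := by
    refine Summable.mul_left _ ?_
    have h2 : Summable fun n : ℤ => 1 / (n : ℝ) ^ 2 := Real.summable_one_div_int_pow.2 (by norm_num)
    refine Summable.of_norm_bounded_eventually h2 ?_
    filter_upwards [Filter.eventually_cofinite_ne (0 : ℤ)] with n hn
    have : (n : ℝ) ≠ 0 := by exact_mod_cast hn
    rw [norm_inv, Real.norm_of_nonneg (by positivity), one_div]
    gcongr
    linarith
  have key : ∀ X : ℝ, 0 ≤ X → X < 1 → ∀ n : ℤ,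
      ((X + n) ^ 2 + y ^ 2)⁻¹ ≤ (2 + 3 / y ^ 2) * ((n : ℝ) ^ 2 + 1)⁻¹ := by
    intro X h0 h1 n
    rw [← div_eq_mul_inv, le_div_iff₀ (by positivity), inv_mul_le_iff₀ (by positivity)]
    -- `2(X + n)² + 2X² - n² = (n + 2X)²`, and `X² < 1`; the constant `2 + 3/y²` is fitted to this.
    have h2 : (n : ℝ) ^ 2 + 1 ≤ 2 * (X + n) ^ 2 + 3 := by
      nlinarith [sq_nonneg ((n : ℝ) + 2 * X)]
    have h3 : 2 * (X + n) ^ 2 + 3 ≤ ((X + n) ^ 2 + y ^ 2) * (2 + 3 / y ^ 2) := by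
      have : ((X + n) ^ 2 + y ^ 2) * (2 + 3 / y ^ 2) =
          2 * (X + n) ^ 2 + 3 + 2 * y ^ 2 + 3 * (X + n) ^ 2 / y ^ 2 := by field_simp; ring
      rw [this]
      have : 0 ≤ 3 * (X + n) ^ 2 / y ^ 2 := by positivity
      nlinarith [sq_nonneg y]
    exact h2.trans h3
  refine ⟨∑' n : ℤ, (2 + 3 / y ^ 2) * ((n : ℝ) ^ 2 + 1)⁻¹,
    tsum_nonneg fun n => by positivity, fun X => ?_⟩
  have hk := key (Int.fract X) (Int.fract_nonneg X) (Int.fract_lt_one X)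
  have hs1 : Summable fun n : ℤ => ((Int.fract X + n) ^ 2 + y ^ 2)⁻¹ :=
    Summable.of_nonneg_of_le (fun n => by positivity) hk hs
  have heq : (fun n : ℤ => ((X + n) ^ 2 + y ^ 2)⁻¹) =
      (fun n : ℤ => ((Int.fract X + n) ^ 2 + y ^ 2)⁻¹) ∘ (Equiv.addRight ⌊X⌋) := by
    ext n
    simp only [Function.comp, Equiv.coe_addRight]
    congr 3
    push_cast
    rw [Int.fract]; ring
  constructor
  · rw [heq]; exact (Equiv.summable_iff _).2 hs1
  · calc ∑' n : ℤ, ((X + n) ^ 2 + y ^ 2)⁻¹ = ∑' n : ℤ, ((Int.fract X + n) ^ 2 + y ^ 2)⁻¹ := by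
          rw [heq]
          exact Equiv.tsum_eq (Equiv.addRight ⌊X⌋)
            (fun n : ℤ => ((Int.fract X + n) ^ 2 + y ^ 2)⁻¹)
      _ ≤ _ := hs1.tsum_le_tsum hk hs

lemma summable_lineKernel {y : ℝ} (hy : 0 < y) {i j : ℤ} (hij : i + j ≤ -2) {τ : ℂ}
    (hτ : τ ∈ expDomain) (x : ℝ) : Summable fun n : ℤ => lineKernel y i j τ (x + n) := by
  obtain ⟨C, -, hC⟩ := exists_tsum_inv_sq_add_sq_le hy
  exact Summable.of_norm_bounded ((hC x).1.mul_left _) fun n => norm_lineKernel_le hy hij hτ (x + n)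

/-- The domain of exponents `s` near `1` on which estimates are uniform. -/
def nearOne : Set ℂ := {s | 1 ≤ s.re ∧ ‖s - 1‖ < 1}

lemma eventually_nearOne : ∀ᶠ s in toOne, s ∈ nearOne :=
  eventually_toOne.mono fun _ hs => ⟨hs.1.le, hs.2⟩

lemma one_mem_nearOne : (1 : ℂ) ∈ nearOne := ⟨by simp, by simp⟩

lemma sub_one_mem_expDomain {s : ℂ} (hs : s ∈ nearOne) : s - 1 ∈ expDomain :=
  ⟨by simpa using hs.1, by linarith [hs.2]⟩

lemma two_mul_sub_one_mem_expDomain {s : ℂ} (hs : s ∈ nearOne) : 2 * (s - 1) ∈ expDomain := by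
  refine ⟨by simpa using hs.1, ?_⟩
  rw [norm_mul, Complex.norm_ofNat]
  linarith [hs.2]

lemma ofReal_cpow_two_mul {t : ℝ} (ht : 0 < t) (a : ℂ) :
    (t : ℂ) ^ (2 * a) = ((t : ℂ) ^ 2) ^ a := by
  have h0 : (t : ℂ) ≠ 0 := by exact_mod_cast ht.ne'
  rw [two_mul, Complex.cpow_add _ _ h0, pow_two, Complex.mul_cpow_ofReal_nonneg ht.le ht.le]

section weights
variable {N : ℕ} [NeZero N]

/-- `1/(j²|j|^(2s-2)) = (conj j)²/|j|^(2s+2)`, so the Poincaré terms are exponential twists of the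
Eisenstein terms and both series are treated together. -/
lemma poincareTerm_eq (r' : ℤ) (z : ℍ) (s : ℂ) (γ : SL(2, ℤ)) : poincareTerm r' z s γ =
    eisTerm z s γ * exp (2 * Real.pi * Complex.I * ((-r' : ℤ) * ((γ • z : ℍ) : ℂ))) := by
  have h := CuspIdx.autom_ne_zero γ z
  have hn : ((‖autom γ z‖ : ℝ) : ℂ) ≠ 0 := by exact_mod_cast norm_ne_zero_iff.2 h
  unfold poincareTerm eisTerm
  have h1 : starRingEnd ℂ (autom γ z) = ((‖autom γ z‖ : ℝ) : ℂ) ^ 2 / autom γ z := by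
    rw [eq_div_iff h, mul_comm, Complex.mul_conj, Complex.normSq_eq_norm_sq]
    push_cast; rfl
  rw [h1, show 2 * s + 2 = (2 * s - 2) + (4 : ℕ) by push_cast; ring, Complex.cpow_add _ _ hn,
    Complex.cpow_natCast]
  have h2 : ((‖autom γ z‖ : ℝ) : ℂ) ^ (2 * s - 2) ≠ 0 := by
    rw [Complex.cpow_ne_zero_iff]; exact Or.inl hn
  have h3 : (-2 * Real.pi * Complex.I * r' * ((γ • z : ℍ) : ℂ)) =
      2 * Real.pi * Complex.I * ((-r' : ℤ) * ((γ • z : ℍ) : ℂ)) := by push_cast; ring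
  rw [h3]
  field_simp

lemma norm_eisTerm (z : ℍ) (s : ℂ) (γ : SL(2, ℤ)) :
    ‖eisTerm z s γ‖ = ‖autom γ z‖ ^ (-2 * s.re) := by
  have h : 0 < ‖autom γ z‖ := norm_pos_iff.2 (CuspIdx.autom_ne_zero γ z)
  rw [eisTerm, norm_div, norm_pow, RCLike.norm_conj, Complex.norm_cpow_eq_rpow_re_of_pos h,
    ← Real.rpow_natCast, ← Real.rpow_sub h]
  congr 1
  simp

lemma eisTerm_neg (z : ℍ) (s : ℂ) (γ : SL(2, ℤ)) : eisTerm z s (-γ) = eisTerm z s γ := by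
  have : autom (-γ) z = -autom γ z := by simp [autom]; ring
  rw [eisTerm, eisTerm, this]
  simp

lemma eisTerm_one (z : ℍ) (s : ℂ) : eisTerm z s 1 = 1 := by simp [eisTerm, autom]

lemma im_le_norm_autom (i : CuspIdx N) (z : ℍ) : z.im ≤ ‖autom i.mat z‖ := by
  refine le_trans ?_ (Complex.abs_im_le_norm _)
  have : (autom i.mat z).im = i.c * z.im := by simp [autom]
  rw [this, abs_of_pos (mul_pos (by exact_mod_cast i.c_pos) z.im_pos)]
  exact le_mul_of_one_le_left z.im_pos.le (by exact_mod_cast i.c_pos)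

lemma norm_autom_pos (i : CuspIdx N) (z : ℍ) : 0 < ‖autom i.mat z‖ :=
  z.im_pos.trans_le (im_le_norm_autom i z)

/-- The constant in the uniform bound of the Eisenstein summands. -/
def eisBound (z : ℍ) : ℝ := 1 + ((z.im ^ 2) ^ 2)⁻¹

lemma eisBound_nonneg (z : ℍ) : 0 ≤ eisBound z := by unfold eisBound; positivity

lemma norm_eisTerm_le (i : CuspIdx N) (z : ℍ) {s : ℂ} (hs : s ∈ nearOne) :
    ‖eisTerm z s i.mat‖ ≤ eisBound z * ‖autom i.mat z‖ ^ (-2 : ℝ) := by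
  have h := norm_autom_pos i z
  have hτ := sub_one_mem_expDomain hs
  have h1 := rpow_neg_le_of_le (D := ‖autom i.mat z‖ ^ 2) (ε := z.im ^ 2)
    (pow_pos z.im_pos 2) (pow_le_pow_left₀ z.im_pos.le (im_le_norm_autom i z) 2)
    hτ.1 (re_le_two_of_mem hτ)
  rw [norm_eisTerm]
  have h2 : ‖autom i.mat z‖ ^ (-2 * s.re) =
      (‖autom i.mat z‖ ^ 2) ^ (-(s - 1).re) * ‖autom i.mat z‖ ^ (-2 : ℝ) := by
    rw [← Real.rpow_two, ← Real.rpow_mul h.le, ← Real.rpow_add h]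
    congr 1
    simp
    ring
  rw [h2]
  gcongr
  exact h1

/-- Distinct indices have distinct bottom rows, so this is part of a lattice sum over `ℤ²`. -/
lemma summable_norm_autom (z : ℍ) {σ : ℝ} (hσ : 2 < σ) :
    Summable fun i : CuspIdx N => ‖autom i.mat z‖ ^ (-σ) := by
  have hinj : Function.Injective fun i : CuspIdx N => ![(i.c : ℤ), i.d] := by
    intro i j h
    refine CuspIdx.ext_of_c_d N ?_ ?_
    · have := congrFun h 0; simpa using this
    · have := congrFun h 1; simpa using this
  have h := ((EisensteinSeries.summable_one_div_norm_rpow hσ).mul_left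
    (EisensteinSeries.r z ^ (-σ))).comp_injective hinj
  refine Summable.of_nonneg_of_le (fun i => by positivity) (fun i => ?_) h
  have := EisensteinSeries.summand_bound z (k := σ) (by linarith) ![(i.c : ℤ), i.d]
  simpa [autom] using this

lemma summable_norm_eisTerm (z : ℍ) {s : ℂ} (hs : 1 < s.re) :
    Summable fun i : CuspIdx N => ‖eisTerm z s i.mat‖ := by
  refine (summable_norm_autom z (σ := 2 * s.re) (by linarith)).congr fun i => ?_
  rw [norm_eisTerm]; ring_nf

/-- `cz + d = c(z + d/c)` and `d/c = u/c + n` with `0 ≤ u < c`: for fixed `c` and `u` the terms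
sample one kernel at integer translates, as Poisson summation requires. -/
lemma eisTerm_eq_lineKernel (i : CuspIdx N) (z : ℍ) (s : ℂ) : eisTerm z s i.mat =
    (i.c : ℂ) ^ (-2 * s) * lineKernel z.im (-2) 0 (s - 1)
      (z.re + ((i.2.1 : ZMod (N * i.1)).val : ℝ) / (i.c : ℝ) + i.2.2) := by
  set X : ℝ := z.re + ((i.2.1 : ZMod (N * i.1)).val : ℝ) / (i.c : ℝ) + i.2.2 with hX
  have hy := z.im_pos
  have hpt : i.pt z = (X : ℂ) + z.im * Complex.I := by
    have : (z : ℂ) = z.re + z.im * Complex.I := (Complex.re_add_im (z : ℂ)).symm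
    rw [CuspIdx.pt, this, hX]
    push_cast
    ring
  have hw := sq_add_sq_mem_slitPlane hy X
  have hw0 : (X : ℂ) ^ 2 + (z.im : ℂ) ^ 2 ≠ 0 := Complex.slitPlane_ne_zero hw
  have hu := add_mul_I_ne_zero hy X
  have hv := sub_mul_I_ne_zero hy X
  have hc := i.c_ne_zero
  have hcj : starRingEnd ℂ ((X : ℂ) + z.im * Complex.I) = (X : ℂ) - z.im * Complex.I := by
    simp [sub_eq_add_neg]
  have hD : 0 < X ^ 2 + z.im ^ 2 := by positivity
  have hnorm : ((‖(X : ℂ) + z.im * Complex.I‖ : ℝ) : ℂ) ^ (2 * s + 2) =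
      ((X : ℂ) ^ 2 + (z.im : ℂ) ^ 2) ^ (s - 1) * ((X : ℂ) ^ 2 + (z.im : ℂ) ^ 2) ^ 2 := by
    have h1 : ((‖(X : ℂ) + z.im * Complex.I‖ : ℝ) : ℂ) ^ 2 = (X : ℂ) ^ 2 + (z.im : ℂ) ^ 2 := by
      rw [norm_add_mul_I, ← Complex.ofReal_pow, Real.sq_sqrt hD.le]
      push_cast; rfl
    rw [show 2 * s + 2 = 2 * (s + 1) by ring, ofReal_cpow_two_mul (norm_pos_iff.2 hu), h1,
      show s + 1 = (s - 1) + (2 : ℕ) by push_cast; ring, Complex.cpow_add _ _ hw0,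
      Complex.cpow_natCast]
  rw [eisTerm, CuspIdx.autom_mat, hpt, map_mul, hcj, Complex.conj_natCast, norm_mul,
    Complex.norm_natCast, Complex.ofReal_mul, Complex.mul_cpow_ofReal_nonneg (by positivity)
    (by positivity), hnorm, lineKernel, Complex.ofReal_natCast]
  have e1 : (i.c : ℂ) ^ (2 * s + 2) = (i.c : ℂ) ^ (2 * s) * (i.c : ℂ) ^ 2 := by
    rw [Complex.cpow_add _ _ hc, Complex.cpow_ofNat]
  have e2 : (i.c : ℂ) ^ (-2 * s) = ((i.c : ℂ) ^ (2 * s))⁻¹ := by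
    rw [neg_mul, Complex.cpow_neg]
  have e3 : ((X : ℂ) + z.im * Complex.I) ^ (-2 : ℤ) = (((X : ℂ) + z.im * Complex.I) ^ 2)⁻¹ := by
    rw [zpow_neg]; rfl
  rw [e1, e2, e3, Complex.cpow_neg _ (s - 1), zpow_zero, mul_one, ← add_mul_sub_I]
  have h1 : (i.c : ℂ) ^ (2 * s) ≠ 0 := by
    rw [Complex.cpow_ne_zero_iff]; exact Or.inl hc
  have h2 : (((X : ℂ) + z.im * Complex.I) * ((X : ℂ) - z.im * Complex.I)) ^ (s - 1) ≠ 0 := by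
    rw [Complex.cpow_ne_zero_iff]; exact Or.inl (mul_ne_zero hu hv)
  field_simp

end weights

/-! ### Sums over the cusp fractions -/

/-- The exponential `e(m w)`. -/
def fexp (m : ℤ) (w : ℂ) : ℂ := exp (2 * Real.pi * Complex.I * (m * w))

lemma fexp_add (m : ℤ) (w w' : ℂ) : fexp m (w + w') = fexp m w * fexp m w' := by
  rw [fexp, fexp, fexp, ← Complex.exp_add]; congr 1; ring

lemma fexp_zero (w : ℂ) : fexp 0 w = 1 := by simp [fexp]

lemma norm_fexp (m : ℤ) (w : ℂ) : ‖fexp m w‖ = Real.exp (-2 * Real.pi * m * w.im) := by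
  rw [fexp, Complex.norm_exp]
  congr 1
  simp
  ring

lemma norm_fexp_ofReal (m : ℤ) (x : ℝ) : ‖fexp m x‖ = 1 := by simp [norm_fexp]

lemma fexp_div_eq (c : ℕ) [NeZero c] (m j : ℤ) :
    fexp m ((j : ℂ) / c) = ZMod.stdAddChar ((m * j : ℤ) : ZMod c) := by
  rw [ZMod.stdAddChar_coe, fexp]
  congr 1
  push_cast
  ring

lemma summable_fintype_prod {α β : Type*} [Fintype α] {f : α × β → ℂ}
    (h : ∀ a, Summable fun b => ‖f (a, b)‖) : Summable f := by
  refine Summable.of_norm ?_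
  rw [summable_prod_of_nonneg fun _ => norm_nonneg _]
  exact ⟨h, (hasSum_fintype _).summable⟩

lemma summable_one_div_one_add_abs_sq : Summable fun r : ℤ => 1 / (1 + |(r : ℝ)|) ^ 2 := by
  have h2 : Summable fun n : ℤ => 1 / (n : ℝ) ^ 2 := Real.summable_one_div_int_pow.2 (by norm_num)
  refine Summable.of_norm_bounded_eventually h2 ?_
  filter_upwards [Filter.eventually_cofinite_ne (0 : ℤ)] with n hn
  have : (n : ℝ) ≠ 0 := by exact_mod_cast hn
  rw [Real.norm_of_nonneg (by positivity), ← sq_abs (n : ℝ)]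
  have := abs_pos.2 this
  gcongr
  linarith

lemma summable_norm_lineFourier {y : ℝ} (hy : 0 < y) {i j : ℤ} (hij : i + j ≤ -2) {τ : ℂ}
    (hτ : τ ∈ expDomain) : Summable fun r : ℤ => ‖lineFourier y i j τ r‖ := by
  obtain ⟨C, hC, h⟩ := exists_norm_fourier_lineKernel_le hy hij
  refine Summable.of_nonneg_of_le (fun _ => norm_nonneg _) (fun r => ?_)
    (summable_one_div_one_add_abs_sq.mul_left C)
  refine (h τ hτ r).trans ?_
  rw [mul_one_div]
  gcongr
  · linarith [abs_nonneg (r : ℝ)]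
  · norm_num

/-- Poisson summation over the points above the fractions with a fixed denominator. -/
lemma tsum_units_lineKernel {y : ℝ} (hy : 0 < y) {i j : ℤ} (hij : i + j ≤ -2) {τ : ℂ}
    (hτ : τ ∈ expDomain) (c : ℕ) [NeZero c] (m : ℤ) (X : ℝ) :
    ∑' x : (ZMod c)ˣ × ℤ, lineKernel y i j τ (X + ((x.1 : ZMod c).val : ℝ) / c + x.2) *
        fexp m ((((x.1⁻¹ : (ZMod c)ˣ) : ZMod c).val : ℂ) / c) =
      ∑' r : ℤ, lineFourier y i j τ r * fexp r X * klo c r m := by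
  have hs : Summable fun x : (ZMod c)ˣ × ℤ =>
      lineKernel y i j τ (X + ((x.1 : ZMod c).val : ℝ) / c + x.2) *
        fexp m ((((x.1⁻¹ : (ZMod c)ˣ) : ZMod c).val : ℂ) / c) :=
    summable_fintype_prod fun u => by
      have h := (summable_lineKernel hy hij hτ (X + ((u : ZMod c).val : ℝ) / c)).mul_right
        (fexp m ((((u⁻¹ : (ZMod c)ˣ) : ZMod c).val : ℂ) / c))
      exact h.norm
  rw [hs.tsum_prod, tsum_fintype]
  have h1 : ∀ u : (ZMod c)ˣ, ∑' n : ℤ, lineKernel y i j τ (X + ((u : ZMod c).val : ℝ) / c + n) *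
        fexp m ((((u⁻¹ : (ZMod c)ˣ) : ZMod c).val : ℂ) / c) =
      ∑' r : ℤ, lineFourier y i j τ r * fexp r X *
        ZMod.stdAddChar ((r : ZMod c) * (u : ZMod c) + (m : ZMod c) * ((u⁻¹ : (ZMod c)ˣ) : ZMod c)) := by
    intro u
    rw [tsum_mul_right, tsum_lineKernel_add_int hy hij hτ, ← tsum_mul_right]
    refine tsum_congr fun r => ?_
    have e1 : Complex.exp (2 * Real.pi * Complex.I *
        (r * ((X + ((u : ZMod c).val : ℝ) / c : ℝ) : ℂ))) =
        fexp r X * ZMod.stdAddChar ((r : ZMod c) * (u : ZMod c)) := by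
      have := fexp_div_eq c r ((u : ZMod c).val : ℤ)
      have h2 : (((r * ((u : ZMod c).val : ℤ) : ℤ)) : ZMod c) = (r : ZMod c) * (u : ZMod c) := by
        push_cast; simp
      rw [h2] at this
      rw [← this, ← fexp_add, fexp]
      push_cast
      rfl
    have e2 : fexp m ((((u⁻¹ : (ZMod c)ˣ) : ZMod c).val : ℂ) / c) =
        ZMod.stdAddChar ((m : ZMod c) * ((u⁻¹ : (ZMod c)ˣ) : ZMod c)) := by
      have := fexp_div_eq c m (((u⁻¹ : (ZMod c)ˣ) : ZMod c).val : ℤ)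
      have h2 : (((m * (((u⁻¹ : (ZMod c)ˣ) : ZMod c).val : ℤ) : ℤ)) : ZMod c) =
          (m : ZMod c) * ((u⁻¹ : (ZMod c)ˣ) : ZMod c) := by
        push_cast; simp
      rw [h2] at this
      rw [← this]
      push_cast
      rfl
    rw [e1, e2, AddChar.map_add_eq_mul]
    ring
  -- Only finitely many `u` occur, so the sum over them moves inside the sum over `r` and assembles
  -- the Kloosterman sum.
  rw [Finset.sum_congr rfl fun u _ => h1 u, ← Summable.tsum_finsetSum]
  · refine tsum_congr fun r => ?_
    rw [klo, Finset.mul_sum]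
  · intro u _
    refine Summable.of_norm_bounded (summable_norm_lineFourier hy hij hτ) fun r => ?_
    rw [norm_mul, norm_mul, norm_fexp_ofReal, mul_one]
    exact le_of_eq (by simp [AddChar.norm_apply])

section cuspSum
variable {N : ℕ} [NeZero N]

/-- The additive twist of the Eisenstein series by `e(m a / c)`. -/
def cuspTerm (m : ℤ) (z : ℍ) (s : ℂ) (i : CuspIdx N) : ℂ :=
  eisTerm z s i.mat * fexp m ((i.a : ℂ) / i.c)

/-- The terms of the Fourier expansion of the additive twists, without the polar terms. -/
def regTerm (N : ℕ) [NeZero N] (m : ℤ) (z : ℍ) (s : ℂ) (x : ℕ+ × ℤ) : ℂ :=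
  if m = 0 ∧ x.2 = 0 then 0 else ((N * x.1 : ℕ) : ℂ) ^ (-2 * s) *
    (lineFourier z.im (-2) 0 (s - 1) x.2 * fexp x.2 z.re * klo (N * x.1) x.2 m)

/-- The regular part of the additive twists. -/
def regSum (N : ℕ) [NeZero N] (m : ℤ) (z : ℍ) (s : ℂ) : ℂ := ∑' x, regTerm N m z s x

/-- The polar part of the Eisenstein series. -/
def poleSum (N : ℕ) (z : ℍ) (s : ℂ) : ℂ := lineFourier z.im (-2) 0 (s - 1) (0 : ℤ) *
  ∑' k : ℕ+, ((N * k : ℕ).totient : ℂ) * ((N * k : ℕ) : ℂ) ^ (-2 * s)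

lemma cast_pos_of_pnat (k : ℕ+) : 0 < N * (k : ℕ) := Nat.mul_pos (NeZero.pos N) k.pos

lemma norm_natCast_cpow_le {c : ℕ} (hc : 0 < c) {s : ℂ} (hs : s ∈ nearOne) :
    ‖(c : ℂ) ^ (-2 * s)‖ ≤ 1 / (c : ℝ) ^ 2 := by
  rw [Complex.norm_natCast_cpow_of_pos hc, one_div, ← Real.rpow_two, ← Real.rpow_neg (by positivity)]
  refine Real.rpow_le_rpow_of_exponent_le (by exact_mod_cast hc) ?_
  have : (-2 * s).re = -2 * s.re := by simp
  rw [this]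
  linarith [hs.1]

/-- Outside the polar terms one of `m`, `x.2` is nonzero, and the Kloosterman bound applies with
that one, after exchanging the arguments if necessary. Either way it costs at most `(1 + |m|)(1 +
|r|)`. -/
lemma exists_norm_regTerm_le (z : ℍ) : ∃ C : ℝ, 0 ≤ C ∧ ∀ (m : ℤ) (s : ℂ), s ∈ nearOne →
    ∀ x : ℕ+ × ℤ, ‖regTerm N m z s x‖ ≤
      C * (1 + |(m : ℝ)|) * (kloWeight (N * x.1) * (1 / (1 + |(x.2 : ℝ)|) ^ 2)) := by
  obtain ⟨C, hC, h⟩ := exists_norm_fourier_lineKernel_le z.im_pos (i := -2) (j := 0) (by norm_num)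
  refine ⟨3 * C, by positivity, fun m s hs x => ?_⟩
  have hw := kloWeight_nonneg (N * x.1)
  unfold regTerm
  split_ifs with hmr
  · rw [norm_zero]; positivity
  · have hF := h _ (sub_one_mem_expDomain hs) x.2
    have hcp := norm_natCast_cpow_le (cast_pos_of_pnat (N := N) x.1) hs
    have hk : ‖klo (N * x.1) x.2 m‖ / ((N * x.1 : ℕ) : ℝ) ^ 2 ≤
        3 * ((1 + |(m : ℝ)|) * (1 + |(x.2 : ℝ)|)) * kloWeight (N * x.1) := by
      have hm0 := abs_nonneg (m : ℝ)
      have hr0 := abs_nonneg (x.2 : ℝ)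
      by_cases hm : m = 0
      · have hr : x.2 ≠ 0 := fun h => hmr ⟨hm, h⟩
        rw [klo_symm]
        refine (norm_klo_div_sq_le (N * x.1) m hr).trans ?_
        gcongr
        nlinarith
      · refine (norm_klo_div_sq_le (N * x.1) x.2 hm).trans ?_
        gcongr
        nlinarith
    have hr : 0 < 1 + |(x.2 : ℝ)| := by positivity
    rw [norm_mul, norm_mul, norm_mul, norm_fexp_ofReal, mul_one]
    calc _ ≤ 1 / ((N * x.1 : ℕ) : ℝ) ^ 2 * (C / (1 + |(x.2 : ℝ)|) ^ 3 * ‖klo (N * x.1) x.2 m‖) := by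
          gcongr
      _ = C / (1 + |(x.2 : ℝ)|) ^ 3 * (‖klo (N * x.1) x.2 m‖ / ((N * x.1 : ℕ) : ℝ) ^ 2) := by ring
      _ ≤ C / (1 + |(x.2 : ℝ)|) ^ 3 *
          (3 * ((1 + |(m : ℝ)|) * (1 + |(x.2 : ℝ)|)) * kloWeight (N * x.1)) := by gcongr
      _ = _ := by field_simp

lemma summable_kloWeight_mul : Summable fun k : ℕ+ => kloWeight (N * k) :=
  summable_kloWeight.comp_injective fun _ _ h =>
    PNat.eq (Nat.eq_of_mul_eq_mul_left (NeZero.pos N) h)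

lemma summable_regBound : Summable fun x : ℕ+ × ℤ =>
    kloWeight (N * x.1) * (1 / (1 + |(x.2 : ℝ)|) ^ 2) :=
  summable_kloWeight_mul.mul_of_nonneg summable_one_div_one_add_abs_sq
    (fun _ => kloWeight_nonneg _) (fun _ => by positivity)

lemma summable_regTerm (m : ℤ) (z : ℍ) {s : ℂ} (hs : s ∈ nearOne) :
    Summable (regTerm N m z s) := by
  obtain ⟨C, -, h⟩ := exists_norm_regTerm_le (N := N) z
  exact Summable.of_norm_bounded (summable_regBound.mul_left _) (h m s hs)

lemma exists_norm_regSum_le (z : ℍ) : ∃ C : ℝ, 0 ≤ C ∧ ∀ (m : ℤ) (s : ℂ), s ∈ nearOne →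
    ‖regSum N m z s‖ ≤ C * (1 + |(m : ℝ)|) := by
  obtain ⟨C, hC, h⟩ := exists_norm_regTerm_le (N := N) z
  refine ⟨C * ∑' x : ℕ+ × ℤ, kloWeight (N * x.1) * (1 / (1 + |(x.2 : ℝ)|) ^ 2),
    mul_nonneg hC (tsum_nonneg fun x => mul_nonneg (kloWeight_nonneg _) (by positivity)),
    fun m s hs => ?_⟩
  have := tsum_of_norm_bounded ((summable_regBound (N := N)).mul_left (C * (1 + |(m : ℝ)|))).hasSum
    (h m s hs)
  refine this.trans (le_of_eq ?_)
  rw [tsum_mul_left]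
  ring

instance : toOne.IsCountablyGenerated := by unfold toOne; infer_instance

lemma tendsto_toOne_sub_one : Tendsto (fun s : ℂ => s - 1) toOne (𝓝 0) := by
  simpa using tendsto_toOne.sub_const 1

lemma eventually_sub_one_mem : ∀ᶠ s in toOne, s - 1 ∈ expDomain :=
  eventually_nearOne.mono fun _ => sub_one_mem_expDomain

lemma tendsto_regSum (m : ℤ) (z : ℍ) :
    Tendsto (regSum N m z) toOne (𝓝 (regSum N m z 1)) := by
  obtain ⟨C, hC, h⟩ := exists_norm_regTerm_le (N := N) z
  refine tendsto_tsum_of_dominated_convergence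
    ((summable_regBound (N := N)).mul_left (C * (1 + |(m : ℝ)|))) (fun x => ?_)
    (eventually_nearOne.mono fun s hs => h m s hs)
  unfold regTerm
  split_ifs
  · exact tendsto_const_nhds
  · have hc : ((N * x.1 : ℕ) : ℂ) ≠ 0 := by exact_mod_cast (cast_pos_of_pnat (N := N) x.1).ne'
    refine Tendsto.mul ?_ ((Tendsto.mul_const _ ?_).mul_const _)
    · exact (tendsto_toOne.const_mul (-2)).const_cpow (Or.inl hc)
    · have := tendsto_fourier_lineKernel z.im_pos (i := -2) (j := 0) (by norm_num)
        tendsto_toOne_sub_one eventually_sub_one_mem (x.2 : ℝ)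
      rwa [← sub_self (1 : ℂ)] at this

/-- A zero times a pole: the zero is `-(s - 1)/s` times a mean tending to `π/y`, and `(s - 1)` times
the totient series tends to `3/(π² φ(N))`. -/
lemma tendsto_poleSum (z : ℍ) : Tendsto (poleSum N z) toOne
    (𝓝 ((-(3 / (Real.pi * phi N * z.im)) : ℝ) : ℂ)) := by
  have h1 := tendsto_fourier_lineKernel z.im_pos (i := -1) (j := -1) (by norm_num)
    tendsto_toOne_sub_one eventually_sub_one_mem ((0 : ℤ) : ℝ)
  have h2 := tendsto_sub_mul_tsum_totient (N := N) (NeZero.pos N)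
  have h3 : Tendsto (fun s : ℂ => -s⁻¹) toOne (𝓝 (-(1 : ℂ)⁻¹)) :=
    (tendsto_toOne.inv₀ one_ne_zero).neg
  have h4 := (h3.mul h1).mul h2
  refine (h4.congr' ?_).trans (le_of_eq ?_)
  · filter_upwards [eventually_toOne] with s hs
    have hs0 : s ≠ 0 := by rintro rfl; simp at hs
    have h5 := fourier_lineKernel_at_zero z.im_pos
      (sub_one_mem_expDomain (s := s) ⟨hs.1.le, hs.2⟩)
    rw [poleSum]
    have h6 : lineFourier z.im (-2) 0 (s - 1) ((0 : ℤ) : ℝ) =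
        -s⁻¹ * (s - 1) * lineFourier z.im (-1) (-1) (s - 1) ((0 : ℤ) : ℝ) := by
      rw [Int.cast_zero]
      field_simp
      linear_combination h5
    rw [h6]
    ring
  · congr 1
    rw [Int.cast_zero, fourier_lineKernel_neg_one_zero z.im_pos]
    have := z.im_pos.ne'
    have := Real.pi_ne_zero
    push_cast
    field_simp

lemma summable_cuspTerm (m : ℤ) (z : ℍ) {s : ℂ} (hs : 1 < s.re) :
    Summable (cuspTerm (N := N) m z s) := by
  refine Summable.of_norm_bounded (summable_norm_eisTerm (N := N) z hs) fun i => ?_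
  rw [cuspTerm, norm_mul]
  have : ‖fexp m ((i.a : ℂ) / i.c)‖ = 1 := by
    have := norm_fexp_ofReal m ((i.a : ℝ) / i.c)
    push_cast at this
    exact this
  rw [this, mul_one]

lemma tsum_cuspTerm_slice (m : ℤ) (z : ℍ) {s : ℂ} (hs : s ∈ nearOne) (k : ℕ+) :
    ∑' x : (ZMod (N * k))ˣ × ℤ, cuspTerm (N := N) m z s ⟨k, x⟩ =
      ((N * k : ℕ) : ℂ) ^ (-2 * s) * ∑' r : ℤ, lineFourier z.im (-2) 0 (s - 1) r *
        fexp r z.re * klo (N * k) r m := by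
  rw [← tsum_units_lineKernel z.im_pos (by norm_num) (sub_one_mem_expDomain hs) (N * k) m z.re,
    ← tsum_mul_left]
  refine tsum_congr fun x => ?_
  rw [cuspTerm, eisTerm_eq_lineKernel, mul_assoc]
  rfl

/-- The frequency `r = 0` is split off exactly when `m = 0`, where the Kloosterman sum is `φ(c)` and
no cancellation is available. -/
lemma tsum_slice_eq (m : ℤ) (z : ℍ) {s : ℂ} (hs : s ∈ nearOne) (k : ℕ+) :
    ((N * k : ℕ) : ℂ) ^ (-2 * s) * ∑' r : ℤ, lineFourier z.im (-2) 0 (s - 1) r *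
        fexp r z.re * klo (N * k) r m = ∑' r : ℤ, regTerm N m z s (k, r) +
      if m = 0 then lineFourier z.im (-2) 0 (s - 1) (0 : ℤ) *
        (((N * k : ℕ).totient : ℂ) * ((N * k : ℕ) : ℂ) ^ (-2 * s)) else 0 := by
  rw [← tsum_mul_left]
  split_ifs with hm
  · subst hm
    have hs1 : Summable fun r : ℤ => ((N * k : ℕ) : ℂ) ^ (-2 * s) *
        (lineFourier z.im (-2) 0 (s - 1) r * fexp r z.re * klo (N * k) r ((0 : ℤ) : ZMod (N * k))) := by
      refine Summable.mul_left _ (Summable.of_norm_bounded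
        ((summable_norm_lineFourier z.im_pos (i := -2) (j := 0) (by norm_num)
          (sub_one_mem_expDomain hs)).mul_right ((N * k : ℕ).totient : ℝ)) fun r => ?_)
      rw [norm_mul, norm_mul, norm_fexp_ofReal, mul_one]
      gcongr
      refine (norm_sum_le _ _).trans ?_
      simp [AddChar.norm_apply, ZMod.card_units_eq_totient]
    rw [hs1.tsum_eq_add_tsum_ite 0, add_comm]
    congr 1
    · refine tsum_congr fun r => ?_
      simp only [regTerm, true_and]
    · rw [fexp_zero, Int.cast_zero (R := ZMod (N * k)), klo_zero_zero]
      ring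
  · rw [add_zero]
    refine tsum_congr fun r => ?_
    rw [regTerm, if_neg (fun h => hm h.1)]

lemma summable_totient_cpow {s : ℂ} (hs : 1 < s.re) :
    Summable fun k : ℕ+ => ((N * k : ℕ).totient : ℂ) * ((N * k : ℕ) : ℂ) ^ (-2 * s) := by
  have h : Summable fun n : ℕ => (n : ℝ) ^ (1 - 2 * s.re) := by
    rw [Real.summable_nat_rpow]; linarith
  have hinj : Function.Injective fun k : ℕ+ => N * (k : ℕ) := fun _ _ h =>
    PNat.eq (Nat.eq_of_mul_eq_mul_left (NeZero.pos N) h)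
  refine Summable.of_norm_bounded (h.comp_injective hinj) fun k => ?_
  have hpos := cast_pos_of_pnat (N := N) k
  have hpos' : (0 : ℝ) < ((N * k : ℕ) : ℝ) := by exact_mod_cast hpos
  rw [norm_mul, Complex.norm_natCast, Complex.norm_natCast_cpow_of_pos hpos, Function.comp_apply,
    Real.rpow_sub hpos', Real.rpow_one, div_eq_mul_inv, ← Real.rpow_neg hpos'.le]
  have : (-2 * s).re = -(2 * s.re) := by simp
  rw [this]
  gcongr
  exact Nat.totient_le _

lemma tsum_cuspTerm (m : ℤ) (z : ℍ) {s : ℂ} (hs : s ∈ nearOne) (hs1 : 1 < s.re) :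
    ∑' i, cuspTerm (N := N) m z s i = regSum N m z s + if m = 0 then poleSum N z s else 0 := by
  rw [(summable_cuspTerm m z hs1).tsum_sigma]
  simp_rw [tsum_cuspTerm_slice m z hs, tsum_slice_eq m z hs]
  have h1 := summable_regTerm (N := N) m z hs
  rw [Summable.tsum_add h1.prod, regSum, h1.tsum_prod]
  · congr 1
    split_ifs
    · rw [tsum_mul_left, poleSum]
    · simp
  · split_ifs
    · exact (summable_totient_cpow hs1).mul_left _
    · exact summable_zero

/-- At `s = 1` the cusp terms must be summed in this order, with the modulus outermost. The polar
terms disappear because the mean of the kernel vanishes there; their contribution to the limit as `s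
→ 1` is recorded separately in `twistLim`. -/
lemma regSum_one (m : ℤ) (z : ℍ) : regSum N m z 1 =
    ∑' k : ℕ+, ∑' x : (ZMod (N * k))ˣ × ℤ, cuspTerm (N := N) m z 1 ⟨k, x⟩ := by
  simp_rw [tsum_cuspTerm_slice m z one_mem_nearOne, tsum_slice_eq m z one_mem_nearOne]
  rw [regSum, (summable_regTerm m z one_mem_nearOne).tsum_prod]
  refine tsum_congr fun k => ?_
  rw [sub_self, Int.cast_zero, fourier_lineKernel_zero_zero z.im_pos]
  simp

end cuspSum

/-! ### Twisted Eisenstein series -/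

lemma norm_exp_sub_exp_le {a b : ℂ} {M : ℝ} (ha : a.re ≤ M) (hb : b.re ≤ M) :
    ‖exp a - exp b‖ ≤ Real.exp M * ‖a - b‖ := by
  refine (convex_halfSpace_re_le M).norm_image_sub_le_of_norm_hasDerivWithin_le
    (f := exp) (f' := exp) (fun x _ => (Complex.hasDerivAt_exp x).hasDerivWithinAt) (fun x hx => ?_) hb ha
  rw [Complex.norm_exp]
  exact Real.exp_le_exp.2 hx

lemma norm_fexp_le {m : ℤ} {w : ℂ} {Y : ℝ} (h0 : 0 ≤ w.im) (hY : w.im ≤ Y) :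
    ‖fexp m w‖ ≤ Real.exp (2 * Real.pi * |(m : ℝ)| * Y) := by
  rw [norm_fexp]
  refine Real.exp_le_exp.2 ?_
  have h1 : -(m : ℝ) * w.im ≤ |(m : ℝ)| * Y :=
    mul_le_mul (neg_le_abs _) hY h0 (abs_nonneg _)
  have := Real.pi_pos
  nlinarith

lemma norm_fexp_sub_le {m : ℤ} {w : ℂ} {x Y : ℝ} (h0 : 0 ≤ w.im) (hY : w.im ≤ Y) :
    ‖fexp m w - fexp m x‖ ≤
      Real.exp (2 * Real.pi * |(m : ℝ)| * Y) * (2 * Real.pi * |(m : ℝ)| * ‖w - x‖) := by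
  have hpi := Real.pi_pos
  have hm := abs_nonneg (m : ℝ)
  have h := norm_exp_sub_exp_le (a := 2 * Real.pi * Complex.I * (m * w))
    (b := 2 * Real.pi * Complex.I * (m * (x : ℂ))) (M := 2 * Real.pi * |(m : ℝ)| * Y) ?_ ?_
  · refine h.trans (le_of_eq ?_)
    rw [← mul_sub, ← mul_sub, norm_mul, norm_mul]
    simp [abs_of_pos hpi]
    ring
  · have h1 : -(m : ℝ) * w.im ≤ |(m : ℝ)| * Y := mul_le_mul (neg_le_abs _) hY h0 hm
    simp
    nlinarith
  · have : 0 ≤ Y := h0.trans hY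
    simp
    positivity

section twist
variable {N : ℕ} [NeZero N]

lemma norm_smul_sub_le (i : CuspIdx N) (z : ℍ) :
    ‖((i.mat • z : ℍ) : ℂ) - ((i.a : ℝ) / i.c : ℝ)‖ ≤ ‖autom i.mat z‖⁻¹ := by
  rw [CuspIdx.mat_smul]
  push_cast
  rw [sub_sub_cancel_left, norm_neg, norm_div, norm_mul, norm_one, Complex.norm_natCast, one_div]
  have h := norm_autom_pos i z
  gcongr
  exact le_mul_of_one_le_left h.le (by exact_mod_cast i.c_pos)

/-- Since `Im γz ≤ 1/|j|` and `∑ |j|⁻³` converges, only finitely many indices have `Im γz ≥ y/2`.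
The pointwise strict bound therefore improves to a uniform one, and the gap `y - Y` is what makes
all series over `r'` converge. -/
lemma exists_im_smul_le (z : ℍ) {y : ℝ} (h0 : z.im < y) (h : ∀ i : CuspIdx N, (i.mat • z).im < y) :
    ∃ Y : ℝ, 0 < Y ∧ Y < y ∧ z.im ≤ Y ∧ ∀ i : CuspIdx N, (i.mat • z).im ≤ Y := by
  have hy : 0 < y := z.im_pos.trans h0
  have hfin : {i : CuspIdx N | y / 2 ≤ (i.mat • z).im}.Finite := by
    have ht := (summable_norm_autom (N := N) z (σ := 3) (by norm_num)).tendsto_cofinite_zero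
    have he := ht.eventually (gt_mem_nhds (show 0 < (y / 2) ^ 3 by positivity))
    refine Set.Finite.subset he fun i hi => ?_
    simp only [Set.mem_ofPred_eq, not_lt, Set.mem_compl_iff] at hi ⊢
    have h1 : (i.mat • z).im ≤ ‖autom i.mat z‖⁻¹ := by
      refine le_trans ?_ (norm_smul_sub_le i z)
      refine le_trans (le_of_eq ?_) (Complex.im_le_norm _)
      simp [-Complex.ofReal_div]
    rw [Real.rpow_neg (norm_nonneg _), Real.rpow_ofNat, ← inv_pow]
    exact pow_le_pow_left₀ (by positivity) (hi.trans h1) 3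
  have hfin2 := hfin.image fun i : CuspIdx N => (⟨(i.mat • z).im, h i⟩ : Set.Iio y)
  obtain ⟨⟨Y, hY⟩, hYb⟩ := hfin2.bddAbove
  refine ⟨max (max Y (y / 2)) z.im, lt_max_of_lt_right z.im_pos,
    max_lt (max_lt hY (by linarith)) h0, le_max_right _ _, fun i => ?_⟩
  rcases lt_or_ge (i.mat • z).im (y / 2) with hi | hi
  · exact hi.le.trans ((le_max_right _ _).trans (le_max_left _ _))
  · have : (⟨(i.mat • z).im, h i⟩ : Set.Iio y) ≤ ⟨Y, hY⟩ := hYb ⟨i, hi, rfl⟩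
    exact le_trans this ((le_max_left _ _).trans (le_max_left _ _))

/-- The summand of the twist of the Eisenstein series by `e(m γ z)`. -/
def twistTerm (m : ℤ) (z : ℍ) (s : ℂ) (i : CuspIdx N) : ℂ :=
  eisTerm z s i.mat * fexp m ((i.mat • z : ℍ) : ℂ)

/-- The twist of the Eisenstein series by `e(m γ z)`. -/
def twistSum (N : ℕ) [NeZero N] (m : ℤ) (z : ℍ) (s : ℂ) : ℂ :=
  fexp m z + ∑' i : CuspIdx N, twistTerm m z s i

/-- The absolutely convergent difference of the two twists. -/
def remTerm (m : ℤ) (z : ℍ) (s : ℂ) (i : CuspIdx N) : ℂ :=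
  eisTerm z s i.mat * (fexp m ((i.mat • z : ℍ) : ℂ) - fexp m ((i.a : ℂ) / i.c))

/-- The limit of `twistSum N m z s` as `s → 1`, without the first term. -/
def twistLim (N : ℕ) [NeZero N] (m : ℤ) (z : ℍ) : ℂ :=
  ∑' i : CuspIdx N, remTerm m z 1 i + regSum N m z 1 +
    if m = 0 then ((-(3 / (Real.pi * phi N * z.im)) : ℝ) : ℂ) else 0

lemma norm_twistTerm_le {z : ℍ} {Y : ℝ} (hY : ∀ i : CuspIdx N, (i.mat • z).im ≤ Y) (m : ℤ) (s : ℂ)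
    (i : CuspIdx N) : ‖twistTerm m z s i‖ ≤
      Real.exp (2 * Real.pi * |(m : ℝ)| * Y) * ‖eisTerm z s i.mat‖ := by
  rw [twistTerm, norm_mul, mul_comm]
  gcongr
  exact norm_fexp_le (i.mat • z).im_pos.le (hY i)

lemma exists_forall_im_smul_le (z : ℍ) : ∃ Y : ℝ, 0 < Y ∧ z.im ≤ Y ∧
    ∀ i : CuspIdx N, (i.mat • z).im ≤ Y := by
  have h : ∀ i : CuspIdx N, (i.mat • z).im ≤ z.im⁻¹ := by
    intro i
    refine le_trans ?_ ((norm_smul_sub_le i z).trans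
      (inv_anti₀ z.im_pos (im_le_norm_autom i z)))
    refine le_trans (le_of_eq ?_) (Complex.im_le_norm _)
    simp [-Complex.ofReal_div]
  exact ⟨max z.im z.im⁻¹, lt_max_of_lt_left z.im_pos, le_max_left _ _,
    fun i => (h i).trans (le_max_right _ _)⟩

lemma summable_twistTerm (m : ℤ) (z : ℍ) {s : ℂ} (hs : 1 < s.re) :
    Summable (twistTerm (N := N) m z s) := by
  obtain ⟨Y, -, -, hY⟩ := exists_forall_im_smul_le (N := N) z
  exact Summable.of_norm_bounded ((summable_norm_eisTerm z hs).mul_left _)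
    (norm_twistTerm_le hY m s)

lemma norm_twistSum_le {z : ℍ} {Y : ℝ} (hz : z.im ≤ Y) (hY : ∀ i : CuspIdx N, (i.mat • z).im ≤ Y)
    (m : ℤ) {s : ℂ} (hs : 1 < s.re) : ‖twistSum N m z s‖ ≤
      (1 + ∑' i : CuspIdx N, ‖eisTerm z s i.mat‖) * Real.exp (2 * Real.pi * |(m : ℝ)| * Y) := by
  have h := tsum_of_norm_bounded ((summable_norm_eisTerm (N := N) z hs).mul_left
    (Real.exp (2 * Real.pi * |(m : ℝ)| * Y))).hasSum (norm_twistTerm_le hY m s)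
  rw [tsum_mul_left] at h
  refine (norm_add_le _ _).trans ?_
  have h1 := norm_fexp_le (m := m) z.im_pos.le hz
  rw [add_mul, one_mul, mul_comm (∑' i : CuspIdx N, ‖eisTerm z s i.mat‖)]
  exact add_le_add h1 h

/-- The weight is of size `|j|⁻²`, and moving from `γz` to `a/c` gains a further `|j|⁻¹`. This also
holds at `s = 1`. -/
lemma norm_remTerm_le {z : ℍ} {Y : ℝ} (hY : ∀ i : CuspIdx N, (i.mat • z).im ≤ Y) (m : ℤ) {s : ℂ}
    (hs : s ∈ nearOne) (i : CuspIdx N) : ‖remTerm m z s i‖ ≤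
      Real.exp (2 * Real.pi * |(m : ℝ)| * Y) * (2 * Real.pi * |(m : ℝ)|) * eisBound z *
        ‖autom i.mat z‖ ^ (-3 : ℝ) := by
  have h := norm_autom_pos i z
  have h1 := norm_eisTerm_le i z hs
  have h2 := norm_fexp_sub_le (m := m) (x := (i.a : ℝ) / i.c) (i.mat • z).im_pos.le (hY i)
  have h3 := norm_smul_sub_le i z
  have h4 := eisBound_nonneg z
  have hpi := Real.pi_pos
  have hx : (((i.a : ℝ) / i.c : ℝ) : ℂ) = (i.a : ℂ) / i.c := by push_cast; rfl
  rw [remTerm, norm_mul, ← hx]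
  calc _ ≤ (eisBound z * ‖autom i.mat z‖ ^ (-2 : ℝ)) * (Real.exp (2 * Real.pi * |(m : ℝ)| * Y) *
        (2 * Real.pi * |(m : ℝ)| * ‖autom i.mat z‖⁻¹)) := by
        refine mul_le_mul h1 (h2.trans ?_) (norm_nonneg _) (by positivity)
        gcongr
    _ = _ := by
      rw [show (-3 : ℝ) = -2 + -1 by norm_num, Real.rpow_add h, Real.rpow_neg_one]
      ring

lemma summable_remTerm (m : ℤ) (z : ℍ) {s : ℂ} (hs : s ∈ nearOne) :
    Summable (remTerm (N := N) m z s) := by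
  obtain ⟨Y, -, -, hY⟩ := exists_forall_im_smul_le (N := N) z
  exact Summable.of_norm_bounded ((summable_norm_autom z (by norm_num)).mul_left _)
    (norm_remTerm_le hY m hs)

lemma tendsto_eisTerm (z : ℍ) (γ : SL(2, ℤ)) :
    Tendsto (fun s => eisTerm z s γ) toOne (𝓝 (eisTerm z 1 γ)) := by
  have hn : ((‖autom γ z‖ : ℝ) : ℂ) ≠ 0 := by
    exact_mod_cast norm_ne_zero_iff.2 (CuspIdx.autom_ne_zero γ z)
  unfold eisTerm
  refine Tendsto.div tendsto_const_nhds ?_ ?_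
  · exact ((tendsto_toOne.const_mul 2).add_const 2).const_cpow (Or.inl hn)
  · rw [Complex.cpow_ne_zero_iff]; exact Or.inl hn

lemma tendsto_tsum_remTerm (m : ℤ) (z : ℍ) :
    Tendsto (fun s => ∑' i, remTerm (N := N) m z s i) toOne (𝓝 (∑' i, remTerm (N := N) m z 1 i)) := by
  obtain ⟨Y, -, -, hY⟩ := exists_forall_im_smul_le (N := N) z
  exact tendsto_tsum_of_dominated_convergence
    ((summable_norm_autom (N := N) z (by norm_num)).mul_left _)
    (fun i => (tendsto_eisTerm z i.mat).mul_const _)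
    (eventually_nearOne.mono fun s hs => norm_remTerm_le hY m hs)

lemma twistSum_eq (m : ℤ) (z : ℍ) {s : ℂ} (hs : s ∈ nearOne) (hs1 : 1 < s.re) :
    twistSum N m z s = fexp m z + (∑' i : CuspIdx N, remTerm m z s i + regSum N m z s +
      if m = 0 then poleSum N z s else 0) := by
  rw [twistSum, add_assoc, ← tsum_cuspTerm m z hs hs1,
    ← (summable_remTerm m z hs).tsum_add (summable_cuspTerm m z hs1)]
  congr 1
  refine tsum_congr fun i => ?_
  rw [twistTerm, remTerm, cuspTerm]
  ring

lemma tendsto_twistSum (m : ℤ) (z : ℍ) :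
    Tendsto (twistSum N m z) toOne (𝓝 (fexp m z + twistLim N m z)) := by
  have h1 := (tendsto_tsum_remTerm (N := N) m z).add (tendsto_regSum (N := N) m z)
  have h2 : Tendsto (fun s => if m = 0 then poleSum N z s else 0) toOne
      (𝓝 (if m = 0 then ((-(3 / (Real.pi * phi N * z.im)) : ℝ) : ℂ) else 0)) := by
    split_ifs
    · exact tendsto_poleSum z
    · exact tendsto_const_nhds
  have h3 := (h1.add h2).const_add (fexp m z)
  refine h3.congr' ?_
  filter_upwards [eventually_toOne] with s hs
  exact (twistSum_eq m z ⟨hs.1.le, hs.2⟩ hs.1).symm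

/-- Uniformity in both `m` and `s`: against coefficients of size `e^(-2π|m|y)` with `y > Y` this
serves as a dominating series. -/
lemma exists_norm_rem_add_reg_le {z : ℍ} {Y : ℝ} (hY0 : 0 < Y)
    (hY : ∀ i : CuspIdx N, (i.mat • z).im ≤ Y) :
    ∃ C : ℝ, 0 ≤ C ∧ ∀ (m : ℤ) (s : ℂ), s ∈ nearOne →
      ‖∑' i : CuspIdx N, remTerm m z s i + regSum N m z s‖ ≤
        C * ((1 + |(m : ℝ)|) * Real.exp (2 * Real.pi * |(m : ℝ)| * Y)) := by
  obtain ⟨C, hC, h⟩ := exists_norm_regSum_le (N := N) z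
  have hpi := Real.pi_pos
  have hB := eisBound_nonneg z
  have hS : 0 ≤ ∑' i : CuspIdx N, ‖autom i.mat z‖ ^ (-3 : ℝ) := tsum_nonneg fun i => by positivity
  refine ⟨2 * Real.pi * eisBound z * ∑' i : CuspIdx N, ‖autom i.mat z‖ ^ (-3 : ℝ) + C,
    by positivity, fun m s hs => ?_⟩
  have h1 := tsum_of_norm_bounded ((summable_norm_autom (N := N) z (σ := 3) (by norm_num)).mul_left
    _).hasSum (norm_remTerm_le hY m hs)
  rw [tsum_mul_left] at h1
  have hm := abs_nonneg (m : ℝ)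
  have he : 1 ≤ Real.exp (2 * Real.pi * |(m : ℝ)| * Y) := Real.one_le_exp (by positivity)
  refine (norm_add_le _ _).trans ?_
  rw [add_mul]
  refine add_le_add (h1.trans ?_) ((h m s hs).trans ?_)
  · calc _ = 2 * Real.pi * eisBound z * (∑' i : CuspIdx N, ‖autom i.mat z‖ ^ (-3 : ℝ)) *
          (|(m : ℝ)| * Real.exp (2 * Real.pi * |(m : ℝ)| * Y)) := by ring
      _ ≤ _ := by gcongr; linarith
  · gcongr
    exact le_mul_of_one_le_right (by positivity) he

lemma hasSum_poincareCosetTerm (r' : ℤ) (z : ℍ) {s : ℂ} (hs : 1 < s.re) :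
    HasSum (poincareCosetTerm N r' z s) (2 * twistSum N (-r') z s) := by
  have h := hasSum_cosets N (F := poincareTerm r' z s) (f := poincareCosetTerm N r' z s)
    (a := ∑' i : CuspIdx N, twistTerm (-r') z s i) (fun γ => ?_) (fun γ => rfl) ?_
  · have h1 : poincareTerm r' z s 1 = fexp (-r') z := by
      rw [poincareTerm_eq, eisTerm_one, one_smul, one_mul, fexp]
    rwa [h1] at h
  · rw [poincareTerm_eq, poincareTerm_eq, eisTerm_neg, ModularGroup.SL_neg_smul]
  · have h2 : (fun i : CuspIdx N => poincareTerm r' z s i.mat) = twistTerm (-r') z s := by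
      ext i; rw [poincareTerm_eq, twistTerm, fexp]
    rw [h2]
    exact (summable_twistTerm (N := N) (-r') z hs).hasSum

lemma hasSum_eisCosetTerm (z : ℍ) {s : ℂ} (hs : 1 < s.re) :
    HasSum (eisCosetTerm N z s) (2 * twistSum N 0 z s) := by
  have h := hasSum_cosets N (F := eisTerm z s) (f := eisCosetTerm N z s)
    (a := ∑' i : CuspIdx N, twistTerm 0 z s i) (fun γ => eisTerm_neg z s γ) (fun γ => rfl) ?_
  · have h1 : eisTerm z s 1 = fexp 0 z := by rw [eisTerm_one, fexp_zero]
    rwa [h1] at h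
  · have h2 : (fun i : CuspIdx N => eisTerm z s i.mat) = twistTerm 0 z s := by
      ext i; rw [twistTerm, fexp_zero, mul_one]
    rw [h2]
    exact (summable_twistTerm (N := N) 0 z hs).hasSum

lemma poincareSeries_eq (r' : ℤ) (z : ℍ) {s : ℂ} (hs : 1 < s.re) :
    poincareSeries N r' z s = twistSum N (-r') z s := by
  rw [poincareSeries, (hasSum_poincareCosetTerm r' z hs).tsum_eq]; ring

lemma eisSeries_eq (z : ℍ) {s : ℂ} (hs : 1 < s.re) : eisSeries N z s = twistSum N 0 z s := by
  rw [eisSeries, (hasSum_eisCosetTerm z hs).tsum_eq]; ring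

end twist

/-! ### The Bessel function -/

/-- The entire function `∑ (-u)^k / (k! (k + 1)!)`, a rescaling of `J₁`. -/
def bes (u : ℝ) : ℝ := ∑' k : ℕ, (-u) ^ k / (k.factorial * (k + 1).factorial)

/-- `b^k/k! ≤ e^b`. Keeping the argument as a product `ab` leaves free how its growth is shared
between the factors. -/
lemma mul_pow_div_factorial_le {a b : ℝ} (ha : 0 ≤ a) (hb : 0 ≤ b) (k : ℕ) :
    (a * b) ^ k / (k.factorial * (k + 1).factorial) ≤ Real.exp b * (a ^ k / k.factorial) := by
  have h1 := Real.pow_div_factorial_le_exp b hb k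
  have hk : (0 : ℝ) < k.factorial := by positivity
  have h2 : ((k.factorial : ℕ) : ℝ) ≤ (k + 1).factorial := by
    exact_mod_cast Nat.factorial_le (Nat.le_succ k)
  calc (a * b) ^ k / (k.factorial * (k + 1).factorial)
      ≤ (a * b) ^ k / (k.factorial * k.factorial) := by gcongr
    _ = b ^ k / k.factorial * (a ^ k / k.factorial) := by rw [mul_pow]; field_simp
    _ ≤ _ := by gcongr

lemma summable_mul_pow_div_factorial {a b : ℝ} (ha : 0 ≤ a) (hb : 0 ≤ b) :
    Summable fun k : ℕ => (a * b) ^ k / (k.factorial * (k + 1).factorial) :=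
  Summable.of_nonneg_of_le (fun k => by positivity) (mul_pow_div_factorial_le ha hb)
    ((Real.summable_pow_div_factorial a).mul_left _)

lemma tsum_mul_pow_div_factorial_le {a b : ℝ} (ha : 0 ≤ a) (hb : 0 ≤ b) :
    ∑' k : ℕ, (a * b) ^ k / (k.factorial * (k + 1).factorial) ≤ Real.exp (a + b) := by
  refine ((summable_mul_pow_div_factorial ha hb).tsum_le_tsum (mul_pow_div_factorial_le ha hb)
    ((Real.summable_pow_div_factorial a).mul_left _)).trans (le_of_eq ?_)
  rw [tsum_mul_left, Real.exp_add, mul_comm, Real.exp_eq_exp_ℝ, NormedSpace.exp_eq_tsum_div]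

lemma abs_bes_le {u a b : ℝ} (ha : 0 ≤ a) (hb : 0 ≤ b) (hu : |u| = a * b) :
    |bes u| ≤ Real.exp (a + b) := by
  rw [← Real.norm_eq_abs, bes]
  refine (tsum_of_norm_bounded (summable_mul_pow_div_factorial ha hb).hasSum fun k => ?_).trans
    (tsum_mul_pow_div_factorial_le ha hb)
  rw [norm_div, norm_pow, norm_neg, Real.norm_eq_abs, hu, Real.norm_of_nonneg (by positivity)]

/-- The Wallis product equals `(2k)!/(4^k k!²)`; dividing by `(2k)!` matches the coefficients of the
cosine series. -/
lemma prod_wallis_div_factorial (k : ℕ) :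
    (∏ i ∈ Finset.range k, (2 * (i : ℝ) + 1) / (2 * i + 2)) / (2 * k).factorial =
      1 / (4 ^ k * (k.factorial * k.factorial)) := by
  induction k with
  | zero => simp
  | succ k ih =>
    have h1 : ((2 * (k + 1)).factorial : ℝ) = (2 * k + 2) * (2 * k + 1) * (2 * k).factorial := by
      rw [show 2 * (k + 1) = 2 * k + 1 + 1 by ring, Nat.factorial_succ, Nat.factorial_succ]
      push_cast
      ring
    have h2 : (((k + 1).factorial : ℕ) : ℝ) = (k + 1) * k.factorial := by
      rw [Nat.factorial_succ]; push_cast; ring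
    have h3 : ((2 * k).factorial : ℝ) ≠ 0 := by positivity
    rw [Finset.prod_range_succ, h1, h2]
    have h4 : (∏ i ∈ Finset.range k, (2 * (i : ℝ) + 1) / (2 * i + 2)) =
        1 / (4 ^ k * (k.factorial * k.factorial)) * (2 * k).factorial := by
      rw [← ih]; field_simp
    rw [h4]
    field_simp
    ring

/-- Poisson's integral for `J₁(x)/x`. Integrate the cosine series termwise and write `cos² = 1 -
sin²`, so that each term is a difference of consecutive Wallis integrals. -/
lemma hasSum_integral_cos_mul_sin (x : ℝ) :
    HasSum (fun k : ℕ => Real.pi / 2 * ((-(x ^ 2 / 4)) ^ k / (k.factorial * (k + 1).factorial)))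
      (∫ θ in (0 : ℝ)..Real.pi, Real.cos (x * Real.sin θ) * Real.cos θ ^ 2) := by
  have h := intervalIntegral.hasSum_integral_of_dominated_convergence
    (μ := MeasureTheory.volume) (a := 0) (b := Real.pi)
    (F := fun (k : ℕ) θ => (-1) ^ k * (x * Real.sin θ) ^ (2 * k) / (2 * k).factorial *
      Real.cos θ ^ 2)
    (f := fun θ => Real.cos (x * Real.sin θ) * Real.cos θ ^ 2)
    (fun k _ => |x| ^ (2 * k) / (2 * k).factorial) ?_ ?_ ?_ ?_ ?_
  · refine (congrArg (fun F => HasSum F (∫ θ in (0 : ℝ)..Real.pi,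
      Real.cos (x * Real.sin θ) * Real.cos θ ^ 2)) (funext fun k => ?_)).mpr h
    have h1 : (fun θ : ℝ => (-1) ^ k * (x * Real.sin θ) ^ (2 * k) / (2 * k).factorial *
        Real.cos θ ^ 2) = fun θ => (-1) ^ k * x ^ (2 * k) / (2 * k).factorial *
          (Real.sin θ ^ (2 * k) - Real.sin θ ^ (2 * (k + 1))) := by
      ext θ
      rw [Real.cos_sq']
      ring
    rw [h1, intervalIntegral.integral_const_mul, intervalIntegral.integral_sub
      (by apply Continuous.intervalIntegrable; fun_prop)
      (by apply Continuous.intervalIntegrable; fun_prop), integral_sin_pow_even,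
      integral_sin_pow_even, Finset.prod_range_succ]
    have h2 := prod_wallis_div_factorial k
    have h3 : ((2 * k).factorial : ℝ) ≠ 0 := by positivity
    have h4 : (((k + 1).factorial : ℕ) : ℝ) = (k + 1) * k.factorial := by
      rw [Nat.factorial_succ]; push_cast; ring
    rw [h4, neg_pow (x ^ 2 / 4), div_pow, ← pow_mul]
    have h5 : (∏ i ∈ Finset.range k, (2 * (i : ℝ) + 1) / (2 * i + 2)) =
        1 / (4 ^ k * (k.factorial * k.factorial)) * (2 * k).factorial := by
      rw [← h2]; field_simp
    rw [h5]
    field_simp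
    ring
  · exact fun k => (by fun_prop : Continuous _).aestronglyMeasurable
  · refine fun k => Eventually.of_forall fun θ _ => ?_
    have h1 := Real.abs_sin_le_one θ
    have h2 := Real.abs_cos_le_one θ
    rw [norm_mul, norm_div, norm_mul, norm_pow, norm_pow, norm_pow, norm_mul, norm_neg, norm_one,
      one_pow, one_mul, Real.norm_natCast, Real.norm_eq_abs, Real.norm_eq_abs, Real.norm_eq_abs]
    calc _ ≤ (|x| * 1) ^ (2 * k) / (2 * k).factorial * 1 ^ 2 := by gcongr
      _ = _ := by simp
  · refine Eventually.of_forall fun θ _ => ?_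
    exact (Real.summable_pow_div_factorial |x|).comp_injective
      (fun a b h => Nat.eq_of_mul_eq_mul_left two_pos h)
  · exact intervalIntegrable_const
  · exact Eventually.of_forall fun θ _ => (Real.hasSum_cos _).mul_right _

/-- In the integral representation `|cos| ≤ 1`, and `∫ cos² = π/2` over `[0, π]`. This oscillatory
range is the case `r' < 0`. -/
lemma abs_bes_le_one {u : ℝ} (hu : 0 ≤ u) : |bes u| ≤ 1 := by
  have h := (hasSum_integral_cos_mul_sin (2 * √u)).tsum_eq
  rw [tsum_mul_left] at h
  have hx : (2 * √u) ^ 2 / 4 = u := by rw [mul_pow, Real.sq_sqrt hu]; ring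
  rw [hx] at h
  change Real.pi / 2 * bes u = _ at h
  have h2 : |∫ θ in (0 : ℝ)..Real.pi, Real.cos (2 * √u * Real.sin θ) * Real.cos θ ^ 2| ≤
      ∫ θ in (0 : ℝ)..Real.pi, Real.cos θ ^ 2 := by
    refine (intervalIntegral.abs_integral_le_integral_abs Real.pi_pos.le).trans ?_
    refine intervalIntegral.integral_mono_on Real.pi_pos.le ?_ ?_ fun θ _ => ?_
    · apply Continuous.intervalIntegrable; fun_prop
    · apply Continuous.intervalIntegrable; fun_prop
    · rw [abs_mul, abs_of_nonneg (sq_nonneg (Real.cos θ))]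
      exact mul_le_of_le_one_left (sq_nonneg _) (Real.abs_cos_le_one _)
  rw [← h, integral_cos_sq, abs_mul, abs_of_pos (by positivity)] at h2
  simp only [Real.cos_pi, Real.sin_pi, mul_zero, Real.cos_zero, Real.sin_zero, sub_zero,
    zero_add] at h2
  exact le_of_mul_le_mul_left (by linarith) (show 0 < Real.pi / 2 by positivity)

/-! ### The Lipschitz formula with an exponential twist -/

lemma exp_hasSum (x : ℂ) : HasSum (fun k : ℕ => x ^ k / k.factorial) (exp x) := by
  have := NormedSpace.expSeries_div_hasSum_exp (𝔸 := ℂ) x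
  rwa [← Complex.exp_eq_exp_ℂ] at this

lemma summable_norm_inv_add_int_sq (w : ℍ) :
    Summable fun n : ℤ => ‖(1 : ℂ) / ((w : ℂ) + n) ^ 2‖ := by
  obtain ⟨C, -, h⟩ := exists_tsum_inv_sq_add_sq_le w.im_pos
  refine (h w.re).1.congr fun n => ?_
  have : ‖(w : ℂ) + n‖ ^ 2 = (w.re + n) ^ 2 + w.im ^ 2 := by
    rw [← Complex.normSq_eq_norm_sq, Complex.normSq_apply]; simp; ring
  rw [norm_div, norm_one, norm_pow, this, one_div]

lemma add_int_ne_zero (w : ℍ) (n : ℤ) : (w : ℂ) + n ≠ 0 := by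
  intro h
  have := congrArg Complex.im h
  simp at this
  exact w.im_pos.ne' this

lemma im_le_norm_add_int (w : ℍ) (n : ℤ) : w.im ≤ ‖(w : ℂ) + n‖ := by
  have := (le_abs_self _).trans (Complex.abs_im_le_norm ((w : ℂ) + n))
  simpa using this

/-- The coefficients in the twisted Lipschitz formula. -/
def lipCoeff (t : ℝ) (r : ℕ) : ℝ := -4 * Real.pi ^ 2 * r * bes (4 * Real.pi ^ 2 * t * r)

/-- `4π²|t|r = (2π|t|/δ)(2πδr)`. The parameter `δ` can be taken small enough for the growth in `r`
to be beaten by the decay of `p^r`. -/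
lemma abs_lipCoeff_le {δ : ℝ} (hδ : 0 < δ) (t : ℝ) (r : ℕ) :
    |lipCoeff t r| ≤ 4 * Real.pi ^ 2 * r * Real.exp (2 * Real.pi * (|t| / δ + δ * r)) := by
  have hpi := Real.pi_pos
  have h := abs_bes_le (u := 4 * Real.pi ^ 2 * t * r) (a := 2 * Real.pi * (|t| / δ))
    (b := 2 * Real.pi * (δ * r)) (by positivity) (by positivity)
    (by rw [abs_mul, abs_mul, Nat.abs_cast, abs_of_pos (by positivity)]; field_simp; ring)
  rw [lipCoeff, abs_mul, abs_mul, abs_mul, Nat.abs_cast, abs_neg, abs_of_pos (by positivity),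
    abs_of_pos (by positivity : (0 : ℝ) < Real.pi ^ 2), mul_add (2 * Real.pi)]
  gcongr

lemma abs_lipCoeff_le_of_nonneg {t : ℝ} (ht : 0 ≤ t) (r : ℕ) :
    |lipCoeff t r| ≤ 4 * Real.pi ^ 2 * r := by
  have hpi := Real.pi_pos
  rw [lipCoeff, abs_mul, abs_mul, abs_mul, Nat.abs_cast, abs_neg, abs_of_pos (by positivity),
    abs_of_pos (by positivity : (0 : ℝ) < Real.pi ^ 2)]
  exact mul_le_of_le_one_right (by positivity) (abs_bes_le_one (by positivity))

lemma norm_exp_two_pi_I_mul (w : ℂ) :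
    ‖exp (2 * Real.pi * Complex.I * w)‖ = Real.exp (-2 * Real.pi * w.im) := by
  rw [Complex.norm_exp]; simp

lemma summable_pnat_pow_mul_exp (j : ℕ) {y : ℝ} (hy : 0 < y) :
    Summable fun r : ℕ+ => (r : ℝ) ^ j * Real.exp (-2 * Real.pi * y * r) := by
  have h := Real.summable_pow_mul_exp_neg_nat_mul j (r := 2 * Real.pi * y)
    (by have := Real.pi_pos; positivity)
  refine (h.comp_injective PNat.coe_injective).congr fun r => ?_
  simp

/-- The double series behind the twisted Lipschitz formula. -/
def lipTerm (w : ℂ) (t : ℝ) (x : ℕ+ × ℕ) : ℂ :=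
  ((-4 * Real.pi ^ 2 * (x.1 : ℕ) * ((-(4 * Real.pi ^ 2 * t * (x.1 : ℕ))) ^ x.2 /
    (x.2.factorial * (x.2 + 1).factorial)) : ℝ) : ℂ) *
    exp (2 * Real.pi * Complex.I * w) ^ (x.1 : ℕ)

lemma norm_lipTerm {w : ℂ} (hw : 0 < w.im) (t : ℝ) (r : ℕ+) (k : ℕ) : ‖lipTerm w t (r, k)‖ =
    4 * Real.pi ^ 2 * (r : ℕ) * Real.exp (-2 * Real.pi * w.im * r) *
      ((2 * Real.pi * (|t| / (w.im / 2)) * (2 * Real.pi * (w.im / 2 * (r : ℕ)))) ^ k /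
        (k.factorial * (k + 1).factorial)) := by
  have hpi := Real.pi_pos
  have h1 : |4 * Real.pi ^ 2 * t * (r : ℕ)| =
      2 * Real.pi * (|t| / (w.im / 2)) * (2 * Real.pi * (w.im / 2 * (r : ℕ))) := by
    rw [abs_mul, abs_mul, Nat.abs_cast, abs_of_pos (by positivity)]; field_simp; ring
  have h2 : |-4 * Real.pi ^ 2 * (r : ℕ) * ((-(4 * Real.pi ^ 2 * t * (r : ℕ))) ^ k /
      (k.factorial * (k + 1).factorial))| = 4 * Real.pi ^ 2 * (r : ℕ) *
      (|4 * Real.pi ^ 2 * t * (r : ℕ)| ^ k / (k.factorial * (k + 1).factorial)) := by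
    rw [abs_mul, abs_div, abs_pow, abs_neg (4 * Real.pi ^ 2 * t * (r : ℕ)), neg_mul, neg_mul,
      abs_neg, abs_of_nonneg (by positivity : 0 ≤ 4 * Real.pi ^ 2 * ((r : ℕ) : ℝ)),
      abs_of_nonneg (by positivity : (0 : ℝ) ≤ k.factorial * (k + 1).factorial)]
  rw [lipTerm, norm_mul, norm_pow, norm_exp_two_pi_I_mul, Complex.norm_real, Real.norm_eq_abs, h2,
    h1, ← Real.exp_nat_mul, show ((r : ℕ) : ℝ) * (-2 * Real.pi * w.im) =
      -2 * Real.pi * w.im * r by ring]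
  ring

lemma summable_lipTerm {w : ℂ} (hw : 0 < w.im) (t : ℝ) : Summable (lipTerm w t) := by
  have hpi := Real.pi_pos
  refine Summable.of_norm ?_
  rw [summable_prod_of_nonneg fun _ => norm_nonneg _]
  simp_rw [norm_lipTerm hw]
  refine ⟨fun r => (summable_mul_pow_div_factorial (by positivity) (by positivity)).mul_left _, ?_⟩
  simp_rw [tsum_mul_left]
  refine Summable.of_nonneg_of_le (fun r => by positivity) (fun r => ?_)
    (((summable_pnat_pow_mul_exp 1 (half_pos hw)).mul_left
      (4 * Real.pi ^ 2 * Real.exp (2 * Real.pi * (|t| / (w.im / 2))))))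
  have h2 := tsum_mul_pow_div_factorial_le (a := 2 * Real.pi * (|t| / (w.im / 2)))
    (b := 2 * Real.pi * (w.im / 2 * (r : ℕ))) (by positivity) (by positivity)
  calc _ ≤ 4 * Real.pi ^ 2 * (r : ℕ) * Real.exp (-2 * Real.pi * w.im * r) *
        Real.exp (2 * Real.pi * (|t| / (w.im / 2)) + 2 * Real.pi * (w.im / 2 * (r : ℕ))) := by
        gcongr
    _ = _ := by
      have : Real.exp (-2 * Real.pi * w.im * r) * Real.exp (2 * Real.pi * (w.im / 2 * (r : ℕ))) =
          Real.exp (-2 * Real.pi * (w.im / 2) * r) := by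
        rw [← Real.exp_add]; congr 1; ring
      rw [Real.exp_add, ← this]
      ring

lemma tsum_lipTerm_right (w : ℂ) (t : ℝ) (r : ℕ+) : ∑' k, lipTerm w t (r, k) =
    (lipCoeff t r : ℂ) * exp (2 * Real.pi * Complex.I * w) ^ (r : ℕ) := by
  simp only [lipTerm]
  rw [tsum_mul_right, lipCoeff, bes, ← Complex.ofReal_tsum, tsum_mul_left]

/-- The classical Lipschitz formula in weight `k + 2`, multiplied by the `k`-th coefficient of the
exponential. -/
lemma tsum_lipTerm_left (w : ℍ) (t : ℝ) (k : ℕ) : ∑' r, lipTerm w t (r, k) =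
    ∑' n : ℤ, (-2 * Real.pi * Complex.I * t) ^ k / k.factorial *
      (1 / ((w : ℂ) + n) ^ (k + 1 + 1)) := by
  rw [tsum_mul_left, EisensteinSeries.qExpansion_identity_pnat (Nat.le_add_left 1 k) w,
    ← mul_assoc, ← tsum_mul_left]
  refine tsum_congr fun r => ?_
  have h3 : (-2 * Real.pi * Complex.I * t) ^ k * (-2 * Real.pi * Complex.I) ^ (k + 1 + 1) =
      (-4 * Real.pi ^ 2) * (-4 * Real.pi ^ 2 * t) ^ k := by
    have hA2 : (-2 * Real.pi * Complex.I) ^ 2 = (-4 * Real.pi ^ 2 : ℂ) := by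
      rw [mul_pow, Complex.I_sq]; ring
    generalize (-2 * Real.pi * Complex.I : ℂ) = A at hA2 ⊢
    rw [← hA2]
    ring
  rw [lipTerm]
  push_cast
  rw [show -(4 * (Real.pi : ℂ) ^ 2 * t * (r : ℕ)) = (-4 * Real.pi ^ 2 * t) * (r : ℕ) by ring,
    mul_pow _ ((r : ℕ) : ℂ) k]
  calc _ = (-4 * Real.pi ^ 2) * (-4 * Real.pi ^ 2 * t) ^ k / (k.factorial * (k + 1).factorial) *
        ((r : ℕ) : ℂ) ^ (k + 1) * exp (2 * Real.pi * Complex.I * w) ^ (r : ℕ) := by ring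
    _ = _ := by
      rw [← h3]
      field_simp

lemma summable_int_exp_series (w : ℍ) (A : ℂ) : Summable fun x : ℤ × ℕ =>
    A ^ x.2 / x.2.factorial * (1 / ((w : ℂ) + x.1) ^ (x.2 + 1 + 1)) := by
  have hw := w.im_pos
  refine Summable.of_norm_bounded ((summable_norm_inv_add_int_sq w).mul_of_nonneg
    (Real.summable_pow_div_factorial (‖A‖ / w.im)) (fun _ => norm_nonneg _)
    (fun _ => by positivity)) fun x => ?_
  have h1 := im_le_norm_add_int w x.1
  have h2 : 0 < ‖(w : ℂ) + x.1‖ := hw.trans_le h1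
  rw [norm_mul, norm_div, norm_pow, norm_div, norm_div, norm_pow, norm_pow, norm_one,
    Complex.norm_natCast]
  calc _ = 1 / ‖(w : ℂ) + x.1‖ ^ 2 * ((‖A‖ / ‖(w : ℂ) + x.1‖) ^ x.2 / x.2.factorial) := by
        rw [div_pow]
        field_simp
        ring
    _ ≤ _ := by gcongr

/-- Expand the exponential, apply the Lipschitz formula in every weight `k + 2`, and sum over `k`
first; the series in `k` is the Bessel series. Both interchanges rest on absolutely convergent
double series. -/
lemma tsum_lipschitz_exp (w : ℍ) (t : ℝ) :
    ∑' n : ℤ, 1 / ((w : ℂ) + n) ^ 2 * exp (-2 * Real.pi * Complex.I * t / ((w : ℂ) + n)) =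
      ∑' r : ℕ+, (lipCoeff t r : ℂ) * exp (2 * Real.pi * Complex.I * w) ^ (r : ℕ) := by
  have hw : 0 < (w : ℂ).im := w.im_pos
  calc _ = ∑' (n : ℤ) (k : ℕ), (-2 * Real.pi * Complex.I * t) ^ k / k.factorial *
        (1 / ((w : ℂ) + n) ^ (k + 1 + 1)) := by
        refine tsum_congr fun n => ?_
        have h := add_int_ne_zero w n
        generalize (-2 * Real.pi * Complex.I * t : ℂ) = A
        rw [← ((exp_hasSum _).mul_left _).tsum_eq]
        refine tsum_congr fun k => ?_
        rw [div_pow]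
        field_simp
        ring
    _ = ∑' (k : ℕ) (n : ℤ), (-2 * Real.pi * Complex.I * t) ^ k / k.factorial *
        (1 / ((w : ℂ) + n) ^ (k + 1 + 1)) :=
        (Summable.tsum_comm (summable_int_exp_series w (-2 * Real.pi * Complex.I * t))).symm
    _ = ∑' (k : ℕ) (r : ℕ+), lipTerm w t (r, k) :=
        tsum_congr fun k => (tsum_lipTerm_left w t k).symm
    _ = ∑' (r : ℕ+) (k : ℕ), lipTerm w t (r, k) :=
        Summable.tsum_comm (f := fun r k => lipTerm w t (r, k)) (summable_lipTerm hw t)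
    _ = _ := tsum_congr fun r => tsum_lipTerm_right w t r

/-! ### The Fourier coefficients -/

section coefficients
variable {N : ℕ} [NeZero N]

/-- The term of modulus `N k` in the `r`-th Fourier coefficient of the limit of the twists. -/
def coeffTerm (N : ℕ) [NeZero N] (m : ℤ) (r : ℕ) (k : ℕ+) : ℂ :=
  klo (N * k) (r : ℤ) m / ((N * k : ℕ) : ℂ) ^ 2 * (lipCoeff (m / ((N * k : ℕ) : ℝ) ^ 2) r : ℂ)

/-- The `r`-th Fourier coefficient of the limit of the twists. -/
def fourierCoeff (N : ℕ) [NeZero N] (m : ℤ) (r : ℕ) : ℂ := ∑' k : ℕ+, coeffTerm N m r k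

lemma norm_klo_natCast_div_sq_le (m : ℤ) {r : ℕ} (hr : 0 < r) (k : ℕ+) :
    ‖klo (N * k) (r : ℤ) m / ((N * k : ℕ) : ℂ) ^ 2‖ ≤ 3 * r * kloWeight (N * k) := by
  have h := norm_klo_div_sq_le (N * k) (m : ZMod (N * k)) (b := (r : ℤ)) (by exact_mod_cast hr.ne')
  rw [klo_symm, norm_div, norm_pow, Complex.norm_natCast]
  simpa using h

lemma norm_coeffTerm_le {δ : ℝ} (hδ : 0 < δ) (m : ℤ) {r : ℕ} (hr : 0 < r) (k : ℕ+) :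
    ‖coeffTerm N m r k‖ ≤ 12 * Real.pi ^ 2 * r ^ 2 *
      Real.exp (2 * Real.pi * (|(m : ℝ)| / (N ^ 2 * δ) + δ * r)) * kloWeight (N * k) := by
  have hpi := Real.pi_pos
  have hN : (0 : ℝ) < N := by exact_mod_cast NeZero.pos N
  have hk : (1 : ℝ) ≤ (k : ℕ) := by exact_mod_cast k.pos
  have h1 := norm_klo_natCast_div_sq_le (N := N) m hr k
  have h2 := abs_lipCoeff_le hδ (m / ((N * k : ℕ) : ℝ) ^ 2) r
  have h3 : |(m : ℝ) / ((N * k : ℕ) : ℝ) ^ 2| / δ ≤ |(m : ℝ)| / (N ^ 2 * δ) := by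
    rw [abs_div, abs_of_nonneg (sq_nonneg ((N * k : ℕ) : ℝ)), div_div]
    push_cast
    gcongr
    exact le_mul_of_one_le_right hN.le hk
  have hw := kloWeight_nonneg (N * k)
  rw [coeffTerm, norm_mul, Complex.norm_real, Real.norm_eq_abs]
  calc _ ≤ 3 * r * kloWeight (N * k) * (4 * Real.pi ^ 2 * r *
        Real.exp (2 * Real.pi * (|(m : ℝ)| / (N ^ 2 * δ) + δ * r))) := by
        refine mul_le_mul h1 (h2.trans ?_) (abs_nonneg _) (by positivity)
        gcongr
    _ = _ := by ring

lemma norm_coeffTerm_le_of_nonneg {m : ℤ} (hm : 0 ≤ m) {r : ℕ} (hr : 0 < r) (k : ℕ+) :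
    ‖coeffTerm N m r k‖ ≤ 12 * Real.pi ^ 2 * r ^ 2 * kloWeight (N * k) := by
  have h1 := norm_klo_natCast_div_sq_le (N := N) m hr k
  have hm' : (0 : ℝ) ≤ m := by exact_mod_cast hm
  have h2 := abs_lipCoeff_le_of_nonneg (t := m / ((N * k : ℕ) : ℝ) ^ 2) (by positivity) r
  have hw := kloWeight_nonneg (N * k)
  rw [coeffTerm, norm_mul, Complex.norm_real, Real.norm_eq_abs]
  calc _ ≤ 3 * r * kloWeight (N * k) * (4 * Real.pi ^ 2 * r) :=
        mul_le_mul h1 h2 (abs_nonneg _) (by positivity)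
    _ = _ := by ring

lemma summable_coeffTerm (m : ℤ) {r : ℕ} (hr : 0 < r) : Summable (coeffTerm N m r) :=
  Summable.of_norm_bounded (summable_kloWeight_mul.mul_left _) (norm_coeffTerm_le one_pos m hr)

/-- The sum of the weights of the moduli `N k`. -/
def kloMass (N : ℕ) : ℝ := ∑' k : ℕ+, kloWeight (N * k)

lemma kloMass_nonneg (N : ℕ) : 0 ≤ kloMass N := tsum_nonneg fun _ => kloWeight_nonneg _

lemma norm_fourierCoeff_le {δ : ℝ} (hδ : 0 < δ) (m : ℤ) {r : ℕ} (hr : 0 < r) :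
    ‖fourierCoeff N m r‖ ≤ 12 * Real.pi ^ 2 * r ^ 2 *
      Real.exp (2 * Real.pi * (|(m : ℝ)| / (N ^ 2 * δ) + δ * r)) * kloMass N := by
  rw [kloMass, ← tsum_mul_left]
  exact tsum_of_norm_bounded (summable_kloWeight_mul.mul_left _).hasSum (norm_coeffTerm_le hδ m hr)

lemma norm_fourierCoeff_le_of_nonneg {m : ℤ} (hm : 0 ≤ m) {r : ℕ} (hr : 0 < r) :
    ‖fourierCoeff N m r‖ ≤ 12 * Real.pi ^ 2 * r ^ 2 * kloMass N := by
  rw [kloMass, ← tsum_mul_left]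
  exact tsum_of_norm_bounded (summable_kloWeight_mul.mul_left _).hasSum
    (norm_coeffTerm_le_of_nonneg hm hr)

lemma norm_nome_pow (z : ℍ) (r : ℕ) : ‖exp (2 * Real.pi * Complex.I * (z : ℂ)) ^ r‖ =
    Real.exp (-2 * Real.pi * z.im * r) := by
  rw [norm_pow, norm_exp_two_pi_I_mul, ← Real.exp_nat_mul]
  congr 1
  rw [UpperHalfPlane.coe_im]
  ring

/-- Taking `δ = Im z / 2` spends half of the decay of `p^r` on the Bessel growth and leaves the
other half for summation. -/
lemma summable_coeffTerm_mul_nome (m : ℤ) (z : ℍ) : Summable fun x : ℕ+ × ℕ+ =>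
    coeffTerm N m x.2 x.1 * exp (2 * Real.pi * Complex.I * (z : ℂ)) ^ (x.2 : ℕ) := by
  have hz := z.im_pos
  refine Summable.of_norm_bounded (((summable_kloWeight_mul (N := N)).mul_of_nonneg
    (summable_pnat_pow_mul_exp 2 (half_pos hz)) (fun _ => kloWeight_nonneg _)
    (fun _ => by positivity)).mul_left (12 * Real.pi ^ 2 *
      Real.exp (2 * Real.pi * (|(m : ℝ)| / (N ^ 2 * (z.im / 2)))))) fun x => ?_
  rw [norm_mul, norm_nome_pow]
  calc _ ≤ 12 * Real.pi ^ 2 * (x.2 : ℕ) ^ 2 * Real.exp (2 * Real.pi * (|(m : ℝ)| /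
        (N ^ 2 * (z.im / 2)) + z.im / 2 * (x.2 : ℕ))) * kloWeight (N * x.1) *
        Real.exp (-2 * Real.pi * z.im * (x.2 : ℕ)) := by
        gcongr
        exact norm_coeffTerm_le (half_pos hz) m x.2.pos x.1
    _ = _ := by
      have : Real.exp (-2 * Real.pi * (z.im / 2) * (x.2 : ℕ)) =
          Real.exp (2 * Real.pi * (z.im / 2 * (x.2 : ℕ))) *
            Real.exp (-2 * Real.pi * z.im * (x.2 : ℕ)) := by
        rw [← Real.exp_add]; congr 1; ring
      rw [mul_add, Real.exp_add, this]
      ring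

lemma summable_fourierCoeff_mul_nome (m : ℤ) (z : ℍ) : Summable fun r : ℕ+ =>
    fourierCoeff N m r * exp (2 * Real.pi * Complex.I * (z : ℂ)) ^ (r : ℕ) := by
  refine (summable_coeffTerm_mul_nome (N := N) m z).prod_symm.prod.congr fun r => ?_
  rw [fourierCoeff, ← tsum_mul_right]
  rfl

lemma eisTerm_at_one (z : ℍ) (γ : SL(2, ℤ)) : eisTerm z 1 γ = 1 / autom γ z ^ 2 := by
  have h := CuspIdx.autom_ne_zero γ z
  rw [eisTerm, show (2 * 1 + 2 : ℂ) = ((4 : ℕ) : ℂ) by norm_num, Complex.cpow_natCast]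
  have h1 : ((‖autom γ z‖ : ℝ) : ℂ) ^ 2 = autom γ z * starRingEnd ℂ (autom γ z) := by
    rw [Complex.mul_conj, Complex.normSq_eq_norm_sq]; push_cast; rfl
  have h2 : starRingEnd ℂ (autom γ z) ≠ 0 := by simpa using h
  rw [show ((‖autom γ z‖ : ℝ) : ℂ) ^ 4 = (((‖autom γ z‖ : ℝ) : ℂ) ^ 2) ^ 2 by ring, h1]
  field_simp

lemma twistTerm_one (m : ℤ) (z : ℍ) (i : CuspIdx N) : twistTerm m z 1 i =
    fexp m ((i.a : ℂ) / i.c) / (i.c : ℂ) ^ 2 * (1 / (i.pt z) ^ 2 *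
      exp (-2 * Real.pi * Complex.I * ((m / (i.c : ℝ) ^ 2 : ℝ) : ℂ) / i.pt z)) := by
  have hj := CuspIdx.autom_ne_zero i.mat z
  have hc := i.c_ne_zero
  rw [CuspIdx.autom_mat] at hj
  have hp := right_ne_zero_of_mul hj
  rw [twistTerm, eisTerm_at_one, CuspIdx.mat_smul, sub_eq_add_neg, fexp_add, CuspIdx.autom_mat]
  have : fexp m (-(1 / ((i.c : ℂ) * (i.c * i.pt z)))) =
      exp (-2 * Real.pi * Complex.I * ((m / (i.c : ℝ) ^ 2 : ℝ) : ℂ) / i.pt z) := by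
    rw [fexp]
    congr 1
    push_cast
    field_simp
  rw [this]
  field_simp

lemma summable_twistTerm_one_slice (m : ℤ) (z : ℍ) (k : ℕ+) :
    Summable fun x : (ZMod (N * k))ˣ × ℤ => twistTerm (N := N) m z 1 ⟨k, x⟩ := by
  obtain ⟨Y, -, -, hY⟩ := exists_forall_im_smul_le (N := N) z
  refine summable_fintype_prod fun u => ?_
  have h := summable_norm_inv_add_int_sq
    ((((u : ZMod (N * k)).val : ℝ) / ((N * k : ℕ) : ℝ) : ℝ) +ᵥ z)
  refine Summable.of_nonneg_of_le (fun _ => norm_nonneg _) (fun n => ?_)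
    (h.mul_left (Real.exp (2 * Real.pi * |(m : ℝ)| * Y)))
  refine (norm_twistTerm_le hY m 1 _).trans ?_
  have hc : (1 : ℝ) ≤ ‖(CuspIdx.c (N := N) ⟨k, u, n⟩ : ℂ)‖ := by
    rw [Complex.norm_natCast]; exact_mod_cast CuspIdx.c_pos (N := N) ⟨k, u, n⟩
  have hp : CuspIdx.pt (N := N) ⟨k, u, n⟩ z =
      (((((u : ZMod (N * k)).val : ℝ) / ((N * k : ℕ) : ℝ) : ℝ) +ᵥ z : ℍ) : ℂ) + n := by
    simp only [UpperHalfPlane.coe_vadd, CuspIdx.pt, CuspIdx.c]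
    ring
  have hne := add_int_ne_zero ((((u : ZMod (N * k)).val : ℝ) / ((N * k : ℕ) : ℝ) : ℝ) +ᵥ z) n
  rw [eisTerm_at_one, CuspIdx.autom_mat, ← hp, norm_div, norm_div, mul_pow, norm_mul]
  rw [← hp] at hne
  gcongr
  · exact pow_pos (norm_pos_iff.2 hne) 2 |>.trans_le (by rw [norm_pow])
  · refine le_mul_of_one_le_left (norm_nonneg _) ?_
    rw [norm_pow]
    exact one_le_pow₀ hc

/-- For a fixed modulus and residue, `γz = a/c - 1/(c²(z + d/c))`, so the sum over `n` is the
twisted Lipschitz series with `t = m/c²`. Summing the resulting characters over the residues gives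
the Kloosterman sum. -/
lemma tsum_twistTerm_one_slice (m : ℤ) (z : ℍ) (k : ℕ+) :
    ∑' x : (ZMod (N * k))ˣ × ℤ, twistTerm (N := N) m z 1 ⟨k, x⟩ =
      ∑' r : ℕ+, coeffTerm N m r k * exp (2 * Real.pi * Complex.I * (z : ℂ)) ^ (r : ℕ) := by
  rw [(summable_twistTerm_one_slice m z k).tsum_prod, tsum_fintype]
  have hsum : ∀ u : (ZMod (N * k))ˣ, Summable fun r : ℕ+ =>
      (lipCoeff (m / ((N * k : ℕ) : ℝ) ^ 2) r : ℂ) *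
        exp (2 * Real.pi * Complex.I * (z : ℂ)) ^ (r : ℕ) / ((N * k : ℕ) : ℂ) ^ 2 *
        ZMod.stdAddChar (((r : ℕ) : ZMod (N * k)) * (u : ZMod (N * k)) +
          (m : ZMod (N * k)) * ((u⁻¹ : (ZMod (N * k))ˣ) : ZMod (N * k))) := by
    intro u
    have h0 := (summable_lipTerm (w := (z : ℂ)) z.im_pos (m / ((N * k : ℕ) : ℝ) ^ 2)).prod.congr
      fun r => tsum_lipTerm_right _ _ r
    refine Summable.of_norm_bounded (h0.div_const (((N * k : ℕ) : ℂ) ^ 2)).norm fun r => ?_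
    rw [norm_mul, AddChar.norm_apply, mul_one]
  have h1 : ∀ u : (ZMod (N * k))ˣ, ∑' n : ℤ, twistTerm (N := N) m z 1 ⟨k, (u, n)⟩ =
      ∑' r : ℕ+, (lipCoeff (m / ((N * k : ℕ) : ℝ) ^ 2) r : ℂ) *
        exp (2 * Real.pi * Complex.I * (z : ℂ)) ^ (r : ℕ) / ((N * k : ℕ) : ℂ) ^ 2 *
        ZMod.stdAddChar (((r : ℕ) : ZMod (N * k)) * (u : ZMod (N * k)) +
          (m : ZMod (N * k)) * ((u⁻¹ : (ZMod (N * k))ˣ) : ZMod (N * k))) := by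
    intro u
    have hp : ∀ n : ℤ, CuspIdx.pt (N := N) ⟨k, u, n⟩ z =
        (((((u : ZMod (N * k)).val : ℝ) / ((N * k : ℕ) : ℝ) : ℝ) +ᵥ z : ℍ) : ℂ) + n := by
      intro n
      simp only [UpperHalfPlane.coe_vadd, CuspIdx.pt, CuspIdx.c]
      ring
    have ha : fexp m ((((u⁻¹ : (ZMod (N * k))ˣ) : ZMod (N * k)).val : ℂ) / ((N * k : ℕ) : ℂ)) =
        ZMod.stdAddChar ((m : ZMod (N * k)) * ((u⁻¹ : (ZMod (N * k))ˣ) : ZMod (N * k))) := by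
      have := fexp_div_eq (N * k) m (((u⁻¹ : (ZMod (N * k))ˣ) : ZMod (N * k)).val : ℤ)
      rw [Int.cast_natCast] at this
      rw [this, Int.cast_mul, Int.cast_natCast, ZMod.natCast_zmod_val]
    have hu : ∀ r : ℕ+, exp (2 * Real.pi * Complex.I *
        ((((u : ZMod (N * k)).val : ℝ) / ((N * k : ℕ) : ℝ) : ℝ) : ℂ)) ^ (r : ℕ) =
        ZMod.stdAddChar (((r : ℕ) : ZMod (N * k)) * (u : ZMod (N * k))) := by
      intro r
      have := fexp_div_eq (N * k) ((r : ℕ) : ℤ) ((u : ZMod (N * k)).val : ℤ)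
      have h2 : (((((r : ℕ) : ℤ) * ((u : ZMod (N * k)).val : ℤ) : ℤ)) : ZMod (N * k)) =
          ((r : ℕ) : ZMod (N * k)) * (u : ZMod (N * k)) := by
        push_cast; simp
      rw [h2] at this
      rw [← this, fexp, ← Complex.exp_nat_mul]
      congr 1
      push_cast
      ring
    simp_rw [twistTerm_one, hp]
    change ∑' n : ℤ, fexp m ((((u⁻¹ : (ZMod (N * k))ˣ) : ZMod (N * k)).val : ℂ) /
      ((N * k : ℕ) : ℂ)) / ((N * k : ℕ) : ℂ) ^ 2 * _ = _
    rw [tsum_mul_left]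
    refine (congrArg _ (tsum_lipschitz_exp _ (m / ((N * k : ℕ) : ℝ) ^ 2))).trans ?_
    rw [← tsum_mul_left]
    refine tsum_congr fun r => ?_
    rw [UpperHalfPlane.coe_vadd, mul_add, Complex.exp_add, mul_pow, hu, ha, AddChar.map_add_eq_mul]
    ring
  rw [Finset.sum_congr rfl fun u _ => h1 u, ← Summable.tsum_finsetSum fun u _ => hsum u]
  refine tsum_congr fun r => ?_
  rw [coeffTerm, klo, ← Finset.mul_sum, Int.cast_natCast]
  ring

/-- Modulus by modulus the cusp terms are the twisted terms minus the remainders. The remainders sum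
absolutely over all indices and cancel against those in `twistLim`; what is left is a double series
absolutely convergent in `(c, r)`, summed over `c` first. -/
lemma twistLim_eq (m : ℤ) (z : ℍ) : twistLim N m z =
    ∑' r : ℕ+, fourierCoeff N m r * exp (2 * Real.pi * Complex.I * (z : ℂ)) ^ (r : ℕ) +
      if m = 0 then ((-(3 / (Real.pi * phi N * z.im)) : ℝ) : ℂ) else 0 := by
  have hr := summable_remTerm (N := N) m z one_mem_nearOne
  have ht := summable_twistTerm_one_slice (N := N) m z
  have hc : ∀ k : ℕ+, ∑' x : (ZMod (N * k))ˣ × ℤ, cuspTerm (N := N) m z 1 ⟨k, x⟩ =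
      ∑' r : ℕ+, coeffTerm N m r k * exp (2 * Real.pi * Complex.I * (z : ℂ)) ^ (r : ℕ) -
        ∑' x : (ZMod (N * k))ˣ × ℤ, remTerm (N := N) m z 1 ⟨k, x⟩ := by
    intro k
    rw [← tsum_twistTerm_one_slice, ← (ht k).tsum_sub (hr.sigma_factor k)]
    refine tsum_congr fun x => ?_
    rw [twistTerm, remTerm, cuspTerm]
    ring
  have hs := summable_coeffTerm_mul_nome (N := N) m z
  rw [twistLim, regSum_one, tsum_congr hc, hs.prod.tsum_sub hr.sigma, ← hr.tsum_sigma,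
    ← hs.tsum_prod, add_sub_cancel, hs.tsum_prod]
  congr 1
  refine (Summable.tsum_comm (f := fun (k r : ℕ+) =>
      coeffTerm N m r k * exp (2 * Real.pi * Complex.I * (z : ℂ)) ^ (r : ℕ)) hs).symm.trans ?_
  refine tsum_congr fun r => ?_
  rw [tsum_mul_right, fourierCoeff]

/-! ### Comparison with the Eisenstein and Poincaré coefficients -/

/-- If `x` is the Bessel argument then `(x/2)² = 4π²|r'|r/c²` is, up to sign, the argument of `bes`,
and `√(r/|r'|) · x/2 = 2πr/c` turns the normalization into that of `lipCoeff`. The sign of `r'`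
decides between `I₁` and `J₁`. -/
lemma sqrt_mul_poincareCoeffTerm {r' : ℤ} (hr' : r' ≠ 0) {r : ℕ} (hr : 0 < r) (k : ℕ+) :
    -2 * Real.pi * ((√(r / |(r' : ℝ)|) : ℝ) : ℂ) * poincareCoeffTerm N r' r k =
      coeffTerm N (-r') r k := by
  have hr0 : (0 : ℝ) < r := by exact_mod_cast hr
  have hm0 : 0 < |(r' : ℝ)| := abs_pos.2 (by exact_mod_cast hr')
  have hc : (0 : ℝ) < ((N * k : ℕ) : ℝ) := by exact_mod_cast cast_pos_of_pnat (N := N) k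
  set c : ℝ := ((N * k : ℕ) : ℝ) with hcdef
  set x : ℝ := 4 * Real.pi * √(r * |(r' : ℝ)|) / c with hx
  have hx2 : (x / 2) ^ 2 = 4 * Real.pi ^ 2 * (|(r' : ℝ)| / c ^ 2) * r := by
    rw [hx, div_pow, div_pow, mul_pow, Real.sq_sqrt (by positivity)]
    field_simp
    ring
  have hB : (if 0 < r' then besselI1 else besselJ1) x =
      x / 2 * bes (4 * Real.pi ^ 2 * (((-r' : ℤ) : ℝ) / c ^ 2) * r) := by
    have hab : (((-r' : ℤ) : ℝ)) = if 0 < r' then -|(r' : ℝ)| else |(r' : ℝ)| := by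
      split_ifs with h
      · rw [abs_of_pos (by exact_mod_cast h)]; push_cast; rfl
      · rw [abs_of_nonpos (by exact_mod_cast not_lt.1 h)]; push_cast; rfl
    rw [hab]
    split_ifs with h
    · rw [besselI1, bes, ← tsum_mul_left]
      refine tsum_congr fun j => ?_
      rw [show -(4 * Real.pi ^ 2 * (-|(r' : ℝ)| / c ^ 2) * r) = (x / 2) ^ 2 by rw [hx2]; ring]
      generalize x / 2 = y
      ring
    · rw [besselJ1, bes, ← tsum_mul_left]
      refine tsum_congr fun j => ?_
      rw [← hx2, neg_pow]
      generalize x / 2 = y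
      ring
  have hs : √(r / |(r' : ℝ)|) * (x / 2) = 2 * Real.pi * r / c := by
    have : √(r / |(r' : ℝ)|) * √(r * |(r' : ℝ)|) = r := by
      rw [← Real.sqrt_mul (by positivity), show (r : ℝ) / |(r' : ℝ)| * (r * |(r' : ℝ)|) = r ^ 2 by
        field_simp, Real.sqrt_sq hr0.le]
    rw [hx]
    linear_combination (2 * Real.pi / c) * this
  have hk : kloosterman (-r) r' (N * k) = klo (N * k) (r : ℤ) ((-r' : ℤ) : ZMod (N * k)) := by
    rw [kloosterman_eq_klo]
    push_cast
    rw [klo_neg]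
  rw [poincareCoeffTerm, coeffTerm, hk, ← hx, hB, lipCoeff]
  have hs' : ((√(r / |(r' : ℝ)|) : ℝ) : ℂ) * ((x / 2 : ℝ) : ℂ) = 2 * Real.pi * r / c := by
    exact_mod_cast congrArg (Complex.ofReal) hs
  have hcc : ((N * k : ℕ) : ℂ) = (c : ℂ) := by rw [hcdef]; push_cast; rfl
  rw [hcc, Complex.ofReal_mul, Complex.ofReal_mul (-4 * Real.pi ^ 2 * r)]
  calc _ = -2 * Real.pi * (((√(r / |(r' : ℝ)|) : ℝ) : ℂ) * ((x / 2 : ℝ) : ℂ)) *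
        (klo (N * k) (r : ℤ) ((-r' : ℤ) : ZMod (N * k)) / c) *
        (bes (4 * Real.pi ^ 2 * (((-r' : ℤ) : ℝ) / c ^ 2) * r) : ℂ) := by ring
    _ = _ := by
      rw [hs']
      generalize bes _ = B
      push_cast
      ring

lemma summable_poincareCoeffTerm {r' : ℤ} (hr' : r' ≠ 0) {r : ℕ} (hr : 0 < r) :
    Summable (poincareCoeffTerm N r' r) := by
  have h0 : (-2 * Real.pi * ((√(r / |(r' : ℝ)|) : ℝ) : ℂ) : ℂ) ≠ 0 := by
    have hr0 : (0 : ℝ) < r := by exact_mod_cast hr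
    have hm0 : 0 < |(r' : ℝ)| := abs_pos.2 (by exact_mod_cast hr')
    have h1 : √(r / |(r' : ℝ)|) ≠ 0 := (Real.sqrt_pos.2 (by positivity)).ne'
    have := Real.pi_ne_zero
    exact mul_ne_zero (mul_ne_zero (by norm_num) (by exact_mod_cast this)) (by exact_mod_cast h1)
  rw [← summable_mul_left_iff h0]
  exact (summable_coeffTerm (-r') hr).congr fun k => (sqrt_mul_poincareCoeffTerm hr' hr k).symm

lemma poincareCoeff_eq {r' : ℤ} (hr' : r' ≠ 0) {r : ℕ} (hr : 0 < r) :
    poincareCoeff N r' r = fourierCoeff N (-r') r := by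
  rw [poincareCoeff, ← tsum_mul_left, fourierCoeff]
  exact tsum_congr fun k => sqrt_mul_poincareCoeffTerm hr' hr k

lemma bes_zero : bes 0 = 1 := by
  rw [bes, tsum_eq_single 0]
  · simp
  · intro k hk
    simp [hk]

/-- For `m = 0` the Bessel factor is `1` and the Kloosterman sum is a Ramanujan sum. -/
lemma eisCoeff_eq (z : ℍ) {r : ℕ} (hr : 0 < r) : eisCoeff N z r = fourierCoeff N 0 r := by
  rw [eisCoeff, if_neg hr.ne', ← tsum_mul_left, fourierCoeff]
  refine tsum_congr fun k => ?_
  have h := kloosterman_eq_klo (N * k) (r : ℤ) 0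
  rw [kloosterman_zero_right (N * k) (cast_pos_of_pnat k).ne' r] at h
  rw [h, coeffTerm, lipCoeff, Int.cast_zero (R := ℝ), zero_div, mul_zero, zero_mul, bes_zero]
  push_cast
  ring

end coefficients

/-! ### The periodized kernel -/

/-- `(w - v) (w - conj v)`. -/
def kerPoly (v : ℍ) (w : ℂ) : ℂ := (w - v) * (w - starRingEnd ℂ (v : ℂ))

/-- `conj P / |P| ^ (2 s)`. -/
def kerPow (s P : ℂ) : ℂ := starRingEnd ℂ P / ((‖P‖ : ℝ) : ℂ) ^ (2 * s)

/-- The periodization of the kernel. -/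
def kerSum (v : ℍ) (s w : ℂ) : ℂ := ∑' n : ℤ, kerPow s (kerPoly v (w + n))

/-- The powers of `|j|` from the two factors combine to `|j|^(4s)`, and `4s = 2(2s - 1) + 2`: this
is why the Eisenstein exponent is `2s - 1`. -/
lemma xiTerm_eq (z v : ℍ) (s : ℂ) (γ : SL(2, ℤ)) : xiTerm z v s γ =
    eisTerm z (2 * s - 1) γ * kerPow s (kerPoly v ((γ • z : ℍ) : ℂ)) := by
  have hj := CuspIdx.autom_ne_zero γ z
  have hn : ((‖autom γ z‖ : ℝ) : ℂ) ≠ 0 := by exact_mod_cast norm_ne_zero_iff.2 hj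
  have hmu : ∀ x : ℂ, mu γ z (-x) = autom γ z * (((γ • z : ℍ) : ℂ) - x) := by
    intro x
    rw [CuspIdx.smul_eq, mul_sub, mul_div_cancel₀ _ hj, mu, autom]
    ring
  rw [xiTerm, hmu, hmu, eisTerm, kerPow, kerPoly, map_mul, map_mul, map_mul, norm_mul, norm_mul,
    norm_mul, Complex.ofReal_mul, Complex.ofReal_mul, Complex.ofReal_mul,
    Complex.mul_cpow_ofReal_nonneg (norm_nonneg _) (norm_nonneg _),
    Complex.mul_cpow_ofReal_nonneg (norm_nonneg _) (norm_nonneg _),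
    Complex.mul_cpow_ofReal_nonneg (norm_nonneg _) (norm_nonneg _),
    show 2 * (2 * s - 1) + 2 = 2 * s + 2 * s by ring, Complex.cpow_add _ _ hn]
  have h1 : ((‖autom γ z‖ : ℝ) : ℂ) ^ (2 * s) ≠ 0 := by
    rw [Complex.cpow_ne_zero_iff]; exact Or.inl hn
  rw [div_mul_div_comm]
  congr 1 <;> ring

lemma kerPow_eq {P : ℂ} (hP : P ≠ 0) (s : ℂ) :
    kerPow s P = P⁻¹ * ((‖P‖ : ℝ) : ℂ) ^ (-(2 * (s - 1))) := by
  have hn : ((‖P‖ : ℝ) : ℂ) ≠ 0 := by exact_mod_cast norm_ne_zero_iff.2 hP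
  have h1 : starRingEnd ℂ P = ((‖P‖ : ℝ) : ℂ) ^ 2 * P⁻¹ := by
    rw [← div_eq_mul_inv, eq_div_iff hP, mul_comm, Complex.mul_conj, Complex.normSq_eq_norm_sq]
    push_cast; rfl
  rw [kerPow, h1, Complex.cpow_neg, show 2 * s = 2 * (s - 1) + (2 : ℕ) by push_cast; ring,
    Complex.cpow_add _ _ hn, Complex.cpow_natCast]
  have h2 : ((‖P‖ : ℝ) : ℂ) ^ (2 * (s - 1)) ≠ 0 := by
    rw [Complex.cpow_ne_zero_iff]; exact Or.inl hn
  field_simp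

lemma norm_kerPow {P : ℂ} (hP : P ≠ 0) (s : ℂ) :
    ‖kerPow s P‖ = ‖P‖⁻¹ * ‖P‖ ^ (-(2 * (s - 1)).re) := by
  rw [kerPow_eq hP, norm_mul, norm_inv, Complex.norm_cpow_eq_rpow_re_of_pos (norm_pos_iff.2 hP),
    Complex.neg_re]

lemma kerPow_one {P : ℂ} (hP : P ≠ 0) : kerPow 1 P = P⁻¹ := by
  rw [kerPow_eq hP]; simp

lemma tendsto_kerPow {P : ℂ} (hP : P ≠ 0) :
    Tendsto (fun s => kerPow s P) toOne (𝓝 (kerPow 1 P)) := by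
  have hn : ((‖P‖ : ℝ) : ℂ) ≠ 0 := by exact_mod_cast norm_ne_zero_iff.2 hP
  unfold kerPow
  refine Tendsto.div tendsto_const_nhds ?_ ?_
  · exact (tendsto_toOne.const_mul 2).const_cpow (Or.inl hn)
  · rw [Complex.cpow_ne_zero_iff]; exact Or.inl hn

lemma abs_log_sub_log_le {a b m D : ℝ} (hm : 0 < m) (ha : m ≤ a) (hb : m ≤ b) (hD : |a - b| ≤ D) :
    |Real.log a - Real.log b| ≤ D / m := by
  have ha0 := hm.trans_le ha
  have hb0 := hm.trans_le hb
  have hD0 := (abs_nonneg _).trans hD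
  have key : ∀ x y : ℝ, m ≤ x → m ≤ y → |x - y| ≤ D → Real.log x - Real.log y ≤ D / m := by
    intro x y hx hy hxy
    have hx0 := hm.trans_le hx
    have hy0 := hm.trans_le hy
    rw [← Real.log_div hx0.ne' hy0.ne']
    refine (Real.log_le_sub_one_of_pos (by positivity)).trans ?_
    rw [div_sub_one hy0.ne']
    calc (x - y) / y ≤ D / y := by gcongr; exact (le_abs_self _).trans hxy
      _ ≤ D / m := by gcongr
  rw [abs_le]
  exact ⟨by linarith [key b a hb ha (by rwa [abs_sub_comm])], key a b ha hb hD⟩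

/-- Write the kernel as `P⁻¹ exp(-τ log|P|)` with `τ = 2(s - 1)`. Both exponents lie in a half-plane
where `exp` is Lipschitz with constant `1 + ε⁻²`, and the logarithms differ by at most `L/κ`. The
factor `3` is `1 + 2`, from the difference of inverses and from `|τ| ≤ 2`. -/
lemma norm_kerPow_sub_le {s : ℂ} (hs : s ∈ nearOne) {P : ℂ} {b ε κ L : ℝ} (hε : 0 < ε)
    (hP : ε ≤ ‖P‖) (hb : ε ≤ b) (hκ : 0 < κ) (hκ1 : κ ≤ 1) (hκP : κ * b ≤ ‖P‖)
    (hL : ‖P - b‖ ≤ L * b) :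
    ‖kerPow s P - kerPow s b‖ ≤ 3 * (1 + (ε ^ 2)⁻¹) / κ * L / b := by
  have hτ := two_mul_sub_one_mem_expDomain hs
  set τ := 2 * (s - 1) with hτdef
  have hb0 := hε.trans_le hb
  have hP0 : 0 < ‖P‖ := hε.trans_le hP
  have hPne := norm_pos_iff.1 hP0
  have hbne : (b : ℂ) ≠ 0 := by exact_mod_cast hb0.ne'
  have hnb : ‖(b : ℂ)‖ = b := by rw [Complex.norm_real, Real.norm_of_nonneg hb0.le]
  have hL0 : 0 ≤ L := by
    by_contra h
    exact absurd ((norm_nonneg _).trans hL) (not_le.2 (mul_neg_of_neg_of_pos (not_le.1 h) hb0))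
  set M := 1 + (ε ^ 2)⁻¹ with hM
  have hM0 : 0 < M := by positivity
  have hexp : ∀ a : ℝ, ε ≤ a → (a : ℂ) ^ (-τ) = exp (-τ * Real.log a) ∧
      (-τ * Real.log a).re ≤ Real.log M := by
    intro a ha
    have ha0 := hε.trans_le ha
    have hane : (a : ℂ) ≠ 0 := by exact_mod_cast ha0.ne'
    refine ⟨by rw [Complex.cpow_def_of_ne_zero hane, Complex.ofReal_log ha0.le, mul_comm], ?_⟩
    have h1 := rpow_neg_le_of_le hε ha hτ.1 (re_le_two_of_mem hτ)
    have h2 : (-τ * Real.log a).re = Real.log (a ^ (-τ.re)) := by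
      rw [Real.log_rpow ha0]; simp
    rw [h2]
    exact Real.log_le_log (Real.rpow_pos_of_pos ha0 _) h1
  obtain ⟨eP, rP⟩ := hexp _ hP
  obtain ⟨eb, rb⟩ := hexp _ hb
  have hdiff := norm_exp_sub_exp_le rP rb
  rw [Real.exp_log hM0, ← mul_sub, norm_mul, norm_neg, ← Complex.ofReal_sub, Complex.norm_real,
    Real.norm_eq_abs] at hdiff
  have hκb : κ * b ≤ b := mul_le_of_le_one_left hb0.le hκ1
  have hnorm : |‖P‖ - b| ≤ L * b := by
    have := abs_norm_sub_norm_le P (b : ℂ)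
    rw [hnb] at this
    exact this.trans hL
  have hlog := abs_log_sub_log_le (by positivity) hκP hκb hnorm
  have hMP : ‖((‖P‖ : ℝ) : ℂ) ^ (-τ)‖ ≤ M := by
    rw [Complex.norm_cpow_eq_rpow_re_of_pos hP0, Complex.neg_re]
    exact rpow_neg_le_of_le hε hP hτ.1 (re_le_two_of_mem hτ)
  have e1 : kerPow s P - kerPow s b = (P⁻¹ - (b : ℂ)⁻¹) * ((‖P‖ : ℝ) : ℂ) ^ (-τ) +
      (b : ℂ)⁻¹ * (exp (-τ * Real.log ‖P‖) - exp (-τ * Real.log b)) := by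
    rw [kerPow_eq hPne, kerPow_eq hbne, hnb, ← eP, ← eb]
    ring
  have e2 : P⁻¹ - (b : ℂ)⁻¹ = -(P - b) / (P * b) := by field_simp; ring
  rw [e1]
  refine (norm_add_le _ _).trans ?_
  rw [norm_mul, norm_mul, e2, norm_div, norm_neg, norm_mul, norm_inv, hnb]
  calc _ ≤ L * b / (κ * b * b) * M + b⁻¹ * (M * (2 * (L * b / (κ * b)))) := by
        gcongr
        · refine hdiff.trans ?_
          gcongr
          exact hτ.2
    _ = _ := by field_simp; ring

section kernel
variable (v : ℍ)

/-- With `X = w.re - v.re`, the distance to `v` is at least `(v.im - Y)/v.im` times `√(X² + (Im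
v)²)`, and the distance to `conj v` is at least that square root itself. -/
lemma norm_kerPoly_ge {w : ℂ} {Y : ℝ} (h0 : 0 ≤ w.im) (hY : w.im ≤ Y) (hv : Y < v.im) :
    (v.im - Y) / v.im * ((w.re - v.re) ^ 2 + v.im ^ 2) ≤ ‖kerPoly v w‖ := by
  have hy := v.im_pos
  set X := w.re - v.re with hX
  set κ := (v.im - Y) / v.im with hκ
  have hκ0 : 0 < κ := div_pos (by linarith) hy
  have hκ1 : κ ≤ 1 := by rw [hκ, div_le_one hy]; linarith
  have hκy : κ * v.im = v.im - Y := by rw [hκ]; field_simp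
  have hA : κ ^ 2 * (X ^ 2 + v.im ^ 2) ≤ ‖w - v‖ ^ 2 := by
    have : ‖w - v‖ ^ 2 = X ^ 2 + (w.im - v.im) ^ 2 := by
      rw [← Complex.normSq_eq_norm_sq, Complex.normSq_apply]; simp [hX]; ring
    rw [this, mul_add, ← mul_pow κ v.im, hκy]
    have h1 : κ ^ 2 * X ^ 2 ≤ X ^ 2 := mul_le_of_le_one_left (sq_nonneg _) (by nlinarith)
    have h2 : (v.im - Y) ^ 2 ≤ (w.im - v.im) ^ 2 := by nlinarith
    linarith
  have hB : X ^ 2 + v.im ^ 2 ≤ ‖w - starRingEnd ℂ (v : ℂ)‖ ^ 2 := by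
    have : ‖w - starRingEnd ℂ (v : ℂ)‖ ^ 2 = X ^ 2 + (w.im + v.im) ^ 2 := by
      rw [← Complex.normSq_eq_norm_sq, Complex.normSq_apply]; simp [hX]; ring
    rw [this]
    nlinarith
  rw [← pow_le_pow_iff_left₀ (by positivity) (norm_nonneg _) two_ne_zero, kerPoly, norm_mul,
    mul_pow, mul_pow]
  calc κ ^ 2 * (X ^ 2 + v.im ^ 2) ^ 2 = κ ^ 2 * (X ^ 2 + v.im ^ 2) * (X ^ 2 + v.im ^ 2) := by ring
    _ ≤ _ := by gcongr

lemma kerPoly_ne_zero {w : ℂ} (h0 : 0 ≤ w.im) (hv : w.im < v.im) : kerPoly v w ≠ 0 := by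
  refine norm_pos_iff.1 (lt_of_lt_of_le ?_ (norm_kerPoly_ge v h0 le_rfl hv))
  have := v.im_pos
  have : 0 < v.im - w.im := sub_pos.2 hv
  positivity

lemma le_norm_kerPoly {w : ℂ} {Y : ℝ} (h0 : 0 ≤ w.im) (hY : w.im ≤ Y) (hv : Y < v.im) :
    (v.im - Y) * v.im ≤ ‖kerPoly v w‖ := by
  refine le_trans ?_ (norm_kerPoly_ge v h0 hY hv)
  have hy := v.im_pos
  have : 0 < v.im - Y := sub_pos.2 hv
  calc (v.im - Y) * v.im = (v.im - Y) / v.im * v.im ^ 2 := by field_simp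
    _ ≤ _ := by gcongr; nlinarith [sq_nonneg (w.re - v.re)]

lemma norm_kerPow_kerPoly_le {Y B : ℝ} (hv : Y < v.im) {s : ℂ}
    (hB : ∀ D : ℝ, (v.im - Y) * v.im ≤ D → D ^ (-(2 * (s - 1)).re) ≤ B) {w : ℂ} (h0 : 0 ≤ w.im)
    (hY : w.im ≤ Y) (n : ℤ) : ‖kerPow s (kerPoly v (w + n))‖ ≤
      v.im / (v.im - Y) * B * ((w.re - v.re + n) ^ 2 + v.im ^ 2)⁻¹ := by
  have hy := v.im_pos
  have hd : 0 < v.im - Y := sub_pos.2 hv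
  have h0' : 0 ≤ (w + n).im := by simpa using h0
  have hY' : (w + n).im ≤ Y := by simpa using hY
  have h1 := norm_kerPoly_ge v h0' hY' hv
  have h2 := hB _ (le_norm_kerPoly v h0' hY' hv)
  have h3 : (w + n).re - v.re = w.re - v.re + n := by simp; ring
  rw [h3] at h1
  rw [norm_kerPow (kerPoly_ne_zero v h0' (hY'.trans_lt hv))]
  have hD : 0 < (w.re - v.re + n) ^ 2 + v.im ^ 2 := by positivity
  have hB0 : 0 ≤ B := (Real.rpow_nonneg (norm_nonneg _) _).trans h2
  calc _ ≤ ((v.im - Y) / v.im * ((w.re - v.re + n) ^ 2 + v.im ^ 2))⁻¹ * B := by gcongr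
    _ = _ := by field_simp

lemma rpow_neg_le_of_re {s : ℂ} (hs : 1 ≤ s.re) {ε : ℝ} (hε : 0 < ε) (D : ℝ) (hD : ε ≤ D) :
    D ^ (-(2 * (s - 1)).re) ≤ ε ^ (-(2 * (s - 1)).re) :=
  Real.rpow_le_rpow_of_nonpos hε hD (by simpa using hs)

lemma rpow_neg_le_of_nearOne {s : ℂ} (hs : s ∈ nearOne) {ε : ℝ} (hε : 0 < ε) (D : ℝ) (hD : ε ≤ D) :
    D ^ (-(2 * (s - 1)).re) ≤ 1 + (ε ^ 2)⁻¹ :=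
  have hτ := two_mul_sub_one_mem_expDomain hs
  rpow_neg_le_of_le hε hD hτ.1 (re_le_two_of_mem hτ)

lemma summable_norm_kerPow {s w : ℂ} (hs : 1 ≤ s.re) (h0 : 0 ≤ w.im) (hv : w.im < v.im) :
    Summable fun n : ℤ => ‖kerPow s (kerPoly v (w + n))‖ := by
  obtain ⟨C, -, h⟩ := exists_tsum_inv_sq_add_sq_le v.im_pos
  have hε : 0 < (v.im - w.im) * v.im := mul_pos (sub_pos.2 hv) v.im_pos
  exact Summable.of_nonneg_of_le (fun _ => norm_nonneg _)
    (norm_kerPow_kerPoly_le v hv (rpow_neg_le_of_re hs hε) h0 le_rfl)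
    ((h (w.re - v.re)).1.mul_left _)

lemma exists_tsum_norm_kerPow_le {s : ℂ} (hs : 1 ≤ s.re) {Y : ℝ} (hv : Y < v.im) :
    ∃ C : ℝ, 0 ≤ C ∧ ∀ w : ℂ, 0 ≤ w.im → w.im ≤ Y →
      ∑' n : ℤ, ‖kerPow s (kerPoly v (w + n))‖ ≤ C := by
  obtain ⟨C, hC, h⟩ := exists_tsum_inv_sq_add_sq_le v.im_pos
  have hy := v.im_pos
  have hd : 0 < v.im - Y := sub_pos.2 hv
  have hε : 0 < (v.im - Y) * v.im := by positivity
  refine ⟨v.im / (v.im - Y) * ((v.im - Y) * v.im) ^ (-(2 * (s - 1)).re) * C, by positivity,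
    fun w h0 hY => ?_⟩
  refine ((summable_norm_kerPow v hs h0 (hY.trans_lt hv)).tsum_le_tsum
    (norm_kerPow_kerPoly_le v hv (rpow_neg_le_of_re hs hε) h0 hY)
    ((h (w.re - v.re)).1.mul_left _)).trans ?_
  rw [tsum_mul_left]
  gcongr
  exact (h _).2

lemma tendsto_kerSum {w : ℂ} (h0 : 0 ≤ w.im) (hv : w.im < v.im) :
    Tendsto (fun s => kerSum v s w) toOne (𝓝 (kerSum v 1 w)) := by
  obtain ⟨C, -, h⟩ := exists_tsum_inv_sq_add_sq_le v.im_pos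
  have hε : 0 < (v.im - w.im) * v.im := mul_pos (sub_pos.2 hv) v.im_pos
  refine tendsto_tsum_of_dominated_convergence ((h (w.re - v.re)).1.mul_left _) (fun n => ?_)
    (eventually_nearOne.mono fun s hs n =>
      norm_kerPow_kerPoly_le v hv (rpow_neg_le_of_nearOne hs hε) h0 le_rfl n)
  exact tendsto_kerPow (kerPoly_ne_zero v (by simpa using h0) (by simpa using hv))

lemma kerPoly_ofReal (x : ℝ) : kerPoly v x = (((x - v.re) ^ 2 + v.im ^ 2 : ℝ) : ℂ) := by
  have h1 : (v : ℂ) = v.re + v.im * Complex.I := (Complex.re_add_im (v : ℂ)).symm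
  have h2 : starRingEnd ℂ (v : ℂ) = v.re - v.im * Complex.I := by
    rw [h1]; simp [sub_eq_add_neg]
  rw [kerPoly, h2, h1]
  push_cast
  linear_combination -(v.im : ℂ) ^ 2 * Complex.I_sq

lemma norm_kerPow_kerPoly_sub_le {Y R ε κ Q S : ℝ} (hY0 : 0 ≤ Y) (hv : Y < v.im)
    (hκ : κ = (v.im - Y) / v.im) (hε : ε = (v.im - Y) * v.im) (hQ : Q = 2 + 2 * R ^ 2 / v.im ^ 2)
    (hS : S = (R + 1) / v.im ^ 2 + 1) {s w : ℂ} {x : ℝ} (hs : s ∈ nearOne) (h0 : 0 ≤ w.im)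
    (hY : w.im ≤ Y) (hR : ‖w - x‖ ≤ R) (n : ℤ) :
    ‖kerPow s (kerPoly v (w + n)) - kerPow s (kerPoly v (x + n))‖ ≤
      3 * (1 + (ε ^ 2)⁻¹) / (κ / Q) * (S * ‖w - x‖) * ((x - v.re + n) ^ 2 + v.im ^ 2)⁻¹ := by
  have hy := v.im_pos
  have hd : 0 < v.im - Y := sub_pos.2 hv
  have hR0 : 0 ≤ R := (norm_nonneg _).trans hR
  have hκ0 : 0 < κ := by rw [hκ]; positivity
  have hκ1 : κ ≤ 1 := by rw [hκ, div_le_one hy]; linarith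
  have hε0 : 0 < ε := by rw [hε]; positivity
  have hεy : ε ≤ v.im ^ 2 := by rw [hε, pow_two]; gcongr; linarith
  have hQ0 : 0 ≤ 2 * R ^ 2 / v.im ^ 2 := by positivity
  have hQ1 : 1 ≤ Q := by rw [hQ]; linarith
  have h0' : 0 ≤ (w + n).im := by simpa using h0
  have hY' : (w + n).im ≤ Y := by simpa using hY
  have h1 := norm_kerPoly_ge v h0' hY' hv
  have h2 := le_norm_kerPoly v h0' hY' hv
  have h3 : (w + n).re - v.re = w.re - v.re + n := by simp; ring
  rw [h3, ← hκ] at h1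
  rw [← hε] at h2
  obtain ⟨X, hX⟩ : ∃ X : ℝ, X = x - v.re + n := ⟨_, rfl⟩
  obtain ⟨b, hb⟩ : ∃ b : ℝ, b = X ^ 2 + v.im ^ 2 := ⟨_, rfl⟩
  have hb0 : 0 < b := by rw [hb]; positivity
  have hbx : kerPoly v (x + n) = (b : ℂ) := by
    have := kerPoly_ofReal v (x + n)
    rw [show x + (n : ℝ) - v.re = X by rw [hX]; ring, ← hb] at this
    rw [← this]
    push_cast
    rfl
  have hwx : |w.re - x| ≤ R := by
    have := (Complex.abs_re_le_norm (w - x)).trans hR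
    simpa using this
  -- The denominators at `w` and at `x` are comparable because the real parts differ by at most `R`;
  -- `Q` comes from `X² ≤ 2W² + 2R²`.
  have hbw : b ≤ Q * ((w.re - v.re + n) ^ 2 + v.im ^ 2) := by
    obtain ⟨W, hW⟩ : ∃ W : ℝ, W = w.re - v.re + n := ⟨_, rfl⟩
    have hXW : X = W - (w.re - x) := by rw [hX, hW]; ring
    have hsq : (w.re - x) ^ 2 ≤ R ^ 2 := by rw [← sq_abs]; gcongr
    have e1 : Q * (W ^ 2 + v.im ^ 2) = 2 * W ^ 2 + 2 * v.im ^ 2 + 2 * R ^ 2 +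
        2 * R ^ 2 / v.im ^ 2 * W ^ 2 := by
      rw [hQ]; field_simp; ring
    have e2 : 0 ≤ 2 * R ^ 2 / v.im ^ 2 * W ^ 2 := by positivity
    rw [← hW, e1, hb, hXW]
    nlinarith [sq_nonneg (W + (w.re - x)), sq_nonneg v.im]
  have hκP : κ / Q * b ≤ ‖kerPoly v (w + n)‖ := by
    refine le_trans ?_ h1
    rw [div_mul_eq_mul_div, div_le_iff₀ (by positivity), mul_assoc, mul_comm _ Q]
    gcongr
  have hL : ‖kerPoly v (w + n) - b‖ ≤ S * ‖w - x‖ * b := by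
    -- For real `b = kerPoly v (x + n)` the difference is linear in `w - x`, with a cofactor that
    -- grows only linearly in `X` and is absorbed by `S b`.
    have e1 : kerPoly v (w + n) - b = (w - x) * ((w - x) + 2 * (X : ℂ)) := by
      rw [← hbx, kerPoly, kerPoly, hX]
      have : (v : ℂ) + starRingEnd ℂ (v : ℂ) = 2 * v.re := by
        rw [Complex.add_conj]; push_cast; rfl
      push_cast
      linear_combination -(w - x) * this
    have e2 : ‖(w - x) + 2 * (X : ℂ)‖ ≤ S * b := by
      refine (norm_add_le _ _).trans ?_
      rw [norm_mul, Complex.norm_ofNat, Complex.norm_real, Real.norm_eq_abs]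
      have e3 : S * b = (R + 1) + (R + 1) / v.im ^ 2 * X ^ 2 + (X ^ 2 + v.im ^ 2) := by
        rw [hS, hb]; field_simp; ring
      have e4 : 0 ≤ (R + 1) / v.im ^ 2 * X ^ 2 := by positivity
      rw [e3]
      have e5 : 2 * |X| ≤ 1 + X ^ 2 := by nlinarith [sq_nonneg (|X| - 1), sq_abs X]
      linarith [sq_nonneg v.im]
    rw [e1, norm_mul]
    calc _ ≤ ‖w - x‖ * (S * b) := by gcongr
      _ = _ := by ring
  have hκQ : κ / Q ≤ 1 := by
    rw [div_le_one (by positivity)]; linarith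
  have hεb : ε ≤ b := hεy.trans (by rw [hb]; exact le_add_of_nonneg_left (sq_nonneg X))
  have hfin := norm_kerPow_sub_le hs hε0 h2 hεb (by positivity) hκQ hκP hL
  rw [hbx, ← hX, ← hb]
  refine hfin.trans (le_of_eq ?_)
  rw [div_eq_mul_inv _ b]

lemma exists_norm_kerSum_sub_le {Y : ℝ} (hY0 : 0 ≤ Y) (hv : Y < v.im) {R : ℝ} (hR0 : 0 ≤ R) :
    ∃ C : ℝ, 0 ≤ C ∧ ∀ (s w : ℂ) (x : ℝ), s ∈ nearOne → 0 ≤ w.im → w.im ≤ Y → ‖w - x‖ ≤ R →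
      ‖kerSum v s w - kerSum v s x‖ ≤ C * ‖w - x‖ := by
  obtain ⟨C, hC, h⟩ := exists_tsum_inv_sq_add_sq_le v.im_pos
  have hy := v.im_pos
  have hd : 0 < v.im - Y := sub_pos.2 hv
  obtain ⟨B, hB⟩ : ∃ B : ℝ, B = 3 * (1 + (((v.im - Y) * v.im) ^ 2)⁻¹) / ((v.im - Y) / v.im /
    (2 + 2 * R ^ 2 / v.im ^ 2)) := ⟨_, rfl⟩
  obtain ⟨S, hS⟩ : ∃ S : ℝ, S = (R + 1) / v.im ^ 2 + 1 := ⟨_, rfl⟩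
  have hB0 : 0 ≤ B := by rw [hB]; positivity
  have hS0 : 0 ≤ S := by rw [hS]; positivity
  refine ⟨B * S * C, by positivity, fun s w x hs h0 hY hR => ?_⟩
  have hsw := (summable_norm_kerPow v hs.1 h0 (hY.trans_lt hv)).of_norm
  have hsx := (summable_norm_kerPow v (w := x) hs.1 (by simp) (by simpa using hy)).of_norm
  have hterm : ∀ n : ℤ, ‖kerPow s (kerPoly v (w + n)) - kerPow s (kerPoly v (x + n))‖ ≤
      B * (S * ‖w - x‖) * ((x - v.re + n) ^ 2 + v.im ^ 2)⁻¹ := by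
    intro n
    rw [hB]
    exact norm_kerPow_kerPoly_sub_le v hY0 hv rfl rfl rfl hS hs h0 hY hR n
  have hfin := tsum_of_norm_bounded ((h (x - v.re)).1.mul_left _).hasSum hterm
  rw [hsw.tsum_sub hsx, tsum_mul_left] at hfin
  refine hfin.trans ?_
  calc _ ≤ B * (S * ‖w - x‖) * C := by
        gcongr
        exact (h _).2
    _ = _ := by ring

lemma kerSum_ofReal {s : ℂ} (hs : s ∈ nearOne) (x : ℝ) : kerSum v s x =
    ∑' r : ℤ, lineFourier v.im (-1) (-1) (2 * (s - 1)) r * fexp r ((x - v.re : ℝ) : ℂ) := by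
  have h := tsum_lineKernel_add_int v.im_pos (i := -1) (j := -1) (by norm_num)
    (two_mul_sub_one_mem_expDomain hs) (x - v.re)
  rw [kerSum]
  refine Eq.trans (tsum_congr fun n => ?_) h
  have hb : 0 < (x - v.re + n) ^ 2 + v.im ^ 2 := by have := v.im_pos; positivity
  have h1 := kerPoly_ofReal v (x + n)
  rw [show x + (n : ℝ) - v.re = x - v.re + n by ring] at h1
  have hbne : (((x - v.re + n) ^ 2 + v.im ^ 2 : ℝ) : ℂ) ≠ 0 := by exact_mod_cast hb.ne'
  rw [show (x : ℂ) + n = ((x + n : ℝ) : ℂ) by push_cast; rfl, h1, kerPow_eq hbne, lineKernel,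
    Complex.norm_real, Real.norm_of_nonneg hb.le, zpow_neg_one, zpow_neg_one, ← mul_inv,
    add_mul_sub_I]
  push_cast
  rfl

/-! ### Cotangent expansion of the periodized kernel at `s = 1`. -/

lemma tsum_pnat_cot (c : ℍ) :
    1 / (c : ℂ) + ∑' n : ℕ+, (1 / ((c : ℂ) - n) + 1 / ((c : ℂ) + n)) =
      Real.pi * Complex.I - 2 * Real.pi * Complex.I *
        (1 + ∑' m : ℕ+, exp (2 * Real.pi * Complex.I * c) ^ (m : ℕ)) := by
  have hgeo := tsum_zero_pnat_eq_tsum_nat (f := fun n => exp (2 * Real.pi * Complex.I * c) ^ n)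
    (summable_geometric_of_norm_lt_one (UpperHalfPlane.norm_exp_two_pi_I_lt_one c))
  rw [pow_zero] at hgeo
  rw [← cot_series_rep c.coe_mem_integerComplement, pi_mul_cot_pi_q_exp, hgeo]

lemma summable_pnat_cot (c : ℍ) :
    Summable fun n : ℕ+ => 1 / ((c : ℂ) - n) + 1 / ((c : ℂ) + n) := by
  have h := summable_cotTerm c.coe_mem_integerComplement
  refine (summable_pnat_iff_summable_succ
    (f := fun n : ℕ => 1 / ((c : ℂ) - n) + 1 / ((c : ℂ) + n))).2 (h.congr fun n => ?_)
  rw [cotTerm]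
  push_cast
  rfl

/-- The two halves do not converge separately over `ℤ`. Pairing `n` with `-n` makes each a cotangent
series, and the two constants `πi` together with the leading ones combine to a single constant term.
-/
lemma tsum_int_eq_cot_add_cot (a b : ℍ)
    (hs : Summable fun n : ℤ => 1 / ((a : ℂ) - n) + 1 / ((b : ℂ) + n)) :
    ∑' n : ℤ, (1 / ((a : ℂ) - n) + 1 / ((b : ℂ) + n)) =
      -(2 * Real.pi * Complex.I) * (1 + ∑' m : ℕ+, exp (2 * Real.pi * Complex.I * a) ^ (m : ℕ) +
        ∑' m : ℕ+, exp (2 * Real.pi * Complex.I * b) ^ (m : ℕ)) := by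
  have hp := summable_pnat_iff_summable_nat.mpr (summable_int_iff_summable_nat_and_neg.mp hs).1
  have hn := summable_pnat_iff_summable_nat.mpr (summable_int_iff_summable_nat_and_neg.mp hs).2
  have h1 := (hp.tsum_add hn).symm.trans ((tsum_congr fun n => ?_).trans
    ((summable_pnat_cot a).tsum_add (summable_pnat_cot b)))
  · rw [tsum_int_eq_zero_add_tsum_pnat hs, add_assoc]
    refine (congrArg _ h1).trans ?_
    have ha := tsum_pnat_cot a
    have hb := tsum_pnat_cot b
    rw [Int.cast_zero, sub_zero, add_zero]
    linear_combination ha + hb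
  · push_cast
    ring

/-- Partial fractions in `w + n`, with `v - w` and `w - conj v` both in the upper half-plane: the
first needs `Im w < Im v`, and this is where the hypothesis on `z₂` enters the expansion. -/
lemma kerSum_one {w : ℂ} (h0 : 0 ≤ w.im) (hv : w.im < v.im) :
    kerSum v 1 w = 2 * Real.pi * Complex.I / ((v : ℂ) - starRingEnd ℂ (v : ℂ)) *
      (1 + ∑' m : ℕ+, exp (2 * Real.pi * Complex.I * (v - w)) ^ (m : ℕ) +
        ∑' m : ℕ+, exp (2 * Real.pi * Complex.I * (w - starRingEnd ℂ (v : ℂ))) ^ (m : ℕ)) := by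
  have hy := v.im_pos
  let a : ℍ := ⟨v - w, by simpa using hv⟩
  let b : ℍ := ⟨w - starRingEnd ℂ (v : ℂ), by simp; linarith⟩
  have hvv : (v : ℂ) - starRingEnd ℂ (v : ℂ) ≠ 0 := by
    rw [Complex.sub_conj]
    simp [hy.ne']
  have hterm : ∀ n : ℤ, kerPow 1 (kerPoly v (w + n)) =
      -(1 / ((v : ℂ) - starRingEnd ℂ (v : ℂ))) * (1 / ((a : ℂ) - n) + 1 / ((b : ℂ) + n)) := by
    intro n
    have hne := kerPoly_ne_zero v (w := w + n) (by simpa using h0) (by simpa using hv)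
    rw [kerPow_one hne]
    rw [kerPoly] at hne ⊢
    have h1 := left_ne_zero_of_mul hne
    have h2 := right_ne_zero_of_mul hne
    have h3 : (a : ℂ) - n = -(w + n - v) := by change (v : ℂ) - w - n = _; ring
    have h4 : (b : ℂ) + n = w + n - starRingEnd ℂ (v : ℂ) := by
      change w - starRingEnd ℂ (v : ℂ) + n = _; ring
    rw [h3, h4]
    field_simp
    ring
  have hs : Summable fun n : ℤ => 1 / ((a : ℂ) - n) + 1 / ((b : ℂ) + n) := by
    have := (summable_norm_kerPow v (s := 1) (by simp) h0 hv).of_norm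
    simp_rw [hterm] at this
    rwa [summable_mul_left_iff (by simpa using hvv)] at this
  have hfin := tsum_int_eq_cot_add_cot a b hs
  rw [kerSum, tsum_congr hterm, tsum_mul_left, hfin]
  change _ = 2 * Real.pi * Complex.I / ((v : ℂ) - starRingEnd ℂ (v : ℂ)) *
      (1 + ∑' m : ℕ+, exp (2 * Real.pi * Complex.I * (a : ℂ)) ^ (m : ℕ) +
        ∑' m : ℕ+, exp (2 * Real.pi * Complex.I * (b : ℂ)) ^ (m : ℕ))
  ring

end kernel

/-! ### Generating series of the twists -/

section generating
variable {N : ℕ} [NeZero N] {z : ℍ} {Y y : ℝ}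

lemma norm_fexp_mul_le {κ : ℕ+ → ℤ} {a : ℕ+ → ℂ} (hκ : ∀ m, |κ m| = m)
    (ha : ∀ m : ℕ+, ‖a m‖ = Real.exp (-2 * Real.pi * y * m)) {w : ℂ} (h0 : 0 ≤ w.im)
    (hw : w.im ≤ Y) (m : ℕ+) :
    ‖fexp (κ m) w * a m‖ ≤ Real.exp (-2 * Real.pi * (y - Y) * m) := by
  have hm : |(κ m : ℝ)| = (m : ℕ) := by
    rw [← Int.cast_abs, hκ]; simp
  have h := norm_fexp_le (m := κ m) h0 hw
  rw [hm] at h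
  rw [norm_mul, ha]
  calc _ ≤ Real.exp (2 * Real.pi * (m : ℕ) * Y) * Real.exp (-2 * Real.pi * y * m) := by gcongr
    _ = _ := by rw [← Real.exp_add]; congr 1; ring

lemma summable_exp_pnat (h : Y < y) :
    Summable fun m : ℕ+ => Real.exp (-2 * Real.pi * (y - Y) * m) := by
  simpa using summable_pnat_pow_mul_exp 0 (sub_pos.2 h)

lemma summable_twistSum_mul {κ : ℕ+ → ℤ} {a : ℕ+ → ℂ} (hκ : ∀ m, |κ m| = m)
    (ha : ∀ m : ℕ+, ‖a m‖ = Real.exp (-2 * Real.pi * y * m)) (hYy : Y < y) (hzY : z.im ≤ Y)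
    (hY : ∀ i : CuspIdx N, (i.mat • z).im ≤ Y) {s : ℂ} (hs : 1 < s.re) :
    Summable fun m : ℕ+ => twistSum N (κ m) z s * a m := by
  refine Summable.of_norm_bounded ((summable_exp_pnat hYy).mul_left
    (1 + ∑' i : CuspIdx N, ‖eisTerm z s i.mat‖)) fun m => ?_
  have hm : |(κ m : ℝ)| = (m : ℕ) := by
    rw [← Int.cast_abs, hκ]; simp
  have h := norm_twistSum_le hzY hY (κ m) hs
  rw [hm] at h
  rw [norm_mul, ha]
  calc _ ≤ (1 + ∑' i : CuspIdx N, ‖eisTerm z s i.mat‖) * Real.exp (2 * Real.pi * (m : ℕ) * Y) *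
        Real.exp (-2 * Real.pi * y * m) := by gcongr
    _ = _ := by rw [mul_assoc, ← Real.exp_add]; congr 2; ring

lemma summable_fexp_mul {κ : ℕ+ → ℤ} {a : ℕ+ → ℂ} (hκ : ∀ m, |κ m| = m)
    (ha : ∀ m : ℕ+, ‖a m‖ = Real.exp (-2 * Real.pi * y * m)) (hYy : Y < y) {w : ℂ} (h0 : 0 ≤ w.im)
    (hw : w.im ≤ Y) : Summable fun m : ℕ+ => fexp (κ m) w * a m :=
  Summable.of_norm_bounded (summable_exp_pnat hYy) (norm_fexp_mul_le hκ ha h0 hw)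

/-- Fubini for `Re s > 1`: each product `e(κ_m γz) a_m` is at most `e^(-2π(y-Y)m)`, uniformly in
`γ`. The data `κ`, `a` allow both signs, so the `q`-series and the conjugate one are handled at
once. -/
lemma tsum_twistSum_mul {κ : ℕ+ → ℤ} {a : ℕ+ → ℂ} (hκ : ∀ m, |κ m| = m)
    (ha : ∀ m : ℕ+, ‖a m‖ = Real.exp (-2 * Real.pi * y * m)) (hYy : Y < y) (hzY : z.im ≤ Y)
    (hY : ∀ i : CuspIdx N, (i.mat • z).im ≤ Y) {s : ℂ} (hs : 1 < s.re) :
    ∑' m : ℕ+, twistSum N (κ m) z s * a m = ∑' m : ℕ+, fexp (κ m) z * a m +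
      ∑' i : CuspIdx N, eisTerm z s i.mat *
        ∑' m : ℕ+, fexp (κ m) ((i.mat • z : ℍ) : ℂ) * a m := by
  have hd : Summable fun x : CuspIdx N × ℕ+ =>
      eisTerm z s x.1.mat * (fexp (κ x.2) ((x.1.mat • z : ℍ) : ℂ) * a x.2) := by
    refine Summable.of_norm_bounded ((summable_norm_eisTerm (N := N) z hs).mul_of_nonneg
      (summable_exp_pnat hYy) (fun _ => norm_nonneg _) (fun _ => (Real.exp_pos _).le)) fun x => ?_
    rw [norm_mul]
    gcongr
    exact norm_fexp_mul_le hκ ha (x.1.mat • z).im_pos.le (hY x.1) x.2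
  have h1 : ∀ m : ℕ+, twistSum N (κ m) z s * a m = fexp (κ m) z * a m +
      ∑' i : CuspIdx N, eisTerm z s i.mat * (fexp (κ m) ((i.mat • z : ℍ) : ℂ) * a m) := by
    intro m
    rw [twistSum, add_mul, ← tsum_mul_right]
    congr 1
    refine tsum_congr fun i => ?_
    rw [twistTerm]
    ring
  have hd2 : Summable fun m : ℕ+ => ∑' i : CuspIdx N,
      eisTerm z s i.mat * (fexp (κ m) ((i.mat • z : ℍ) : ℂ) * a m) := hd.prod_symm.prod
  rw [tsum_congr h1, (summable_fexp_mul hκ ha hYy z.im_pos.le hzY).tsum_add hd2]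
  congr 1
  refine (Summable.tsum_comm (f := fun (i : CuspIdx N) (m : ℕ+) =>
    eisTerm z s i.mat * (fexp (κ m) ((i.mat • z : ℍ) : ℂ) * a m)) hd).trans ?_
  exact tsum_congr fun i => tsum_mul_left

lemma summable_twistLim_mul {κ : ℕ+ → ℤ} {a : ℕ+ → ℂ} (hκ : ∀ m, |κ m| = m)
    (ha : ∀ m : ℕ+, ‖a m‖ = Real.exp (-2 * Real.pi * y * m)) (hYy : Y < y) (hY0 : 0 < Y)
    (hY : ∀ i : CuspIdx N, (i.mat • z).im ≤ Y) :
    Summable fun m : ℕ+ => twistLim N (κ m) z * a m := by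
  obtain ⟨C, hC, h⟩ := exists_norm_rem_add_reg_le hY0 hY
  refine Summable.of_norm_bounded (((summable_exp_pnat hYy).add
    (summable_pnat_pow_mul_exp 1 (sub_pos.2 hYy))).mul_left C) fun m => ?_
  have hm : |(κ m : ℝ)| = (m : ℕ) := by
    rw [← Int.cast_abs, hκ]; simp
  have hm0 : κ m ≠ 0 := by
    intro h0
    have := hκ m
    rw [h0, abs_zero] at this
    exact m.pos.ne (by exact_mod_cast this)
  have h1 := h (κ m) 1 one_mem_nearOne
  rw [hm] at h1
  rw [twistLim, if_neg hm0, add_zero, norm_mul, ha]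
  calc _ ≤ C * ((1 + (m : ℕ)) * Real.exp (2 * Real.pi * (m : ℕ) * Y)) *
        Real.exp (-2 * Real.pi * y * m) := by gcongr
    _ = C * ((1 + (m : ℕ)) * (Real.exp (2 * Real.pi * (m : ℕ) * Y) *
        Real.exp (-2 * Real.pi * y * m))) := by ring
    _ = _ := by
      rw [← Real.exp_add, show 2 * Real.pi * (m : ℕ) * Y + -2 * Real.pi * y * (m : ℕ) =
        -2 * Real.pi * (y - Y) * (m : ℕ) by ring]
      ring

/-- Dominated convergence over `m`. The domination has to come from the split form of the twists,
since the absolute bound by Eisenstein terms is not uniform as `s → 1`. -/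
lemma tendsto_tsum_twistSum_mul {κ : ℕ+ → ℤ} {a : ℕ+ → ℂ} (hκ : ∀ m, |κ m| = m)
    (ha : ∀ m : ℕ+, ‖a m‖ = Real.exp (-2 * Real.pi * y * m)) (hYy : Y < y) (hY0 : 0 < Y)
    (hzY : z.im ≤ Y) (hY : ∀ i : CuspIdx N, (i.mat • z).im ≤ Y) :
    Tendsto (fun s => ∑' m : ℕ+, twistSum N (κ m) z s * a m) toOne
      (𝓝 (∑' m : ℕ+, fexp (κ m) z * a m + ∑' m : ℕ+, twistLim N (κ m) z * a m)) := by
  obtain ⟨C, hC, h⟩ := exists_norm_rem_add_reg_le hY0 hY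
  rw [← (summable_fexp_mul hκ ha hYy z.im_pos.le hzY).tsum_add
    (summable_twistLim_mul hκ ha hYy hY0 hY)]
  refine tendsto_tsum_of_dominated_convergence (((summable_exp_pnat hYy).add (((summable_exp_pnat
    hYy).add (summable_pnat_pow_mul_exp 1 (sub_pos.2 hYy))).mul_left C))) (fun m => ?_) ?_
  · rw [← add_mul]
    exact (tendsto_twistSum (κ m) z).mul_const _
  · filter_upwards [eventually_toOne] with s hs m
    have hm : |(κ m : ℝ)| = (m : ℕ) := by
      rw [← Int.cast_abs, hκ]; simp
    have hm0 : κ m ≠ 0 := by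
      intro h0
      have := hκ m
      rw [h0, abs_zero] at this
      exact m.pos.ne (by exact_mod_cast this)
    have h1 := h (κ m) s ⟨hs.1.le, hs.2⟩
    rw [hm] at h1
    rw [twistSum_eq (κ m) z ⟨hs.1.le, hs.2⟩ hs.1, if_neg hm0, add_zero, add_mul]
    refine (norm_add_le _ _).trans (add_le_add
      (norm_fexp_mul_le hκ ha z.im_pos.le hzY m) ?_)
    rw [norm_mul, ha]
    calc _ ≤ C * ((1 + (m : ℕ)) * Real.exp (2 * Real.pi * (m : ℕ) * Y)) *
          Real.exp (-2 * Real.pi * y * m) := by gcongr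
      _ = C * ((1 + (m : ℕ)) * (Real.exp (2 * Real.pi * (m : ℕ) * Y) *
          Real.exp (-2 * Real.pi * y * m))) := by ring
      _ = _ := by
        rw [← Real.exp_add, show 2 * Real.pi * (m : ℕ) * Y + -2 * Real.pi * y * (m : ℕ) =
          -2 * Real.pi * (y - Y) * (m : ℕ) by ring]
        ring

end generating

/-! ### The kernel through the periodization -/

section xi
variable {N : ℕ} [NeZero N] {z v : ℍ} {Y : ℝ}

lemma xiTerm_T_zpow_mul_rep (s : ℂ) (x : Bool × Option (CuspIdx N)) (n : ℤ) :
    xiTerm z v s (ModularGroup.T ^ n * rep N x) = eisTerm z (2 * s - 1) (repMat N x.2) *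
      kerPow s (kerPoly v (((repMat N x.2 • z : ℍ) : ℂ) + n)) := by
  have h1 : eisTerm z (2 * s - 1) (rep N x) = eisTerm z (2 * s - 1) (repMat N x.2) := by
    obtain ⟨b, o⟩ := x
    cases b <;> simp [rep, eisTerm_neg]
  have h2 : rep N x • z = repMat N x.2 • z := by
    obtain ⟨b, o⟩ := x
    cases b
    · exact ModularGroup.SL_neg_smul _ _
    · rfl
  rw [xiTerm_eq, mul_smul, ModularGroup.coe_T_zpow_smul_eq, h2, ← h1, eisTerm, eisTerm,
    autom_T_zpow_mul]

lemma im_repMat_smul_le (hzY : z.im ≤ Y) (hY : ∀ i : CuspIdx N, (i.mat • z).im ≤ Y)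
    (o : Option (CuspIdx N)) : (((repMat N o • z : ℍ) : ℂ)).im ≤ Y := by
  cases o with
  | none => simpa [repMat] using hzY
  | some i => exact hY i

lemma re_two_mul_sub_one {s : ℂ} (hs : 1 < s.re) : 1 < (2 * s - 1).re := by
  simp; linarith

lemma summable_norm_eisTerm_rep {s : ℂ} (hs : 1 < s.re) :
    Summable fun x : Bool × Option (CuspIdx N) => ‖eisTerm z s (repMat N x.2)‖ := by
  rw [← Complex.summable_ofReal]
  have h := (Complex.summable_ofReal.2 (summable_norm_eisTerm (N := N) z hs)).hasSum
  exact (hasSum_bool_prod fun b => hasSum_option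
    (f := fun o => ((‖eisTerm z s (repMat N o)‖ : ℝ) : ℂ)) h).summable

lemma summable_xiTerm_rep (hYv : Y < v.im) (hzY : z.im ≤ Y)
    (hY : ∀ i : CuspIdx N, (i.mat • z).im ≤ Y) {s : ℂ} (hs : 1 < s.re) :
    Summable fun x : (Bool × Option (CuspIdx N)) × ℤ =>
      xiTerm z v s (ModularGroup.T ^ x.2 * rep N x.1) := by
  obtain ⟨C, hC, h⟩ := exists_tsum_norm_kerPow_le v hs.le hYv
  have hI := fun x : Bool × Option (CuspIdx N) => im_repMat_smul_le hzY hY x.2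
  have hI0 := fun x : Bool × Option (CuspIdx N) => (repMat N x.2 • z).im_pos.le
  simp_rw [xiTerm_T_zpow_mul_rep]
  refine Summable.of_norm ?_
  rw [summable_prod_of_nonneg fun _ => norm_nonneg _]
  simp_rw [norm_mul, tsum_mul_left]
  refine ⟨fun x => (summable_norm_kerPow v hs.le (hI0 x) ((hI x).trans_lt hYv)).mul_left _, ?_⟩
  refine Summable.of_nonneg_of_le (fun x => mul_nonneg (norm_nonneg _)
    (tsum_nonneg fun _ => norm_nonneg _)) (fun x => ?_)
    ((summable_norm_eisTerm_rep (z := z) (re_two_mul_sub_one hs)).mul_right C)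
  gcongr
  exact h _ (hI0 x) (hI x)

lemma summable_xiTerm (hYv : Y < v.im) (hzY : z.im ≤ Y)
    (hY : ∀ i : CuspIdx N, (i.mat • z).im ≤ Y) {s : ℂ} (hs : 1 < s.re) :
    Summable fun γ : CongruenceSubgroup.Gamma0 N => xiTerm z v s γ := by
  rw [← (gammaEquiv N).summable_iff]
  exact summable_xiTerm_rep hYv hzY hY hs

lemma exists_norm_kerSum_le {s : ℂ} (hs : 1 ≤ s.re) (hYv : Y < v.im) :
    ∃ C : ℝ, 0 ≤ C ∧ ∀ w : ℂ, 0 ≤ w.im → w.im ≤ Y → ‖kerSum v s w‖ ≤ C := by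
  obtain ⟨C, hC, h⟩ := exists_tsum_norm_kerPow_le v hs hYv
  exact ⟨C, hC, fun w h0 hw => (norm_tsum_le_tsum_norm
    (summable_norm_kerPow v hs h0 (hw.trans_lt hYv))).trans (h w h0 hw)⟩

lemma summable_eisTerm_mul {s : ℂ} (hs : 1 < s.re) {g : CuspIdx N → ℂ} {C : ℝ}
    (hg : ∀ i, ‖g i‖ ≤ C) : Summable fun i : CuspIdx N => eisTerm z s i.mat * g i := by
  refine Summable.of_norm_bounded ((summable_norm_eisTerm z hs).mul_right C) fun i => ?_
  rw [norm_mul]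
  gcongr
  exact hg i

lemma tsum_bool_option {α : Type*} {g : Option α → ℂ} (hg : Summable fun i => g (some i)) :
    ∑' x : Bool × Option α, g x.2 = 2 * (g none + ∑' i, g (some i)) :=
  (hasSum_bool_prod (f := fun x : Bool × Option α => g x.2)
    fun _ => hasSum_option hg.hasSum).tsum_eq

/-- The sum over `n` in `T^n γ` periodizes the kernel, and the two signs cancel the factor `1/2`. -/
lemma xiSeries_eq (hYv : Y < v.im) (hzY : z.im ≤ Y)
    (hY : ∀ i : CuspIdx N, (i.mat • z).im ≤ Y) {s : ℂ} (hs : 1 < s.re) :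
    xiSeries N z v s = kerSum v s z +
      ∑' i : CuspIdx N, eisTerm z (2 * s - 1) i.mat * kerSum v s ((i.mat • z : ℍ) : ℂ) := by
  obtain ⟨C, hC, h⟩ := exists_norm_kerSum_le (v := v) hs.le hYv
  have hsum := summable_xiTerm_rep hYv hzY hY hs
  have h1 : ∀ x : Bool × Option (CuspIdx N),
      ∑' n : ℤ, xiTerm z v s (ModularGroup.T ^ n * rep N x) =
        eisTerm z (2 * s - 1) (repMat N x.2) * kerSum v s ((repMat N x.2 • z : ℍ) : ℂ) := by
    intro x
    simp_rw [xiTerm_T_zpow_mul_rep]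
    rw [tsum_mul_left, kerSum]
  have h2 : Summable fun i : CuspIdx N =>
      eisTerm z (2 * s - 1) i.mat * kerSum v s ((i.mat • z : ℍ) : ℂ) :=
    summable_eisTerm_mul (re_two_mul_sub_one hs) fun i => h _ (i.mat • z).im_pos.le (hY i)
  have h3 := tsum_bool_option (g := fun o : Option (CuspIdx N) =>
    eisTerm z (2 * s - 1) (repMat N o) * kerSum v s ((repMat N o • z : ℍ) : ℂ)) h2
  have h4 := (gammaEquiv N).tsum_eq fun γ : CongruenceSubgroup.Gamma0 N => xiTerm z v s γ
  have h5 : repMat N (none : Option (CuspIdx N)) = 1 := rfl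
  rw [xiSeries, ← h4]
  refine (congrArg _ (hsum.tsum_prod.trans ((tsum_congr h1).trans h3))).trans ?_
  rw [h5, one_smul, eisTerm_one, one_mul, ← mul_assoc, one_div, inv_mul_cancel₀ two_ne_zero,
    one_mul]
  rfl

/-! ### Passing from the periodized kernel at `s` to the one at `1`. -/

/-- The Lipschitz part of the difference of the kernel from its value at `s = 1`. -/
def lipPart (z v : ℍ) (s : ℂ) (i : CuspIdx N) : ℂ :=
  (kerSum v s ((i.mat • z : ℍ) : ℂ) - kerSum v s ((i.a / i.c : ℝ) : ℂ)) -
    (kerSum v 1 ((i.mat • z : ℍ) : ℂ) - kerSum v 1 ((i.a / i.c : ℝ) : ℂ))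

/-- The periodized kernel is Lipschitz near the real line uniformly in `s`, and `γz` is within
`1/|j|` of `a/c`. -/
lemma exists_norm_lipPart_le (hY0 : 0 < Y) (hYv : Y < v.im)
    (hY : ∀ i : CuspIdx N, (i.mat • z).im ≤ Y) : ∃ C : ℝ, 0 ≤ C ∧
      ∀ s ∈ nearOne, ∀ i : CuspIdx N, ‖lipPart z v s i‖ ≤ C * ‖autom i.mat z‖⁻¹ := by
  obtain ⟨C, hC, h⟩ := exists_norm_kerSum_sub_le v hY0.le hYv (R := z.im⁻¹)
    (inv_nonneg.2 z.im_pos.le)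
  refine ⟨2 * C, by positivity, fun s hs i => ?_⟩
  have h1 := norm_smul_sub_le i z
  have h2 := h1.trans (inv_anti₀ z.im_pos (im_le_norm_autom i z))
  have h3 := h s _ _ hs (i.mat • z).im_pos.le (hY i) h2
  have h4 := h 1 _ _ one_mem_nearOne (i.mat • z).im_pos.le (hY i) h2
  refine (norm_sub_le _ _).trans ((add_le_add h3 h4).trans ?_)
  rw [← two_mul, ← mul_assoc]
  gcongr

lemma tendsto_tsum_lipPart (hY0 : 0 < Y) (hYv : Y < v.im)
    (hY : ∀ i : CuspIdx N, (i.mat • z).im ≤ Y) :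
    Tendsto (fun s => ∑' i : CuspIdx N, eisTerm z (2 * s - 1) i.mat * lipPart z v s i) toOne
      (𝓝 0) := by
  obtain ⟨C, hC, h⟩ := exists_norm_lipPart_le (v := v) hY0 hYv hY
  have hB := eisBound_nonneg z
  rw [← tsum_zero (α := ℂ) (β := CuspIdx N)]
  refine tendsto_tsum_of_dominated_convergence ((summable_norm_autom (N := N) z (σ := 3)
    (by norm_num)).mul_left (eisBound z * C)) (fun i => ?_) ?_
  · have h1 := tendsto_kerSum v (w := ((i.mat • z : ℍ) : ℂ)) (i.mat • z).im_pos.le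
      ((hY i).trans_lt hYv)
    have h2 := tendsto_kerSum v (w := ((i.a / i.c : ℝ) : ℂ)) (by simp) (by simpa using v.im_pos)
    have h3 : Tendsto (fun s => lipPart z v s i) toOne (𝓝 0) := by
      have := (h1.sub h2).sub_const
        (kerSum v 1 ((i.mat • z : ℍ) : ℂ) - kerSum v 1 ((i.a / i.c : ℝ) : ℂ))
      rwa [sub_self] at this
    have h4 := ((tendsto_eisTerm z i.mat).comp tendsto_toOne_two_mul_sub_one).mul h3
    rwa [mul_zero] at h4
  · filter_upwards [eventually_nearOne,
      tendsto_toOne_two_mul_sub_one.eventually eventually_nearOne] with s hs hs' i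
    have h1 := norm_eisTerm_le i z hs'
    have h2 := h s hs i
    have hj := norm_autom_pos i z
    rw [norm_mul]
    calc _ ≤ (eisBound z * ‖autom i.mat z‖ ^ (-2 : ℝ)) * (C * ‖autom i.mat z‖⁻¹) := by gcongr
      _ = _ := by
        rw [show (-3 : ℝ) = -2 + -1 by norm_num, Real.rpow_add hj, Real.rpow_neg_one]
        ring

/-- The difference of the Fourier coefficients of the kernel at `s` and at `1`. -/
def fourierDiff (v : ℍ) (s : ℂ) (r : ℤ) : ℂ :=
  (lineFourier v.im (-1) (-1) (2 * (s - 1)) r - lineFourier v.im (-1) (-1) (2 * (1 - 1)) r) *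
    fexp r ((-v.re : ℝ) : ℂ)

lemma exists_norm_fourierDiff_le (v : ℍ) : ∃ C : ℝ, 0 ≤ C ∧ ∀ s ∈ nearOne, ∀ r : ℤ,
    ‖fourierDiff v s r‖ ≤ C / (1 + |(r : ℝ)|) ^ 3 := by
  obtain ⟨C, hC, h⟩ := exists_norm_fourier_lineKernel_le v.im_pos (i := -1) (j := -1) (by norm_num)
  refine ⟨2 * C, by positivity, fun s hs r => ?_⟩
  rw [fourierDiff, norm_mul, norm_fexp_ofReal, mul_one]
  refine (norm_sub_le _ _).trans ((add_le_add (h _ (two_mul_sub_one_mem_expDomain hs) r)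
    (h _ (two_mul_sub_one_mem_expDomain one_mem_nearOne) r)).trans (le_of_eq ?_))
  ring

lemma summable_norm_fourierDiff {s : ℂ} (hs : s ∈ nearOne) :
    Summable fun r : ℤ => ‖fourierDiff v s r‖ := by
  have h1 := summable_norm_lineFourier v.im_pos (i := -1) (j := -1) (by norm_num)
    (two_mul_sub_one_mem_expDomain hs)
  have h2 := summable_norm_lineFourier v.im_pos (i := -1) (j := -1) (by norm_num)
    (two_mul_sub_one_mem_expDomain one_mem_nearOne)
  refine Summable.of_nonneg_of_le (fun _ => norm_nonneg _) (fun r => ?_) (h1.add h2)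
  rw [fourierDiff, norm_mul, norm_fexp_ofReal, mul_one]
  exact norm_sub_le _ _

lemma tendsto_fourierDiff (v : ℍ) (r : ℤ) :
    Tendsto (fun s => fourierDiff v s r) toOne (𝓝 0) := by
  have h0 : Tendsto (fun s : ℂ => 2 * (s - 1)) toOne (𝓝 0) := by
    simpa using tendsto_toOne_sub_one.const_mul 2
  have h := tendsto_fourier_lineKernel v.im_pos (i := -1) (j := -1) (by norm_num) h0
    (eventually_nearOne.mono fun s hs => two_mul_sub_one_mem_expDomain hs) (r : ℝ)
  have h2 := (h.sub_const (lineFourier v.im (-1) (-1) 0 r)).mul_const (fexp r ((-v.re : ℝ) : ℂ))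
  rw [sub_self, zero_mul] at h2
  simp only [fourierDiff, sub_self, mul_zero]
  exact h2

lemma kerSum_ofReal_sub {s : ℂ} (hs : s ∈ nearOne) (x : ℝ) :
    kerSum v s x - kerSum v 1 x = ∑' r : ℤ, fourierDiff v s r * fexp r x := by
  have hsum : ∀ s ∈ nearOne, Summable fun r : ℤ =>
      lineFourier v.im (-1) (-1) (2 * (s - 1)) r * fexp r ((x - v.re : ℝ) : ℂ) := by
    intro s hs
    refine Summable.of_norm_bounded (summable_norm_lineFourier v.im_pos (i := -1) (j := -1)
      (by norm_num) (two_mul_sub_one_mem_expDomain hs)) fun r => ?_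
    rw [norm_mul, norm_fexp_ofReal, mul_one]
  rw [kerSum_ofReal v hs, kerSum_ofReal v one_mem_nearOne,
    ← (hsum s hs).tsum_sub (hsum 1 one_mem_nearOne)]
  refine tsum_congr fun r => ?_
  rw [fourierDiff, sub_eq_add_neg x, Complex.ofReal_add, fexp_add]
  ring

/-- At the real points `a/c` the kernel has an absolutely convergent Fourier series, so the sum
becomes a combination of the additive twists; only the frequency `0` meets the pole part. -/
lemma tsum_eisTerm_mul_kerSum_sub {s : ℂ} (hs : s ∈ nearOne) (hs1 : 1 < s.re)
    (hs' : 2 * s - 1 ∈ nearOne) :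
    ∑' i : CuspIdx N, eisTerm z (2 * s - 1) i.mat *
        (kerSum v s ((i.a / i.c : ℝ) : ℂ) - kerSum v 1 ((i.a / i.c : ℝ) : ℂ)) =
      ∑' r : ℤ, fourierDiff v s r * regSum N r z (2 * s - 1) +
        fourierDiff v s 0 * poleSum N z (2 * s - 1) := by
  have h1 := re_two_mul_sub_one hs1
  have hd : Summable fun x : CuspIdx N × ℤ => eisTerm z (2 * s - 1) x.1.mat *
      (fourierDiff v s x.2 * fexp x.2 ((x.1.a / x.1.c : ℝ) : ℂ)) := by
    refine Summable.of_norm_bounded ((summable_norm_eisTerm (N := N) z h1).mul_of_nonneg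
      (summable_norm_fourierDiff (v := v) hs) (fun _ => norm_nonneg _)
      (fun _ => norm_nonneg _)) fun x => ?_
    rw [norm_mul, norm_mul, norm_fexp_ofReal, mul_one]
  obtain ⟨C, hC, hF⟩ := exists_norm_fourierDiff_le v
  obtain ⟨D, hD, hR⟩ := exists_norm_regSum_le (N := N) z
  have hreg : Summable fun r : ℤ => fourierDiff v s r * regSum N r z (2 * s - 1) := by
    refine Summable.of_norm_bounded (summable_one_div_one_add_abs_sq.mul_left (C * D)) fun r => ?_
    rw [norm_mul]
    have hr : 0 < 1 + |(r : ℝ)| := by positivity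
    calc _ ≤ C / (1 + |(r : ℝ)|) ^ 3 * (D * (1 + |(r : ℝ)|)) :=
          mul_le_mul (hF s hs r) (hR r _ hs') (norm_nonneg _) (by positivity)
      _ = _ := by field_simp
  simp_rw [kerSum_ofReal_sub hs, ← tsum_mul_left]
  refine (Summable.tsum_comm (f := fun (i : CuspIdx N) (r : ℤ) => eisTerm z (2 * s - 1) i.mat *
    (fourierDiff v s r * fexp r ((i.a / i.c : ℝ) : ℂ))) hd).symm.trans ?_
  have h2 : ∀ r : ℤ, ∑' i : CuspIdx N, eisTerm z (2 * s - 1) i.mat *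
      (fourierDiff v s r * fexp r ((i.a / i.c : ℝ) : ℂ)) =
      fourierDiff v s r * regSum N r z (2 * s - 1) +
        if r = 0 then fourierDiff v s 0 * poleSum N z (2 * s - 1) else 0 := by
    intro r
    have h3 : ∑' i : CuspIdx N, eisTerm z (2 * s - 1) i.mat *
      (fourierDiff v s r * fexp r ((i.a / i.c : ℝ) : ℂ)) =
        fourierDiff v s r * ∑' i : CuspIdx N, cuspTerm r z (2 * s - 1) i := by
      rw [← tsum_mul_left]
      refine tsum_congr fun i => ?_
      rw [cuspTerm]
      push_cast
      ring
    rw [h3, tsum_cuspTerm r z hs' h1, mul_add]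
    split_ifs with hr
    · rw [hr]
    · rw [mul_zero]
  rw [tsum_congr h2, hreg.tsum_add (hasSum_ite_eq 0 _).summable, tsum_ite_eq]

/-- Each Fourier difference tends to `0` while the twists stay bounded by `1 + |r|`; cubic decay in
`r` dominates. At `r = 0` the pole part has a finite limit, so that product vanishes too. -/
lemma tendsto_tsum_eisTerm_mul_kerSum_sub :
    Tendsto (fun s => ∑' i : CuspIdx N, eisTerm z (2 * s - 1) i.mat *
        (kerSum v s ((i.a / i.c : ℝ) : ℂ) - kerSum v 1 ((i.a / i.c : ℝ) : ℂ))) toOne (𝓝 0) := by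
  obtain ⟨C, hC, hF⟩ := exists_norm_fourierDiff_le v
  obtain ⟨D, hD, hR⟩ := exists_norm_regSum_le (N := N) z
  have h1 : Tendsto (fun s => ∑' r : ℤ, fourierDiff v s r * regSum N r z (2 * s - 1)) toOne
      (𝓝 0) := by
    rw [← tsum_zero (α := ℂ) (β := ℤ)]
    refine tendsto_tsum_of_dominated_convergence
      (summable_one_div_one_add_abs_sq.mul_left (C * D)) (fun r => ?_) ?_
    · have := (tendsto_fourierDiff v r).mul
        ((tendsto_regSum (N := N) r z).comp tendsto_toOne_two_mul_sub_one)
      rwa [zero_mul] at this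
    · filter_upwards [eventually_nearOne,
        tendsto_toOne_two_mul_sub_one.eventually eventually_nearOne] with s hs hs' r
      rw [norm_mul]
      have hr : 0 < 1 + |(r : ℝ)| := by positivity
      calc _ ≤ C / (1 + |(r : ℝ)|) ^ 3 * (D * (1 + |(r : ℝ)|)) :=
            mul_le_mul (hF s hs r) (hR r _ hs') (norm_nonneg _) (by positivity)
        _ = _ := by field_simp
  have h2 := (tendsto_fourierDiff v 0).mul
    ((tendsto_poleSum (N := N) z).comp tendsto_toOne_two_mul_sub_one)
  rw [zero_mul] at h2
  have h3 := h1.add h2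
  rw [add_zero] at h3
  refine h3.congr' ?_
  filter_upwards [eventually_toOne,
    tendsto_toOne_two_mul_sub_one.eventually eventually_nearOne] with s hs hs'
  exact (tsum_eisTerm_mul_kerSum_sub ⟨hs.1.le, hs.2⟩ hs.1 hs').symm

/-- The difference between the kernel and the expression through the values at `s = 1` of the
periodization tends to zero. -/
lemma tendsto_xiSeries_sub (hY0 : 0 < Y) (hYv : Y < v.im) (hzY : z.im ≤ Y)
    (hY : ∀ i : CuspIdx N, (i.mat • z).im ≤ Y) :
    Tendsto (fun s => xiSeries N z v s - (kerSum v 1 z + ∑' i : CuspIdx N,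
      eisTerm z (2 * s - 1) i.mat * kerSum v 1 ((i.mat • z : ℍ) : ℂ))) toOne (𝓝 0) := by
  have h1 := (tendsto_kerSum v (w := z) z.im_pos.le (hzY.trans_lt hYv)).sub_const (kerSum v 1 z)
  rw [sub_self] at h1
  have h2 := (h1.add (tendsto_tsum_lipPart (N := N) (z := z) (v := v) hY0 hYv hY)).add
    (tendsto_tsum_eisTerm_mul_kerSum_sub (N := N) (z := z) (v := v))
  rw [add_zero, add_zero] at h2
  refine h2.congr' ?_
  filter_upwards [eventually_toOne] with s hs
  have hs' := re_two_mul_sub_one hs.1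
  obtain ⟨C, hC, hsb⟩ := exists_norm_kerSum_le (v := v) hs.1.le hYv
  obtain ⟨D, hD, h1b⟩ := exists_norm_kerSum_le (v := v) (s := 1) (by simp) hYv
  have hx : ∀ i : CuspIdx N, (0 : ℝ) ≤ (((i.a / i.c : ℝ) : ℂ)).im ∧
      (((i.a / i.c : ℝ) : ℂ)).im ≤ Y := fun i => by
    rw [Complex.ofReal_im]; exact ⟨le_rfl, hY0.le⟩
  have hw : ∀ i : CuspIdx N, ‖kerSum v s ((i.mat • z : ℍ) : ℂ)‖ ≤ C :=
    fun i => hsb _ (i.mat • z).im_pos.le (hY i)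
  have hw1 : ∀ i : CuspIdx N, ‖kerSum v 1 ((i.mat • z : ℍ) : ℂ)‖ ≤ D :=
    fun i => h1b _ (i.mat • z).im_pos.le (hY i)
  have hr : ∀ i : CuspIdx N, ‖kerSum v s ((i.a / i.c : ℝ) : ℂ) -
      kerSum v 1 ((i.a / i.c : ℝ) : ℂ)‖ ≤ C + D := fun i =>
    (norm_sub_le _ _).trans (add_le_add (hsb _ (hx i).1 (hx i).2) (h1b _ (hx i).1 (hx i).2))
  have s1 := summable_eisTerm_mul (z := z) hs' hw
  have s2 := summable_eisTerm_mul (z := z) hs' hw1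
  have s3 := summable_eisTerm_mul (z := z) hs' hr
  have e : ∑' i : CuspIdx N, eisTerm z (2 * s - 1) i.mat * lipPart z v s i =
      ∑' i : CuspIdx N, eisTerm z (2 * s - 1) i.mat * kerSum v s ((i.mat • z : ℍ) : ℂ) -
      ∑' i : CuspIdx N, eisTerm z (2 * s - 1) i.mat * kerSum v 1 ((i.mat • z : ℍ) : ℂ) -
      ∑' i : CuspIdx N, eisTerm z (2 * s - 1) i.mat *
        (kerSum v s ((i.a / i.c : ℝ) : ℂ) - kerSum v 1 ((i.a / i.c : ℝ) : ℂ)) := by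
    rw [← s1.tsum_sub s2, ← (s1.sub s2).tsum_sub s3]
    refine tsum_congr fun i => ?_
    rw [lipPart]
    ring
  rw [e, xiSeries_eq hYv hzY hY hs.1]
  ring

end xi

/-! ### The expansion of the kernel -/

section expansion
variable {N : ℕ} [NeZero N] {z v : ℍ} {Y : ℝ} {p q q' : ℂ}

lemma fexp_eq_zpow (m : ℤ) (w : ℂ) : fexp m w = exp (2 * Real.pi * Complex.I * w) ^ m := by
  rw [← Complex.exp_int_mul, fexp]
  congr 1
  ring

lemma norm_nome_conj_zpow (hq' : q' = exp (2 * Real.pi * Complex.I * starRingEnd ℂ (v : ℂ)))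
    (m : ℕ+) : ‖q' ^ (-(m : ℤ))‖ = Real.exp (-2 * Real.pi * v.im * m) := by
  rw [hq', ← fexp_eq_zpow, norm_fexp]
  congr 1
  simp
  ring

lemma abs_neg_pnat (m : ℕ+) : |-((m : ℕ) : ℤ)| = (m : ℕ) := by
  rw [abs_neg, Nat.abs_cast]

lemma abs_neg_neg_pnat (m : ℕ+) : |-(-((m : ℕ) : ℤ))| = (m : ℕ) := by
  rw [neg_neg, Nat.abs_cast]

/-- The sum of the Eisenstein series and of the generating series of the Poincaré series. -/
def genSeries (N : ℕ) (z : ℍ) (q q' s : ℂ) : ℂ :=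
  eisSeries N z s + (∑' m : ℕ+, poincareSeries N (m : ℤ) z s * q ^ (m : ℕ)) +
    (∑' m : ℕ+, poincareSeries N (-(m : ℤ)) z s * q' ^ (-(m : ℤ)))

/-- The limit of `genSeries` in terms of the limits of the twists. -/
def genLim (N : ℕ) [NeZero N] (z : ℍ) (q q' : ℂ) : ℂ :=
  (fexp 0 z + twistLim N 0 z) +
    (∑' m : ℕ+, fexp (-(m : ℤ)) z * q ^ (m : ℕ) +
      ∑' m : ℕ+, twistLim N (-(m : ℤ)) z * q ^ (m : ℕ)) +
    (∑' m : ℕ+, fexp (-(-(m : ℤ))) z * q' ^ (-(m : ℤ)) +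
      ∑' m : ℕ+, twistLim N (-(-(m : ℤ))) z * q' ^ (-(m : ℤ)))

lemma genSeries_eq {s : ℂ} (hs : 1 < s.re) : genSeries N z q q' s = twistSum N 0 z s +
    (∑' m : ℕ+, twistSum N (-(m : ℤ)) z s * q ^ (m : ℕ)) +
    (∑' m : ℕ+, twistSum N (-(-(m : ℤ))) z s * q' ^ (-(m : ℤ))) := by
  simp only [genSeries, eisSeries_eq z hs, poincareSeries_eq _ z hs]

lemma tendsto_genSeries (hq : q = exp (2 * Real.pi * Complex.I * (v : ℂ)))
    (hq' : q' = exp (2 * Real.pi * Complex.I * starRingEnd ℂ (v : ℂ))) (hY0 : 0 < Y)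
    (hYv : Y < v.im) (hzY : z.im ≤ Y) (hY : ∀ i : CuspIdx N, (i.mat • z).im ≤ Y) :
    Tendsto (genSeries N z q q') toOne (𝓝 (genLim N z q q')) := by
  have h1 := tendsto_tsum_twistSum_mul (N := N) (z := z) abs_neg_pnat
    (a := fun m => q ^ (m : ℕ)) (fun m => by rw [hq]; exact norm_nome_pow v m) hYv hY0 hzY hY
  have h2 := tendsto_tsum_twistSum_mul (N := N) (z := z) abs_neg_neg_pnat
    (a := fun m => q' ^ (-(m : ℤ))) (norm_nome_conj_zpow hq') hYv hY0 hzY hY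
  refine (((tendsto_twistSum 0 z).add h1).add h2).congr' ?_
  filter_upwards [eventually_toOne] with s hs
  exact (genSeries_eq hs.1).symm

lemma kerSum_one_eq (hq : q = exp (2 * Real.pi * Complex.I * (v : ℂ)))
    (hq' : q' = exp (2 * Real.pi * Complex.I * starRingEnd ℂ (v : ℂ))) {w : ℂ} (h0 : 0 ≤ w.im)
    (hv : w.im < v.im) : kerSum v 1 w =
      2 * Real.pi * Complex.I / ((v : ℂ) - starRingEnd ℂ (v : ℂ)) *
      (1 + ∑' m : ℕ+, fexp (-(m : ℤ)) w * q ^ (m : ℕ) +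
        ∑' m : ℕ+, fexp (-(-(m : ℤ))) w * q' ^ (-(m : ℤ))) := by
  have h1 : ∀ m : ℕ+, exp (2 * Real.pi * Complex.I * (v - w)) ^ (m : ℕ) =
      fexp (-(m : ℤ)) w * q ^ (m : ℕ) := by
    intro m
    rw [fexp, hq, ← Complex.exp_nat_mul, ← Complex.exp_nat_mul, ← Complex.exp_add]
    congr 1
    push_cast
    ring
  have h2 : ∀ m : ℕ+, exp (2 * Real.pi * Complex.I * (w - starRingEnd ℂ (v : ℂ))) ^ (m : ℕ) =
      fexp (-(-(m : ℤ))) w * q' ^ (-(m : ℤ)) := by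
    intro m
    rw [fexp, hq', ← Complex.exp_nat_mul, ← Complex.exp_int_mul, ← Complex.exp_add]
    congr 1
    push_cast
    ring
  rw [kerSum_one v h0 hv, tsum_congr h1, tsum_congr h2]

/-- Inserting the exponential expansion of the kernel at `s = 1` and interchanging sums identifies
the Eisenstein sum weighted by the kernel with the generating series, already for `Re s > 1`. -/
lemma kerSum_add_tsum_eq (hq : q = exp (2 * Real.pi * Complex.I * (v : ℂ)))
    (hq' : q' = exp (2 * Real.pi * Complex.I * starRingEnd ℂ (v : ℂ)))
    (hYv : Y < v.im) (hzY : z.im ≤ Y) (hY : ∀ i : CuspIdx N, (i.mat • z).im ≤ Y) {s : ℂ}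
    (hs : 1 < s.re) :
    kerSum v 1 z + ∑' i : CuspIdx N, eisTerm z s i.mat * kerSum v 1 ((i.mat • z : ℍ) : ℂ) =
      2 * Real.pi * Complex.I / ((v : ℂ) - starRingEnd ℂ (v : ℂ)) * genSeries N z q q' s := by
  have ha : ∀ m : ℕ+, ‖q ^ (m : ℕ)‖ = Real.exp (-2 * Real.pi * v.im * m) :=
    fun m => by rw [hq]; exact norm_nome_pow v m
  have ha' := norm_nome_conj_zpow (v := v) hq'
  have b1 : ∀ i : CuspIdx N, ‖∑' m : ℕ+, fexp (-(m : ℤ)) ((i.mat • z : ℍ) : ℂ) * q ^ (m : ℕ)‖ ≤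
      ∑' m : ℕ+, Real.exp (-2 * Real.pi * (v.im - Y) * m) := fun i =>
    tsum_of_norm_bounded (summable_exp_pnat hYv).hasSum
      (norm_fexp_mul_le abs_neg_pnat ha (i.mat • z).im_pos.le (hY i))
  have b2 : ∀ i : CuspIdx N, ‖∑' m : ℕ+, fexp (-(-(m : ℤ))) ((i.mat • z : ℍ) : ℂ) *
      q' ^ (-(m : ℤ))‖ ≤ ∑' m : ℕ+, Real.exp (-2 * Real.pi * (v.im - Y) * m) := fun i =>
    tsum_of_norm_bounded (summable_exp_pnat hYv).hasSum
      (norm_fexp_mul_le abs_neg_neg_pnat ha' (i.mat • z).im_pos.le (hY i))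
  have s0 : Summable fun i : CuspIdx N => eisTerm z s i.mat := (summable_norm_eisTerm z hs).of_norm
  have s1 := summable_eisTerm_mul (z := z) hs b1
  have s2 := summable_eisTerm_mul (z := z) hs b2
  have e0 : twistSum N 0 z s = 1 + ∑' i : CuspIdx N, eisTerm z s i.mat := by
    rw [twistSum, fexp_zero]
    congr 1
    refine tsum_congr fun i => ?_
    rw [twistTerm, fexp_zero, mul_one]
  have e1 := tsum_twistSum_mul (N := N) (z := z) abs_neg_pnat (a := fun m => q ^ (m : ℕ)) ha hYv
    hzY hY hs
  have e2 := tsum_twistSum_mul (N := N) (z := z) abs_neg_neg_pnat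
    (a := fun m => q' ^ (-(m : ℤ))) ha' hYv hzY hY hs
  have e3 : ∑' i : CuspIdx N, eisTerm z s i.mat * kerSum v 1 ((i.mat • z : ℍ) : ℂ) =
      2 * Real.pi * Complex.I / ((v : ℂ) - starRingEnd ℂ (v : ℂ)) *
        (∑' i : CuspIdx N, eisTerm z s i.mat + ∑' i : CuspIdx N, eisTerm z s i.mat *
          (∑' m : ℕ+, fexp (-(m : ℤ)) ((i.mat • z : ℍ) : ℂ) * q ^ (m : ℕ)) +
        ∑' i : CuspIdx N, eisTerm z s i.mat *
          (∑' m : ℕ+, fexp (-(-(m : ℤ))) ((i.mat • z : ℍ) : ℂ) * q' ^ (-(m : ℤ)))) := by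
    rw [← s0.tsum_add s1, ← (s0.add s1).tsum_add s2, ← tsum_mul_left]
    refine tsum_congr fun i => ?_
    rw [kerSum_one_eq hq hq' (i.mat • z).im_pos.le ((hY i).trans_lt hYv)]
    ring
  rw [e3, genSeries_eq hs, e0, e1, e2, kerSum_one_eq hq hq' z.im_pos.le (hzY.trans_lt hYv)]
  ring

lemma tendsto_xiSeries (hq : q = exp (2 * Real.pi * Complex.I * (v : ℂ)))
    (hq' : q' = exp (2 * Real.pi * Complex.I * starRingEnd ℂ (v : ℂ))) (hY0 : 0 < Y)
    (hYv : Y < v.im) (hzY : z.im ≤ Y) (hY : ∀ i : CuspIdx N, (i.mat • z).im ≤ Y) :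
    Tendsto (xiSeries N z v) toOne
      (𝓝 (2 * Real.pi * Complex.I / ((v : ℂ) - starRingEnd ℂ (v : ℂ)) * genLim N z q q')) := by
  have h1 := tendsto_xiSeries_sub (N := N) hY0 hYv hzY hY
  -- The exponent here is `2s - 1`, which tends to `1` inside the same half-plane as `s` does.
  have h2 := ((tendsto_genSeries (N := N) hq hq' hY0 hYv hzY hY).comp
    tendsto_toOne_two_mul_sub_one).const_mul
      (2 * Real.pi * Complex.I / ((v : ℂ) - starRingEnd ℂ (v : ℂ)))
  have h3 := h1.add h2
  rw [zero_add] at h3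
  refine h3.congr' ?_
  filter_upwards [eventually_toOne] with s hs
  rw [kerSum_add_tsum_eq hq hq' hYv hzY hY (re_two_mul_sub_one hs.1), Function.comp_apply]
  ring

lemma Xi_eq (hq : q = exp (2 * Real.pi * Complex.I * (v : ℂ)))
    (hq' : q' = exp (2 * Real.pi * Complex.I * starRingEnd ℂ (v : ℂ))) (hY0 : 0 < Y)
    (hYv : Y < v.im) (hzY : z.im ≤ Y) (hY : ∀ i : CuspIdx N, (i.mat • z).im ≤ Y) :
    Xi N z v = 2 * Real.pi * Complex.I / ((v : ℂ) - starRingEnd ℂ (v : ℂ)) * genLim N z q q' := by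
  have := toOne_neBot
  exact (tendsto_xiSeries hq hq' hY0 hYv hzY hY).limUnder_eq

lemma inv_mul_Xi_mul (hq : q = exp (2 * Real.pi * Complex.I * (v : ℂ)))
    (hq' : q' = exp (2 * Real.pi * Complex.I * starRingEnd ℂ (v : ℂ))) (hY0 : 0 < Y)
    (hYv : Y < v.im) (hzY : z.im ≤ Y) (hY : ∀ i : CuspIdx N, (i.mat • z).im ≤ Y) :
    (2 * Real.pi * Complex.I)⁻¹ * Xi N z v * (v - starRingEnd ℂ (v : ℂ)) = genLim N z q q' := by
  have hvv : (v : ℂ) - starRingEnd ℂ (v : ℂ) ≠ 0 := by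
    rw [Complex.sub_conj]
    simp [v.im_pos.ne']
  rw [Xi_eq hq hq' hY0 hYv hzY hY]
  have h2 := Complex.two_pi_I_ne_zero
  field_simp

lemma summable_eisCoeff_mul (hp : p = exp (2 * Real.pi * Complex.I * (z : ℂ))) :
    Summable fun r : ℕ => eisCoeff N z r * p ^ r := by
  rw [← summable_pnat_iff_summable_nat]
  refine (summable_fourierCoeff_mul_nome (N := N) 0 z).congr fun r => ?_
  rw [eisCoeff_eq z r.pos, hp]

lemma tsum_eisCoeff_mul (hp : p = exp (2 * Real.pi * Complex.I * (z : ℂ))) :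
    ∑' r : ℕ, eisCoeff N z r * p ^ r = fexp 0 z + twistLim N 0 z := by
  rw [← tsum_zero_pnat_eq_tsum_nat (summable_eisCoeff_mul hp), twistLim_eq, if_pos rfl, fexp_zero]
  have h : ∑' r : ℕ+, eisCoeff N z r * p ^ (r : ℕ) = ∑' r : ℕ+, fourierCoeff N 0 r *
      exp (2 * Real.pi * Complex.I * (z : ℂ)) ^ (r : ℕ) :=
    tsum_congr fun r => by rw [eisCoeff_eq z r.pos, hp]
  rw [h, eisCoeff, if_pos rfl]
  push_cast
  ring

lemma summable_poincareCoeff_mul (hp : p = exp (2 * Real.pi * Complex.I * (z : ℂ))) {r' : ℤ}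
    (hr' : r' ≠ 0) : Summable fun r : ℕ+ => poincareCoeff N r' r * p ^ (r : ℕ) := by
  refine (summable_fourierCoeff_mul_nome (N := N) (-r') z).congr fun r => ?_
  rw [poincareCoeff_eq hr' r.pos, hp]

lemma tsum_poincareCoeff_mul (hp : p = exp (2 * Real.pi * Complex.I * (z : ℂ))) {r' : ℤ}
    (hr' : r' ≠ 0) : ∑' r : ℕ+, poincareCoeff N r' r * p ^ (r : ℕ) = twistLim N (-r') z := by
  rw [twistLim_eq, if_neg (neg_ne_zero.2 hr'), add_zero]
  exact tsum_congr fun r => by rw [poincareCoeff_eq hr' r.pos, hp]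

lemma summable_poincareCoeff_double_pos (hp : p = exp (2 * Real.pi * Complex.I * (z : ℂ)))
    (hq : q = exp (2 * Real.pi * Complex.I * (v : ℂ))) (h : 1 < (N : ℝ) ^ 2 * z.im * v.im) :
    Summable fun x : ℕ+ × ℕ+ =>
      poincareCoeff N (x.2 : ℤ) x.1 * p ^ (x.1 : ℕ) * q ^ (x.2 : ℕ) := by
  have hz := z.im_pos
  have hv := v.im_pos
  have hN : (0 : ℝ) < N := by exact_mod_cast NeZero.pos N
  have hlt : 1 / ((N : ℝ) ^ 2 * v.im) < z.im := by
    rw [div_lt_iff₀ (by positivity)]; linarith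
  -- `δ < Im z` gives decay in `r`, and `1/(N²δ) < Im v` gives decay in `r'`; both are possible
  -- exactly when `N² Im z Im v > 1`.
  obtain ⟨δ, hδ1, hδ2⟩ := exists_between hlt
  have hδ : 0 < δ := lt_trans (by positivity) hδ1
  have hδ3 : 1 / ((N : ℝ) ^ 2 * δ) < v.im := by
    rw [div_lt_iff₀ (by positivity)] at hδ1 ⊢; linarith
  have hK := kloMass_nonneg N
  refine Summable.of_norm_bounded (((summable_pnat_pow_mul_exp 2 (sub_pos.2 hδ2)).mul_of_nonneg
    (summable_exp_pnat hδ3) (fun _ => by positivity) (fun _ => by positivity)).mul_left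
      (12 * Real.pi ^ 2 * kloMass N)) fun x => ?_
  have h1 := norm_fourierCoeff_le (N := N) hδ (-(x.2 : ℤ)) x.1.pos
  have hm : |((-(x.2 : ℤ) : ℤ) : ℝ)| = (x.2 : ℕ) := by push_cast; rw [abs_neg, Nat.abs_cast]
  rw [hm] at h1
  rw [poincareCoeff_eq (by exact_mod_cast x.2.ne_zero) x.1.pos, norm_mul, norm_mul, hp, hq,
    norm_nome_pow, norm_nome_pow]
  calc _ ≤ 12 * Real.pi ^ 2 * (x.1 : ℕ) ^ 2 * Real.exp (2 * Real.pi * ((x.2 : ℕ) / (N ^ 2 * δ) +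
        δ * (x.1 : ℕ))) * kloMass N * Real.exp (-2 * Real.pi * z.im * (x.1 : ℕ)) *
        Real.exp (-2 * Real.pi * v.im * (x.2 : ℕ)) := by gcongr
    _ = 12 * Real.pi ^ 2 * kloMass N * ((x.1 : ℕ) ^ 2 *
        (Real.exp (2 * Real.pi * ((x.2 : ℕ) / (N ^ 2 * δ) + δ * (x.1 : ℕ))) *
        Real.exp (-2 * Real.pi * z.im * (x.1 : ℕ)) *
        Real.exp (-2 * Real.pi * v.im * (x.2 : ℕ)))) := by ring
    _ = _ := by
      rw [mul_assoc ((x.1 : ℕ) ^ 2 : ℝ), ← Real.exp_add, ← Real.exp_add, ← Real.exp_add]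
      congr 3
      ring

/-- For negative `r'` the coefficients are bounded by a multiple of `r²` independent of `r'`, so no
condition on the imaginary parts is needed. -/
lemma summable_poincareCoeff_double_neg (hp : p = exp (2 * Real.pi * Complex.I * (z : ℂ)))
    (hq' : q' = exp (2 * Real.pi * Complex.I * starRingEnd ℂ (v : ℂ))) :
    Summable fun x : ℕ+ × ℕ+ =>
      poincareCoeff N (-(x.2 : ℤ)) x.1 * p ^ (x.1 : ℕ) * q' ^ (-(x.2 : ℤ)) := by
  have hK := kloMass_nonneg N
  have hv : Summable fun m : ℕ+ => Real.exp (-2 * Real.pi * v.im * m) := by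
    simpa using summable_pnat_pow_mul_exp 0 v.im_pos
  refine Summable.of_norm_bounded (((summable_pnat_pow_mul_exp 2 z.im_pos).mul_of_nonneg
    hv (fun _ => by positivity) (fun _ => by positivity)).mul_left
      (12 * Real.pi ^ 2 * kloMass N)) fun x => ?_
  have h1 := norm_fourierCoeff_le_of_nonneg (N := N) (m := -(-(x.2 : ℤ))) (by simp) x.1.pos
  rw [poincareCoeff_eq (neg_ne_zero.2 (by exact_mod_cast x.2.ne_zero)) x.1.pos, norm_mul, norm_mul,
    norm_nome_conj_zpow hq', hp, norm_nome_pow]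
  calc _ ≤ 12 * Real.pi ^ 2 * (x.1 : ℕ) ^ 2 * kloMass N *
        Real.exp (-2 * Real.pi * z.im * (x.1 : ℕ)) *
        Real.exp (-2 * Real.pi * v.im * (x.2 : ℕ)) := by gcongr
    _ = _ := by ring

/-- For `r' > 0` the sum over `r` stays inside, because absolute convergence of that double family
is available only under the extra condition. -/
lemma genLim_eq (hp : p = exp (2 * Real.pi * Complex.I * (z : ℂ)))
    (hq' : q' = exp (2 * Real.pi * Complex.I * starRingEnd ℂ (v : ℂ))) : genLim N z q q' =
      (∑' r : ℕ, eisCoeff N z r * p ^ r) +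
      ((∑' m : ℕ+, p ^ (-(m : ℤ)) * q ^ (m : ℕ)) +
        (∑' m : ℕ+, ∑' r : ℕ+, poincareCoeff N (m : ℤ) r * p ^ (r : ℕ) * q ^ (m : ℕ))) +
      ((∑' m : ℕ+, p ^ (m : ℕ) * q' ^ (-(m : ℤ))) +
        (∑' x : ℕ+ × ℕ+,
          poincareCoeff N (-(x.2 : ℤ)) x.1 * p ^ (x.1 : ℕ) * q' ^ (-(x.2 : ℤ)))) := by
  have hd := summable_poincareCoeff_double_neg (N := N) hp hq'
  have e : ∑' x : ℕ+ × ℕ+, poincareCoeff N (-(x.2 : ℤ)) x.1 * p ^ (x.1 : ℕ) * q' ^ (-(x.2 : ℤ)) =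
      ∑' m : ℕ+, twistLim N (-(-(m : ℤ))) z * q' ^ (-(m : ℤ)) := by
    rw [hd.tsum_prod]
    refine (Summable.tsum_comm (f := fun (r m : ℕ+) =>
      poincareCoeff N (-(m : ℤ)) r * p ^ (r : ℕ) * q' ^ (-(m : ℤ))) hd).symm.trans ?_
    refine tsum_congr fun m => ?_
    rw [tsum_mul_right, tsum_poincareCoeff_mul hp (neg_ne_zero.2 (by exact_mod_cast m.ne_zero))]
  rw [genLim, tsum_eisCoeff_mul hp, e]
  congr 1
  · congr 2
    · exact tsum_congr fun m => by rw [fexp_eq_zpow, hp]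
    · refine tsum_congr fun m => ?_
      rw [tsum_mul_right, tsum_poincareCoeff_mul hp (by exact_mod_cast m.ne_zero)]
  · congr 1
    exact tsum_congr fun m => by rw [fexp_eq_zpow, hp, neg_neg, zpow_natCast]

end expansion

end CauchyKernel

end

/-! ### Assembly of the theorem. -/

theorem theorem5 (N : ℕ) (hN : 0 < N) (z₁ z₂ : ℍ)
    (hz : ∀ γ ∈ CongruenceSubgroup.Gamma0 N, (γ • z₁).im < z₂.im)
    (p q q' : ℂ) (hp : p = Complex.exp (2 * Real.pi * Complex.I * (z₁ : ℂ)))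
    (hq : q = Complex.exp (2 * Real.pi * Complex.I * (z₂ : ℂ)))
    (hq' : q' = Complex.exp (2 * Real.pi * Complex.I * (starRingEnd ℂ (z₂ : ℂ)))) :
    -- the series defining the kernel, the Eisenstein series and the Poincaré series converge
    -- absolutely for `Re s > 1`, and so do the series of the Poincaré coefficients
    (∀ s : ℂ, 1 < s.re →
      Summable (fun γ : CongruenceSubgroup.Gamma0 N => CauchyKernel.xiTerm z₁ z₂ s γ) ∧
      Summable (CauchyKernel.eisCosetTerm N z₁ s) ∧
      ∀ r' : ℤ, r' ≠ 0 → Summable (CauchyKernel.poincareCosetTerm N r' z₁ s)) ∧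
    (∀ r' : ℤ, r' ≠ 0 → ∀ r : ℕ, 0 < r → Summable (CauchyKernel.poincareCoeffTerm N r' r)) ∧
    -- `Ξ_N(z₁, z₂)` is a genuine limit
    Filter.Tendsto (CauchyKernel.xiSeries N z₁ z₂) CauchyKernel.toOne
      (nhds (CauchyKernel.Xi N z₁ z₂)) ∧
    -- `e_{r, N}` are the coefficients of the Eisenstein series at `s → 1`
    Summable (fun r : ℕ => CauchyKernel.eisCoeff N z₁ r * p ^ r) ∧
    Filter.Tendsto (CauchyKernel.eisSeries N z₁) CauchyKernel.toOne
      (nhds (∑' r : ℕ, CauchyKernel.eisCoeff N z₁ r * p ^ r)) ∧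
    -- `p_{r', N}(r)` are the coefficients of the Poincaré series at `s → 1`
    (∀ r' : ℤ, r' ≠ 0 →
      Summable (fun r : ℕ+ => CauchyKernel.poincareCoeff N r' r * p ^ (r : ℕ)) ∧
      Filter.Tendsto (CauchyKernel.poincareSeries N r' z₁) CauchyKernel.toOne
        (nhds (p ^ (-r') + ∑' r : ℕ+, CauchyKernel.poincareCoeff N r' r * p ^ (r : ℕ)))) ∧
    -- convergence of the series over `r'` and of the double series
    Summable (fun m : ℕ+ => p ^ (-(m : ℤ)) * q ^ (m : ℕ)) ∧
    Summable (fun m : ℕ+ => p ^ (m : ℕ) * q' ^ (-(m : ℤ))) ∧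
    Summable (fun m : ℕ+ =>
      ∑' r : ℕ+, CauchyKernel.poincareCoeff N (m : ℤ) r * p ^ (r : ℕ) * q ^ (m : ℕ)) ∧
    (1 < (N : ℝ) ^ 2 * z₁.im * z₂.im → Summable (fun x : ℕ+ × ℕ+ =>
      CauchyKernel.poincareCoeff N (x.2 : ℤ) x.1 * p ^ (x.1 : ℕ) * q ^ (x.2 : ℕ))) ∧
    Summable (fun x : ℕ+ × ℕ+ =>
      CauchyKernel.poincareCoeff N (-(x.2 : ℤ)) x.1 * p ^ (x.1 : ℕ) * q' ^ (-(x.2 : ℤ))) ∧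
    -- the Fourier expansion of the kernel
    (2 * Real.pi * Complex.I)⁻¹ * CauchyKernel.Xi N z₁ z₂ * (z₂ - starRingEnd ℂ (z₂ : ℂ)) =
      (∑' r : ℕ, CauchyKernel.eisCoeff N z₁ r * p ^ r) +
      ((∑' m : ℕ+, p ^ (-(m : ℤ)) * q ^ (m : ℕ)) +
        (∑' m : ℕ+, ∑' r : ℕ+,
          CauchyKernel.poincareCoeff N (m : ℤ) r * p ^ (r : ℕ) * q ^ (m : ℕ))) +
      ((∑' m : ℕ+, p ^ (m : ℕ) * q' ^ (-(m : ℤ))) +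
        (∑' x : ℕ+ × ℕ+,
          CauchyKernel.poincareCoeff N (-(x.2 : ℤ)) x.1 * p ^ (x.1 : ℕ) * q' ^ (-(x.2 : ℤ)))) ∧
    -- the same expansion through the Eisenstein and Poincaré series
    (∀ s : ℂ, 1 < s.re →
      Summable (fun m : ℕ+ => CauchyKernel.poincareSeries N (m : ℤ) z₁ s * q ^ (m : ℕ)) ∧
      Summable (fun m : ℕ+ => CauchyKernel.poincareSeries N (-(m : ℤ)) z₁ s * q' ^ (-(m : ℤ)))) ∧
    Filter.Tendsto (fun s : ℂ => CauchyKernel.eisSeries N z₁ s +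
        (∑' m : ℕ+, CauchyKernel.poincareSeries N (m : ℤ) z₁ s * q ^ (m : ℕ)) +
        (∑' m : ℕ+, CauchyKernel.poincareSeries N (-(m : ℤ)) z₁ s * q' ^ (-(m : ℤ))))
      CauchyKernel.toOne
      (nhds ((2 * Real.pi * Complex.I)⁻¹ * CauchyKernel.Xi N z₁ z₂ *
        (z₂ - starRingEnd ℂ (z₂ : ℂ)))) := by
  have : NeZero N := ⟨hN.ne'⟩
  have hz1 : z₁.im < z₂.im := by
    have := hz 1 (one_mem _)
    rwa [one_smul] at this
  -- The coset representatives suffice here: translations and signs do not change `Im γz₁`, and the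
  -- identity is covered by `hz1`.
  obtain ⟨Y, hY0, hYv, hzY, hY⟩ := CauchyKernel.exists_im_smul_le (N := N) z₁ hz1
    fun i => hz _ i.mat_mem
  have hfin := CauchyKernel.inv_mul_Xi_mul (N := N) hq hq' hY0 hYv hzY hY
  have hqn : ∀ m : ℕ+, ‖q ^ (m : ℕ)‖ = Real.exp (-2 * Real.pi * z₂.im * m) :=
    fun m => by rw [hq]; exact CauchyKernel.norm_nome_pow z₂ m
  have hqn' := CauchyKernel.norm_nome_conj_zpow (v := z₂) hq'
  have hne : ∀ m : ℕ+, ((m : ℕ) : ℤ) ≠ 0 := fun m => by exact_mod_cast m.ne_zero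
  refine ⟨fun s hs => ⟨CauchyKernel.summable_xiTerm hYv hzY hY hs,
      (CauchyKernel.hasSum_eisCosetTerm z₁ hs).summable,
      fun r' _ => (CauchyKernel.hasSum_poincareCosetTerm r' z₁ hs).summable⟩,
    fun r' hr' r hr => CauchyKernel.summable_poincareCoeffTerm hr' hr,
    ?_, CauchyKernel.summable_eisCoeff_mul hp, ?_,
    fun r' hr' => ⟨CauchyKernel.summable_poincareCoeff_mul hp hr', ?_⟩, ?_, ?_, ?_,
    CauchyKernel.summable_poincareCoeff_double_pos hp hq,
    CauchyKernel.summable_poincareCoeff_double_neg hp hq', ?_, fun s hs => ⟨?_, ?_⟩, ?_⟩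
  · rw [CauchyKernel.Xi_eq hq hq' hY0 hYv hzY hY]
    exact CauchyKernel.tendsto_xiSeries hq hq' hY0 hYv hzY hY
  · rw [CauchyKernel.tsum_eisCoeff_mul hp]
    refine (CauchyKernel.tendsto_twistSum 0 z₁).congr' ?_
    filter_upwards [CauchyKernel.eventually_toOne] with s hs
    exact (CauchyKernel.eisSeries_eq z₁ hs.1).symm
  · rw [CauchyKernel.tsum_poincareCoeff_mul hp hr', hp, ← CauchyKernel.fexp_eq_zpow]
    refine (CauchyKernel.tendsto_twistSum (-r') z₁).congr' ?_
    filter_upwards [CauchyKernel.eventually_toOne] with s hs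
    exact (CauchyKernel.poincareSeries_eq r' z₁ hs.1).symm
  · refine (CauchyKernel.summable_fexp_mul CauchyKernel.abs_neg_pnat hqn hYv z₁.im_pos.le
      hzY).congr fun m => ?_
    rw [CauchyKernel.fexp_eq_zpow, hp]
  · refine (CauchyKernel.summable_fexp_mul CauchyKernel.abs_neg_neg_pnat hqn' hYv z₁.im_pos.le
      hzY).congr fun m => ?_
    rw [CauchyKernel.fexp_eq_zpow, hp, neg_neg, zpow_natCast]
  · refine (CauchyKernel.summable_twistLim_mul (N := N) CauchyKernel.abs_neg_pnat hqn hYv hY0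
      hY).congr fun m => ?_
    rw [tsum_mul_right, CauchyKernel.tsum_poincareCoeff_mul hp (hne m)]
  · rw [hfin, CauchyKernel.genLim_eq hp hq']
  · refine (CauchyKernel.summable_twistSum_mul (N := N) CauchyKernel.abs_neg_pnat hqn hYv hzY hY
      hs).congr fun m => ?_
    rw [CauchyKernel.poincareSeries_eq _ z₁ hs]
  · refine (CauchyKernel.summable_twistSum_mul (N := N) CauchyKernel.abs_neg_neg_pnat hqn' hYv hzY
      hY hs).congr fun m => ?_
    rw [CauchyKernel.poincareSeries_eq _ z₁ hs]
  · rw [hfin]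
    exact CauchyKernel.tendsto_genSeries hq hq' hY0 hYv hzY hY
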